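/- **Setting.** For $t>0$ let $G_t(x)=(4\pi t)^{-d/2}e^{-|x|^2/(4t)}$ on $\mathbb R^d$, and for a measurable set $\Sigma\subset\mathbb R^d$ let $$E_t(\Sigma)=\int_{\mathbb R^d}(1-\mathbf 1_\Sigma)\,G_t*\mathbf 1_\Sigma\,dx\in[0,\infty].$$ Let $D=73547857887405865499600064\sqrt{133495318877644714344377}-23474745371243059566207357648855848671>0$, $c=\sqrt[3]{D}$, and $$\gamma_{4,2}=\frac{c-\frac{5551049511730043591353151}{c}-456109196575}{3627134098848},$$ $$\gamma_{4,3}=\frac{-5586815667458\,c+c^2+\frac{31012690382968488487137089701456460158}{c}+\frac{30814150681678355363112149018994128529535197628801}{c^2}+7974522440634228925392639}{18386964471851466374900016},$$ $$\gamma_{1,0}=1,\quad(\gamma_{2,0},\gamma_{2,1})=(-\tfrac14,\tfrac54),\quad(\gamma_{3,0},\gamma_{3,1},\gamma_{3,2})=(\tfrac56,-\tfrac23,\tfrac56),\quad\gamma_{4,1}=\tfrac12,\quad\gamma_{4,0}=1-\tfrac12-\gamma_{4,2}-\gamma_{4,3}.$$ Put $\beta_{1,0}=0$ and $\beta_{1,m}=1+\sum_{i=0}^{m-1}\gamma_{m,i}\beta_{1,i}$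 for $1\le m\le4$. Given a time step $\delta t>0$, put $\tau=\delta t/\beta_{1,4}$. One step $\Sigma^k\mapsto\Sigma^{k+1}$ of the four-stage threshold dynamics scheme is: $\bar\Sigma_0=\Sigma^k$, $$\bar\Sigma_m=\Big\{x:\ G_\tau*\sum_{i=0}^{m-1}\gamma_{m,i}\mathbf 1_{\bar\Sigma_i}(x)\ge\tfrac12\Big\}\quad(m=1,2,3,4),\qquad \Sigma^{k+1}=\bar\Sigma_4.$$ **Accuracy.** The scheme is *accurate of order $p$ in $\mathbb R^{n+1}$* (for motion by mean curvature) if the following holds. Let $\Sigma^0\subset\mathbb R^{n+1}$ be measurable, let $(x,z)\in\mathbb R^n\times\mathbb R$ be Cartesian coordinates on $\mathbb R^{n+1}$ with arbitrary origin and axes, let $T,r>0$, and let $f(x,t)$ be smooth on $\{|x|<r\}\times[0,T)$ with $$f_t=\frac{(1+|\nabla f|^2)\Delta f-D^2f(\nabla f,\nabla f)}{1+|\nabla f|^2},\qquad f(0,0)=0,\quad \nabla f(0,0)=0,$$ such that for $|x|<r$, $|z|<r$ one has $(x,z)\in\Sigma^0\iff z\le f(x,0)$. Then there are $\delta_0,\rho>0$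 and $C$ such that for every $\delta t\in(0,\delta_0)$ there is $z\in(-\rho,\rho)$ with $$\{z'\in(-\rho,\rho):(0,z')\in\Sigma^1\}=(-\rho,z]\qquad\text{and}\qquad |z-f(0,\delta t)|\le C\,\delta t^{\,p+1}.$$ **Theorem.** With the coefficients above: 1. (Unconditional energy stability, any dimension.) For every $d$, every $\delta t>0$ and every measurable $\Sigma^0\subset\mathbb R^d$, the iterates satisfy $E_\tau(\Sigma^{k+1})\le E_\tau(\Sigma^k)$ for all $k\ge0$. 2. (First order, any dimension.) The scheme is accurate of order $1$ in $\mathbb R^{n+1}$ for every $n\ge0$. 3. (Second order, two dimensions.) The scheme is accurate of order $2$ in $\mathbb R^{2}$. -/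

import Mathlib

noncomputable section

namespace ThresholdDynamics

open MeasureTheory Set
open scoped Convolution Gradient ContDiff

/-- `d`-dimensional Euclidean space. -/
abbrev Space (d : ℕ) : Type := EuclideanSpace ℝ (Fin d)

/-- The Gaussian kernel `G_t(x) = (4 π t)^(-d/2) exp(-|x|² / (4 t))` on `ℝ^d`. -/
def gaussKernel {d : ℕ} (t : ℝ) (x : Space d) : ℝ :=
  (4 * Real.pi * t) ^ (-(d : ℝ) / 2) * Real.exp (-‖x‖ ^ 2 / (4 * t))

/-- The characteristic function `𝟏_S` of a set `S`. -/
def indicatorFun {d : ℕ} (S : Set (Space d)) : Space d → ℝ :=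
  S.indicator fun _ => 1

/-- The energy `E_t(S) = ∫ (1 - 𝟏_S) (G_t * 𝟏_S) dx`, with values in `[0, ∞]`
(the integrand is nonnegative). -/
def energy {d : ℕ} (t : ℝ) (S : Set (Space d)) : ENNReal :=
  ∫⁻ x, ENNReal.ofReal ((1 - indicatorFun S x) * (gaussKernel t ⋆ indicatorFun S) x)

/-- The intermediate stages of the multistage threshold dynamics scheme with kernel `G_τ`,
started from `S`: stage `0` is `S`, and stage `m` is
`{x : (G_τ * ∑ i < m, γ_{m,i} 𝟏_{stage i}) x ≥ 1/2}`. -/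
def stage {d : ℕ} (γ : ℕ → ℕ → ℝ) (τ : ℝ) (S : Set (Space d)) : ℕ → Set (Space d)
  | 0 => S
  | m + 1 =>
    {x | 1 / 2 ≤ (gaussKernel τ ⋆
      fun y => ∑ i : Fin (m + 1), γ (m + 1) i * indicatorFun (stage γ τ S i) y) x}

/-- The coefficients `β_{1,m}`: `β_{1,0} = 0` and `β_{1,m} = 1 + ∑ i < m, γ_{m,i} β_{1,i}`. -/
def beta₁ (γ : ℕ → ℕ → ℝ) : ℕ → ℝ
  | 0 => 0
  | m + 1 => 1 + ∑ i : Fin (m + 1), γ (m + 1) i * beta₁ γ i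

/-- The width `τ = δt / β_{1,M}` of the kernel used by the `M`-stage scheme. -/
def kernelTime (γ : ℕ → ℕ → ℝ) (M : ℕ) (δt : ℝ) : ℝ :=
  δt / beta₁ γ M

/-- One time step `Σ^k ↦ Σ^{k+1}` of the `M`-stage scheme with time step size `δt`. -/
def step {d : ℕ} (γ : ℕ → ℕ → ℝ) (M : ℕ) (δt : ℝ) (S : Set (Space d)) : Set (Space d) :=
  stage γ (kernelTime γ M δt) S M

/-- The radicand of the cube roots in the coefficients below. -/
def radicand : ℝ :=
  73547857887405865499600064 * √133495318877644714344377
    - 23474745371243059566207357648855848671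

/-- The coefficient `γ_{4,2}`. -/
def gamma42 : ℝ :=
  (radicand ^ (1 / 3 : ℝ) - 5551049511730043591353151 / radicand ^ (1 / 3 : ℝ)
    - 456109196575) / 3627134098848

/-- The coefficient `γ_{4,3}`. -/
def gamma43 : ℝ :=
  (-5586815667458 * radicand ^ (1 / 3 : ℝ) + radicand ^ (2 / 3 : ℝ)
    + 31012690382968488487137089701456460158 / radicand ^ (1 / 3 : ℝ)
    + 30814150681678355363112149018994128529535197628801 / radicand ^ (2 / 3 : ℝ)
    + 7974522440634228925392639) / 18386964471851466374900016

/-- The coefficients `γ_{m,i}` (`1 ≤ m ≤ 4`, `0 ≤ i < m`) of the four-stage scheme. -/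
def gammaCoeff : ℕ → ℕ → ℝ
  | 1, 0 => 1
  | 2, 0 => -1 / 4
  | 2, 1 => 5 / 4
  | 3, 0 => 5 / 6
  | 3, 1 => -2 / 3
  | 3, 2 => 5 / 6
  | 4, 0 => 1 - 1 / 2 - gamma42 - gamma43
  | 4, 1 => 1 / 2
  | 4, 2 => gamma42
  | 4, 3 => gamma43
  | _, _ => 0

/-- The right-hand side of the equation `f_t = …` of motion by mean curvature of a graph:
`((1 + |∇u|²) Δu - D²u(∇u, ∇u)) / (1 + |∇u|²)`. For `u = u(x, y)` this is
`(u_xx (1 + u_y²) - 2 u_x u_y u_xy + u_yy (1 + u_x²)) / (1 + u_x² + u_y²)`. -/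
def graphMeanCurvatureSpeed {n : ℕ} (u : Space n → ℝ) (x : Space n) : ℝ :=
  ((1 + ‖∇ u x‖ ^ 2) * Laplacian.laplacian u x
    - iteratedFDeriv ℝ 2 u x ![∇ u x, ∇ u x]) / (1 + ‖∇ u x‖ ^ 2)

/-- `f(·, t)`, `0 ≤ t < T`, is a smooth (up to `t = 0`) motion by mean curvature of graphs over
the ball of radius `r` about the origin of `ℝ^n`. The first argument of `f` is the time. -/
structure IsGraphMotionByMeanCurvature {n : ℕ} (T r : ℝ) (f : ℝ → Space n → ℝ) : Prop where
  smooth : ContDiffOn ℝ ∞ (fun p : ℝ × Space n => f p.1 p.2) (Ico 0 T ×ˢ Metric.ball 0 r)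
  equation : ∀ t ∈ Ico 0 T, ∀ x ∈ Metric.ball (0 : Space n) r,
    derivWithin (fun s => f s x) (Ico 0 T) t = graphMeanCurvatureSpeed (f t) x

/-- Cartesian coordinates `(x, z) ∈ ℝ^n × ℝ` on `ℝ^(n+1)`: origin and axes are arbitrary. -/
abbrev CartesianCoords (n : ℕ) : Type :=
  WithLp 2 (Space n × ℝ) ≃ᵃⁱ[ℝ] Space (n + 1)

/-- The point with coordinates `(x, z)`. -/
def CartesianCoords.point {n : ℕ} (e : CartesianCoords n) (x : Space n) (z : ℝ) : Space (n + 1) :=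
  e (WithLp.toLp 2 (x, z))

/-- A scheme `Φ δt : Σ^k ↦ Σ^{k+1}` in `ℝ^(n+1)` is accurate of order `p` in time for motion by
mean curvature. Let `S` be, near a point of its boundary, the region below the graph of `f(·, 0)`
in Cartesian coordinates centred at that point, where `f` moves by mean curvature and
`f(0, 0) = 0`, `∇f(0, 0) = 0`. Then after one time step the interface meets the `z`-axis,
near the origin, in exactly one point, and the height `z` of that point is `f(0, δt)` up to
`O(δt^(p+1))`. -/
def IsAccurateOfOrder (n p : ℕ) (Φ : ℝ → Set (Space (n + 1)) → Set (Space (n + 1))) : Prop :=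
  ∀ (S : Set (Space (n + 1))) (e : CartesianCoords n) (T r : ℝ) (f : ℝ → Space n → ℝ),
    MeasurableSet S → 0 < T → 0 < r → IsGraphMotionByMeanCurvature T r f →
    f 0 0 = 0 → ∇ (f 0) 0 = 0 →
    (∀ x ∈ Metric.ball (0 : Space n) r, ∀ z ∈ Ioo (-r) r, e.point x z ∈ S ↔ z ≤ f 0 x) →
    ∃ δ₀ > 0, ∃ ρ > 0, ∃ C : ℝ, ∀ δt ∈ Ioo 0 δ₀, ∃ z ∈ Ioo (-ρ) ρ,
      (∀ z' ∈ Ioo (-ρ) ρ, e.point 0 z' ∈ Φ δt S ↔ z' ≤ z) ∧ |z - f δt 0| ≤ C * δt ^ (p + 1)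

end ThresholdDynamics

end

/-!
The three parts rest on two independent arguments.

**Energy stability.** The energy is the quadratic functional `∫ (1 - u) Gu` of the indicator
function `u`, where `G` is the averaging operator `heatAvg`. If the initial energy is infinite there
is nothing to prove. Otherwise all stages differ from the initial set `S` by sets of finite measure
(`integrable_stage_sub`), and the energy of a stage can be expanded about `S`
(`energyDensity_expansion`). By definition, each stage minimizes an energy that is linearized about
a combination of its predecessors (`stage_minimizes`). The sum of these four inequalities, each
stage being compared with the preceding one, bounds the energy increment by `∑ M i j ∫ φ i G(φ j)`,
where `φ i` is the difference of the indicator functions of a stage and of `S`, and `M` is an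
explicit 4 × 4 matrix (`stabilityMatrix`). The form of `M` is negative semidefinite
(`stability_form_nonneg`), and as the Gaussian has a positive Fourier transform this persists when
`G` is inserted (`integral_form_heatAvg_nonpos`).

**Accuracy.** All lengths are rescaled by `ε = √τ`, so that the averaging is over a Gaussian `μ` of
covariance twice the identity, and near the origin the initial set becomes the subgraph
`η ≤ ε h 0 ε ξ` of a flat function, with an error `O(ε^(k+1))` that grows polynomially in `ξ`. This
is the notion `IsSubgraphUpTo`; it says nothing about heights `|η| ≥ R / ε`, where the weight of the
Gaussian is negligible. The average of the indicator function of such a region is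
`1 / 2 + ∫ Ψ(ε h(ξ + y) - η) dμ(y)` up to `O(ε^(k+1))`, where `Ψ` is the primitive of the Gaussian
density with `Ψ 0 = 0` (`IsSubgraphUpTo.regionAvg_sub`), and `Ψ(ε u) ≈ g(0) ε (u - ε² u³ / 12)`. So
the next stage is again close to a subgraph, of every function `h'` for which

  `∑ γ i ∫ (u i - ε² (u i)³ / 12) dμ = O(ε^k)`,  where `u i y = h i (ξ + y) - h' ξ`

(`stageDefect`, `IsSubgraphUpTo.next_stage`). On the axis the thresholded function of the last stage
is moreover strictly decreasing near the origin, so that there is exactly one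
crossing (`IsSubgraphUpTo.exists_crossing`). By `accurate_of_heights`, it remains to exhibit heights
that solve these equations, start from the Taylor polynomial of the initial height, and end at the Taylor
polynomial of the motion at time `β_4 ε²`. Here `k = 2 p` for accuracy of order `p`.

For order one, the heights are the quadratic Taylor polynomial of `f 0` plus `β_m Δf`, followed by
an odd correction of relative order `ε`, which vanishes on the axis (`isAccurateOfOrder_one`).

For order two in the plane, let `κ, c, q, e` be the second to fifth derivative of `f 0`. The heights
are explicit polynomials (`lineHeight`) whose value on the axis is
`κ β_m + ε² (q δ_m + κ³ b_m)`, with recursively defined `δ_m` (`biharmonicCoeff`) and `b_m`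
(`curvatureCubeCoeff`). The equation `f_t = f_xx / (1 + f_x²)` gives
`f(t, 0) = κ t + (q - 2 κ³) t² / 2 + O(t³)` (`dt_dt_of_curveShortening`). These agree at
`t = β_4 ε²` precisely if `δ_4 = β_4² / 2` and `b_4 = -β_4²`. These are two
polynomial equations in `γ_{4,2}` and `γ_{4,3}`. The given values are polynomials in the real root
of a cubic, in Cardano's form, and that cubic implies both equations (`cardanoRoot_cubic`,
`biharmonicCoeff_four`, `curvatureCubeCoeff_four`).
-/

noncomputable section

namespace ThresholdDynamics

open MeasureTheory Set ProbabilityTheory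
open scoped Convolution Gradient ContDiff

/-! ### The coefficients of the four-stage scheme -/

/-- The coefficient `δ_m` of `t² f_xxxx` in the height of the `m`-th stage. -/
def biharmonicCoeff (γ : ℕ → ℕ → ℝ) : ℕ → ℝ
  | 0 => 0
  | m + 1 => 1 / 2 + ∑ i : Fin (m + 1), γ (m + 1) i * (beta₁ γ i + biharmonicCoeff γ i)

/-- The coefficient `b_m` of `t² f_xx³` in the height of the `m`-th stage. -/
def curvatureCubeCoeff (γ : ℕ → ℕ → ℝ) : ℕ → ℝ
  | 0 => 0
  | m + 1 => ∑ i : Fin (m + 1), γ (m + 1) i * (curvatureCubeCoeff γ i - 2 * beta₁ γ i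
      - (15 + 9 * (beta₁ γ i - beta₁ γ (m + 1)) + 3 * (beta₁ γ i - beta₁ γ (m + 1)) ^ 2
        + (beta₁ γ i - beta₁ γ (m + 1)) ^ 3) / 12)

lemma radicand_pos : 0 < radicand := by
  have h : (23474745371243059566207357648855848671 / 73547857887405865499600064 : ℝ)
      < √133495318877644714344377 := by
    apply Real.lt_sqrt_of_sq_lt
    norm_num
  rw [div_lt_iff₀ (by norm_num)] at h
  unfold radicand
  linarith

/-- The Cardano combination `c - P / c`, in which both `γ_{4,2}` and `γ_{4,3}` are polynomials. -/
def cardanoRoot : ℝ :=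
  radicand ^ (1 / 3 : ℝ) - 5551049511730043591353151 / radicand ^ (1 / 3 : ℝ)

lemma radicand_rpow_cube : (radicand ^ (1 / 3 : ℝ)) ^ 3 = radicand := by
  rw [← Real.rpow_natCast, ← Real.rpow_mul radicand_pos.le]
  norm_num

/-- Cardano's formula: `c³ = D` is a root of `X² + 2 Q X - P³`, so that `c - P / c` is a root of
`X³ + 3 P X + 2 Q`. -/
lemma cardanoRoot_cubic :
    cardanoRoot ^ 3 + 3 * 5551049511730043591353151 * cardanoRoot
      + 2 * 23474745371243059566207357648855848671 = 0 := by
  have hc := radicand_rpow_cube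
  have hpos : 0 < radicand ^ (1 / 3 : ℝ) := Real.rpow_pos_of_pos radicand_pos _
  unfold cardanoRoot
  set c := radicand ^ (1 / 3 : ℝ)
  have hs : √133495318877644714344377 ^ 2 = (133495318877644714344377 : ℝ) :=
    Real.sq_sqrt (by norm_num)
  unfold radicand at hc
  have h6 : c ^ 6 + 2 * 23474745371243059566207357648855848671 * c ^ 3
      - 5551049511730043591353151 ^ 3 = 0 := by
    have : c ^ 6 = (c ^ 3) ^ 2 := by ring
    rw [this, hc]
    linear_combination (73547857887405865499600064 : ℝ) ^ 2 * hs
  have h3 : c ^ 3 ≠ 0 := by positivity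
  have hq : c ≠ 0 := hpos.ne'
  apply mul_left_cancel₀ h3
  rw [mul_zero, ← h6]
  field_simp
  ring

lemma gamma42_eq : gamma42 = (cardanoRoot - 456109196575) / 3627134098848 := rfl

lemma gamma43_eq : gamma43 = (cardanoRoot ^ 2 - 5586815667458 * cardanoRoot
    + (7974522440634228925392639 + 2 * 5551049511730043591353151))
      / 18386964471851466374900016 := by
  have hpos : 0 < radicand ^ (1 / 3 : ℝ) := Real.rpow_pos_of_pos radicand_pos _
  have h2 : radicand ^ (2 / 3 : ℝ) = (radicand ^ (1 / 3 : ℝ)) ^ 2 := by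
    rw [← Real.rpow_natCast, ← Real.rpow_mul radicand_pos.le]
    norm_num
  unfold gamma43 cardanoRoot
  rw [h2]
  field_simp
  ring

lemma gammaCoeff_four_zero : gammaCoeff 4 0 = 1 - 1 / 2 - gamma42 - gamma43 := rfl
lemma gammaCoeff_four_one : gammaCoeff 4 1 = 1 / 2 := rfl
lemma gammaCoeff_four_two : gammaCoeff 4 2 = gamma42 := rfl
lemma gammaCoeff_four_three : gammaCoeff 4 3 = gamma43 := rfl

lemma sum_gammaCoeff : ∀ m < 4, ∑ i : Fin (m + 1), gammaCoeff (m + 1) i = 1 := by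
  intro m hm
  interval_cases m <;> simp [Fin.sum_univ_succ, gammaCoeff] <;> ring

lemma beta_one : beta₁ gammaCoeff 1 = 1 := by
  simp [beta₁]

lemma beta_two : beta₁ gammaCoeff 2 = 9 / 4 := by
  rw [beta₁]
  simp [Fin.sum_univ_succ, gammaCoeff, beta_one, show beta₁ gammaCoeff 0 = 0 from by rw [beta₁]]
  norm_num

lemma beta_three : beta₁ gammaCoeff 3 = 53 / 24 := by
  rw [beta₁]
  simp [Fin.sum_univ_succ, gammaCoeff, beta_one, beta_two,
    show beta₁ gammaCoeff 0 = 0 from by rw [beta₁]]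
  norm_num

lemma beta_four : beta₁ gammaCoeff 4 = 3 / 2 + 9 / 4 * gamma42 + 53 / 24 * gamma43 := by
  rw [beta₁]
  simp [Fin.sum_univ_succ, gammaCoeff, beta_one, beta_two, beta_three,
    show beta₁ gammaCoeff 0 = 0 from by rw [beta₁]]
  ring

/-- The first condition for second order accuracy: `β_4² / 2` is the coefficient of `f_xxxx` in the
Taylor expansion of the motion at time `β_4`. Both sides are polynomials in `cardanoRoot`, and their
difference is a multiple of its cubic. -/
lemma biharmonicCoeff_four :
    biharmonicCoeff gammaCoeff 4 = beta₁ gammaCoeff 4 ^ 2 / 2 := by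
  have h0 : beta₁ gammaCoeff 0 = 0 := by rw [beta₁]
  have e0 : biharmonicCoeff gammaCoeff 0 = 0 := by rw [biharmonicCoeff]
  have e1 : biharmonicCoeff gammaCoeff 1 = 1 / 2 := by
    rw [biharmonicCoeff]; simp [h0, e0]
  have e2 : biharmonicCoeff gammaCoeff 2 = 19 / 8 := by
    rw [biharmonicCoeff]; simp [Fin.sum_univ_succ, gammaCoeff, h0, e0, e1, beta_one]; norm_num
  have e3 : biharmonicCoeff gammaCoeff 3 = 161 / 48 := by
    rw [biharmonicCoeff]
    simp [Fin.sum_univ_succ, gammaCoeff, h0, e0, e1, e2, beta_one, beta_two]; norm_num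
  have e4 : biharmonicCoeff gammaCoeff 4 = 5 / 4 + 37 / 8 * gamma42 + 267 / 48 * gamma43 := by
    rw [biharmonicCoeff]
    simp [Fin.sum_univ_succ, gammaCoeff, h0, e0, e1, e2, e3, beta_one, beta_two, beta_three]; ring
  rw [e4, beta_four, gamma42_eq, gamma43_eq]
  linear_combination
    (1185081015171593 / 194734346393737770513869097058319105239833982156947456
      - 2809 / 389468692787475541027738194116638210479667964313894912 * cardanoRoot)
    * cardanoRoot_cubic

/-- The second condition for second order accuracy: `-β_4²` is the coefficient of `f_xx³` in the
Taylor expansion of the motion at time `β_4`. -/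
lemma curvatureCubeCoeff_four :
    curvatureCubeCoeff gammaCoeff 4 = -beta₁ gammaCoeff 4 ^ 2 := by
  have h0 : beta₁ gammaCoeff 0 = 0 := by rw [beta₁]
  have e0 : curvatureCubeCoeff gammaCoeff 0 = 0 := by rw [curvatureCubeCoeff]
  have e1 : curvatureCubeCoeff gammaCoeff 1 = -2 / 3 := by
    rw [curvatureCubeCoeff]; simp [gammaCoeff, h0, e0, beta_one]; norm_num
  have e2 : curvatureCubeCoeff gammaCoeff 2 = -517 / 128 := by
    rw [curvatureCubeCoeff]
    simp [Fin.sum_univ_succ, gammaCoeff, h0, e0, e1, beta_one, beta_two]; norm_num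
  have e3 : curvatureCubeCoeff gammaCoeff 3 = -247225 / 41472 := by
    rw [curvatureCubeCoeff]
    simp [Fin.sum_univ_succ, gammaCoeff, h0, e0, e1, e2, beta_one, beta_two, beta_three]; norm_num
  rw [curvatureCubeCoeff]
  simp only [Fin.sum_univ_succ, Fin.val_zero, Fin.val_succ, Finset.univ_eq_empty,
    Finset.sum_empty, zero_add, Nat.reduceAdd, gammaCoeff_four_zero, gammaCoeff_four_one,
    gammaCoeff_four_two, gammaCoeff_four_three, h0, e0, e1, e2, e3, beta_one, beta_two, beta_three,
    beta_four]
  rw [gamma42_eq, gamma43_eq]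
  linear_combination
    (598297226529393271228553288858408705616761
        / 128900646309271432007579846530548907190701757094831604377234970075937223560134656
      + 1263413311 / 141124759768927337242482990114552088843728646205068449153024 * cardanoRoot
      + 62809293804094429
        / 171867528412361909343439795374065209587602342793108805836313293434582964746846208
        * cardanoRoot ^ 2
      - 148877
        / 515602585237085728030319386122195628762807028379326417508939880303748894240538624
        * cardanoRoot ^ 3)
    * cardanoRoot_cubic

lemma cardanoRoot_mem : cardanoRoot ∈ Ioo (-2189500000000 : ℝ) (-2189100000000) := by
  have h := cardanoRoot_cubic
  constructor
  · by_contra! hc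
    nlinarith [mul_nonneg (sq_nonneg cardanoRoot) (sub_nonneg.2 hc), sq_nonneg cardanoRoot]
  · by_contra! hc
    have : 0 ≤ (cardanoRoot + 2189100000000) * (cardanoRoot ^ 2 - 2189100000000 * cardanoRoot
      + 2189100000000 ^ 2) := mul_nonneg (by linarith) (by nlinarith [sq_nonneg cardanoRoot])
    nlinarith

lemma gamma42_mem : gamma42 ∈ Ioo (-0.7294 : ℝ) (-0.7292) := by
  have := cardanoRoot_mem
  rw [gamma42_eq]
  constructor
  · rw [lt_div_iff₀ (by norm_num)]; norm_num; linarith [this.1]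
  · rw [div_lt_iff₀ (by norm_num)]; norm_num; linarith [this.2]

lemma gamma43_mem : gamma43 ∈ Ioo (1.963 : ℝ) 1.9637 := by
  have := cardanoRoot_mem
  rw [gamma43_eq]
  constructor
  · rw [lt_div_iff₀ (by norm_num)]; norm_num; nlinarith [this.1, this.2]
  · rw [div_lt_iff₀ (by norm_num)]; norm_num; nlinarith [this.1, this.2]

lemma beta_four_pos : 0 < beta₁ gammaCoeff 4 := by
  rw [beta_four]
  have := gamma42_mem.1
  have := gamma43_mem.1
  norm_num at *
  linarith

/-- The quadratic form that controls the energy decay of the four-stage scheme, see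
`stabilityMatrix`. -/
lemma stability_form_nonneg (p₁ p₂ p₃ p₄ : ℝ) :
    2 * ((p₂ - p₁) * (5 / 4 * p₁) + (p₃ - p₂) * (-2 / 3 * p₁ + 5 / 6 * p₂)
      + (p₄ - p₃) * (1 / 2 * p₁ + gamma42 * p₂ + gamma43 * p₃)) ≤ p₄ ^ 2 := by
  obtain ⟨hx₁, hx₂⟩ := gamma42_mem
  obtain ⟨hy₁, hy₂⟩ := gamma43_mem
  set x := gamma42
  set y := gamma43
  -- `x` and `y` are moved to the midpoints of their enclosures at the cost of small squares
  have hx : 2 * ((p₄ - p₃) * p₂) * (x + 0.7293) ≤ 0.0001 * ((p₄ - p₃) ^ 2 + p₂ ^ 2) := by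
    nlinarith [mul_nonneg (sq_nonneg (p₄ - p₃ - p₂)) (by norm_num at *; linarith : 0 ≤ x + 0.7294),
      mul_nonneg (sq_nonneg (p₄ - p₃ + p₂)) (by norm_num at *; linarith : 0 ≤ -0.7292 - x)]
  have hy : 2 * ((p₄ - p₃) * p₃) * (y - 1.96335) ≤ 0.00035 * ((p₄ - p₃) ^ 2 + p₃ ^ 2) := by
    nlinarith [mul_nonneg (sq_nonneg (p₄ - p₃ - p₃)) (by norm_num at *; linarith : 0 ≤ y - 1.963),
      mul_nonneg (sq_nonneg (p₄ - p₃ + p₃)) (by norm_num at *; linarith : 0 ≤ 1.9637 - y)]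
  -- completing the square in `p₄`, then in `p₁`, then in `p₂`, leaves a positive multiple of `p₃²`
  have h₄ := sq_nonneg (p₄ - 10000 / 19991 * p₁ + 14586 / 19991 * p₂ - 39258 / 19991 * p₃)
  have h₁ := sq_nonneg (p₁ - 372277 / 539730 * p₂ + 22163 / 269865 * p₃)
  have h₂ := sq_nonneg (p₂ - 4854421 / 103731049 * p₃)
  nlinarith [sq_nonneg p₃]

/-! ### The heat kernel as a probability measure -/

/-- The law with density `G_1` on `ℝ^d`, i.e. the centred Gaussian law with covariance `2 I`. -/
def gaussMeasure (d : ℕ) : Measure (Space d) :=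
  (stdGaussian (Space d)).map fun x => √2 • x

instance (d : ℕ) : IsProbabilityMeasure (gaussMeasure d) :=
  Measure.isProbabilityMeasure_map (by fun_prop)

instance (d : ℕ) : IsGaussian (gaussMeasure d) := by
  have : (fun x : Space d => √2 • x) = ⇑((√2 : ℝ) • ContinuousLinearMap.id ℝ (Space d) :
      Space d →L[ℝ] Space d) := rfl
  rw [gaussMeasure, this]
  infer_instance

lemma charFun_gaussMeasure {d : ℕ} (t : Space d) :
    charFun (gaussMeasure d) t = Complex.exp (-‖t‖ ^ 2) := by
  rw [gaussMeasure, charFun_map_smul, charFun_stdGaussian, norm_smul]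
  congr 1
  have : (√2 : ℝ) ^ 2 = 2 := Real.sq_sqrt (by norm_num)
  rw [← Complex.ofReal_pow, mul_pow, Real.norm_eq_abs, sq_abs, this]
  push_cast
  ring

lemma gaussKernel_nonneg {d : ℕ} {t : ℝ} (ht : 0 < t) (x : Space d) : 0 ≤ gaussKernel t x := by
  unfold gaussKernel; positivity

lemma continuous_gaussKernel {d : ℕ} (t : ℝ) : Continuous (gaussKernel (d := d) t) := by
  unfold gaussKernel; fun_prop

lemma gaussKernel_one {d : ℕ} (x : Space d) :
    gaussKernel 1 x = (4 * Real.pi) ^ (-(d : ℝ) / 2) * Real.exp (-(1 / 4) * ‖x‖ ^ 2) := by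
  unfold gaussKernel
  congr 2 <;> ring

lemma integrable_gaussKernel_one {d : ℕ} : Integrable (gaussKernel (d := d) 1) := by
  have h := GaussianFourier.integrable_cexp_neg_mul_sq_norm_add (b := ((1 / 4 : ℝ) : ℂ))
    (by norm_num) 0 (0 : Space d)
  have h2 := (h.re).const_mul ((4 * Real.pi) ^ (-(d : ℝ) / 2))
  refine h2.congr (.of_forall fun x => ?_)
  simp only [gaussKernel_one]
  congr 1
  rw [zero_mul, add_zero]
  norm_cast

lemma gaussMeasure_eq_withDensity (d : ℕ) :
    gaussMeasure d = volume.withDensity fun x => ENNReal.ofReal (gaussKernel 1 x) := by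
  have : IsFiniteMeasure
      ((volume : Measure (Space d)).withDensity fun x => ENNReal.ofReal (gaussKernel 1 x)) :=
    isFiniteMeasure_withDensity_ofReal integrable_gaussKernel_one.2
  apply Measure.ext_of_charFun
  ext t
  rw [charFun_gaussMeasure, charFun_apply, integral_withDensity_eq_integral_toReal_smul
    (by have := continuous_gaussKernel (d := d) 1; fun_prop) (by simp)]
  have h := GaussianFourier.integral_cexp_neg_mul_sq_norm_add (b := ((1 / 4 : ℝ) : ℂ))
    (by norm_num) Complex.I t
  have hpi : (0 : ℝ) < 4 * Real.pi := by positivity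
  have : ∀ x : Space d, (ENNReal.ofReal (gaussKernel 1 x)).toReal •
      Complex.exp ((inner ℝ x t : ℝ) * Complex.I) = ((4 * Real.pi) ^ (-(d : ℝ) / 2) : ℝ) *
      Complex.exp (-((1 / 4 : ℝ) : ℂ) * ‖x‖ ^ 2 + Complex.I * (inner ℝ t x : ℝ)) := by
    intro x
    rw [ENNReal.toReal_ofReal (gaussKernel_nonneg one_pos x), gaussKernel_one, Complex.exp_add,
      real_inner_comm, Complex.real_smul]
    push_cast
    ring_nf
  simp_rw [this]
  rw [integral_const_mul, h]
  have e1 : (Real.pi : ℂ) / ((1 / 4 : ℝ) : ℂ) = ((4 * Real.pi : ℝ) : ℂ) := by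
    push_cast; ring
  have e2 : ((Module.finrank ℝ (Space d) : ℂ) / 2) = (((d : ℝ) / 2 : ℝ) : ℂ) := by
    simp
  rw [e1, e2, ← Complex.ofReal_cpow hpi.le, ← mul_assoc, ← Complex.ofReal_mul,
    ← Real.rpow_add hpi, show -(d : ℝ) / 2 + d / 2 = 0 by ring, Real.rpow_zero, Complex.ofReal_one,
    one_mul]
  congr 1
  rw [Complex.I_sq]
  push_cast
  ring

lemma integral_gaussMeasure {d : ℕ} {E : Type*} [NormedAddCommGroup E] [NormedSpace ℝ E]
    (f : Space d → E) :
    ∫ x, f x ∂gaussMeasure d = ∫ x, gaussKernel 1 x • f x := by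
  rw [gaussMeasure_eq_withDensity, integral_withDensity_eq_integral_toReal_smul
    (by have := continuous_gaussKernel (d := d) 1; fun_prop) (by simp)]
  simp_rw [ENNReal.toReal_ofReal (gaussKernel_nonneg one_pos _)]

lemma gaussMeasure_map_neg (d : ℕ) : (gaussMeasure d).map (fun x => -x) = gaussMeasure d := by
  have : IsProbabilityMeasure ((gaussMeasure d).map fun x => -x) :=
    Measure.isProbabilityMeasure_map (by fun_prop)
  apply Measure.ext_of_charFun
  ext t
  have := charFun_map_smul (μ := gaussMeasure d) (-1) t
  simp only [neg_one_smul] at this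
  rw [this, charFun_gaussMeasure, charFun_gaussMeasure, norm_neg]

lemma integral_gaussMeasure_neg {d : ℕ} {E : Type*} [NormedAddCommGroup E] [NormedSpace ℝ E]
    (f : Space d → E) :
    ∫ x, f (-x) ∂gaussMeasure d = ∫ x, f x ∂gaussMeasure d := by
  conv_rhs => rw [← gaussMeasure_map_neg]
  exact ((Homeomorph.neg (Space d)).measurableEmbedding.integral_map f).symm

/-- Convolution with `G_t` is the average over `√t` times a Gaussian vector. -/
lemma gaussKernel_convolution {d : ℕ} {t : ℝ} (ht : 0 < t) (f : Space d → ℝ) (x : Space d) :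
    (gaussKernel t ⋆ f) x = ∫ w, f (x + √t • w) ∂gaussMeasure d := by
  have hs : 0 < √t := Real.sqrt_pos.2 ht
  rw [← integral_gaussMeasure_neg, integral_gaussMeasure]
  rw [convolution_lsmul]
  have h := Measure.integral_comp_smul (volume : Measure (Space d))
    (fun w => gaussKernel t w • f (x - w)) √t
  have h3 : (√t ^ d) ≠ 0 := by positivity
  have h2 : ∀ w : Space d, gaussKernel t (√t • w) = (√t ^ d)⁻¹ * gaussKernel 1 w := by
    intro w
    have h4 : (t : ℝ) ^ (-(d : ℝ) / 2) = (√t ^ d)⁻¹ := by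
      rw [Real.sqrt_eq_rpow, ← Real.rpow_natCast, ← Real.rpow_mul ht.le, ← Real.rpow_neg ht.le]
      congr 1; ring
    unfold gaussKernel
    rw [Real.mul_rpow (by positivity) ht.le, h4, norm_smul, mul_pow, Real.norm_eq_abs,
      abs_of_pos hs, Real.sq_sqrt ht.le, mul_one, mul_one,
      show -(t * ‖w‖ ^ 2) / (4 * t) = -‖w‖ ^ 2 / 4 by field_simp]
    ring
  simp only [h2] at h
  simp only [smul_neg, ← sub_eq_add_neg]
  rw [abs_of_pos (by positivity)] at h
  simp only [mul_smul] at h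
  rw [integral_smul] at h
  rw [finrank_euclideanSpace_fin] at h
  exact (smul_right_injective ℝ (inv_ne_zero h3) h).symm

/-- In Cartesian coordinates the Gaussian law on `ℝ^(n+1)` splits as a product. -/
lemma gaussMeasure_succ {n : ℕ} (L : WithLp 2 (Space n × ℝ) ≃ₗᵢ[ℝ] Space (n + 1)) :
    gaussMeasure (n + 1) = ((gaussMeasure n).prod (gaussianReal 0 2)).map
      fun p => L (WithLp.toLp 2 p) := by
  have hm : Measurable fun p : Space n × ℝ => L (WithLp.toLp 2 p) :=
    L.continuous.measurable.comp (by fun_prop)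
  have : IsProbabilityMeasure (((gaussMeasure n).prod (gaussianReal 0 2)).map
      fun p => L (WithLp.toLp 2 p)) :=
    Measure.isProbabilityMeasure_map hm.aemeasurable
  apply Measure.ext_of_charFun
  ext t
  have h1 : ((gaussMeasure n).prod (gaussianReal 0 2)).map (fun p => L (WithLp.toLp 2 p))
      = (((gaussMeasure n).prod (gaussianReal 0 2)).map (WithLp.toLp 2)).map L := by
    rw [Measure.map_map L.continuous.measurable (by fun_prop)]
    rfl
  have h2 : charFun ((((gaussMeasure n).prod (gaussianReal 0 2)).map (WithLp.toLp 2)).map L) t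
      = charFun (((gaussMeasure n).prod (gaussianReal 0 2)).map (WithLp.toLp 2)) (L.symm t) := by
    rw [charFun_apply, charFun_apply, integral_map L.continuous.aemeasurable
      (by fun_prop)]
    congr with x
    rw [← L.inner_map_map, L.apply_symm_apply]
  rw [h1, h2, charFun_prod, charFun_gaussMeasure, charFun_gaussMeasure, charFun_gaussianReal,
    ← Complex.exp_add]
  congr 1
  have h3 : ‖t‖ ^ 2 = ‖(L.symm t).ofLp.1‖ ^ 2 + ‖(L.symm t).ofLp.2‖ ^ 2 := by
    rw [← L.symm.norm_map t, WithLp.prod_norm_sq_eq_of_L2]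
    rfl
  rw [← Complex.ofReal_pow, h3]
  push_cast
  rw [← Complex.ofReal_pow ‖(L.symm t).ofLp.2‖, Real.norm_eq_abs, sq_abs]
  push_cast
  ring

/-! ### Moments -/

lemma integrable_one_add_norm_pow {E : Type*} [NormedAddCommGroup E] [NormedSpace ℝ E]
    [MeasurableSpace E] [BorelSpace E] [CompleteSpace E] [SecondCountableTopology E]
    (μ : Measure E) [IsGaussian μ] (N : ℕ) : Integrable (fun x => (1 + ‖x‖) ^ N) μ := by
  have hid : MemLp (fun x : E => x) (N : ENNReal) μ :=
    IsGaussian.memLp_id μ _ (ENNReal.natCast_ne_top N)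
  have hc : MemLp (fun _ : E => (1 : ℝ)) (N : ENNReal) μ := memLp_const 1
  have h : MemLp (fun x : E => 1 + ‖x‖) (N : ENNReal) μ := hc.add hid.norm
  refine h.integrable_norm_pow'.congr (.of_forall fun x => ?_)
  simp only [Real.norm_eq_abs]
  rw [abs_of_nonneg (by positivity)]

lemma integrable_pow_gaussianReal (k : ℕ) : Integrable (fun s : ℝ => s ^ k) (gaussianReal 0 2) := by
  refine (integrable_one_add_norm_pow (gaussianReal 0 2) k).mono' (by fun_prop) (.of_forall ?_)
  intro s
  rw [norm_pow]
  gcongr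
  linarith

/-- The density `(4 π)^(-1/2) exp (-s² / 4)` of the one-dimensional kernel. -/
def gaussDensity (s : ℝ) : ℝ := gaussianPDFReal 0 2 s

lemma gaussDensity_eq (s : ℝ) :
    gaussDensity s = gaussDensity 0 * Real.exp (-s ^ 2 / 4) := by
  unfold gaussDensity gaussianPDFReal
  norm_num

lemma gaussDensity_pos (s : ℝ) : 0 < gaussDensity s :=
  gaussianPDFReal_pos _ _ _ (by norm_num)

lemma hasDerivAt_gaussDensity (s : ℝ) :
    HasDerivAt gaussDensity (-(s / 2) * gaussDensity s) s := by
  have h : HasDerivAt (fun s : ℝ => gaussDensity 0 * Real.exp (-s ^ 2 / 4))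
      (gaussDensity 0 * (Real.exp (-s ^ 2 / 4) * (-(2 * s) / 4))) s := by
    have := ((((hasDerivAt_id s).pow 2).neg.div_const 4).exp).const_mul (gaussDensity 0)
    simpa using this
  have h2 : gaussDensity = fun s : ℝ => gaussDensity 0 * Real.exp (-s ^ 2 / 4) :=
    funext gaussDensity_eq
  rw [gaussDensity_eq s]
  convert h using 1
  · ring

lemma integral_gaussianReal (f : ℝ → ℝ) :
    ∫ s, f s ∂gaussianReal 0 2 = ∫ s, gaussDensity s * f s := by
  rw [integral_gaussianReal_eq_integral_smul (by norm_num)]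
  rfl

lemma integrable_gaussianReal_iff {f : ℝ → ℝ} :
    Integrable f (gaussianReal 0 2) ↔ Integrable fun s => gaussDensity s * f s := by
  rw [gaussianReal_of_var_ne_zero 0 (by norm_num), integrable_withDensity_iff_integrable_smul₀'
    (by fun_prop) (by simp [gaussianPDF])]
  simp only [toReal_gaussianPDF, smul_eq_mul]
  rfl

lemma moment_add_two (k : ℕ) :
    ∫ s, s ^ (k + 2) ∂gaussianReal 0 2 = 2 * (k + 1) * ∫ s, s ^ k ∂gaussianReal 0 2 := by
  have i1 := integrable_gaussianReal_iff.1 (integrable_pow_gaussianReal (k + 2))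
  have i2 := integrable_gaussianReal_iff.1 (integrable_pow_gaussianReal k)
  have i3 := integrable_gaussianReal_iff.1 (integrable_pow_gaussianReal (k + 1))
  have h := integral_mul_deriv_eq_deriv_mul_of_integrable (u := fun s : ℝ => s ^ (k + 1))
    (v := gaussDensity) (u' := fun s => (k + 1 : ℝ) * s ^ k)
    (v' := fun s => -(s / 2) * gaussDensity s)
    (fun s _ => by simpa using hasDerivAt_pow (k + 1) s)
    (fun s _ => hasDerivAt_gaussDensity s)
    ((i1.const_mul (-1 / 2)).congr (.of_forall fun s => by simp only [Pi.mul_apply]; ring))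
    ((i2.const_mul (k + 1)).congr (.of_forall fun s => by simp only [Pi.mul_apply]; ring))
    (i3.congr (.of_forall fun s => by simp only [Pi.mul_apply]; ring))
  rw [integral_gaussianReal, integral_gaussianReal]
  have e1 : ∫ s : ℝ, s ^ (k + 1) * (-(s / 2) * gaussDensity s)
      = (-1 / 2) * ∫ s, gaussDensity s * s ^ (k + 2) := by
    rw [← integral_const_mul]; congr with s; ring
  have e2 : ∫ s : ℝ, (k + 1 : ℝ) * s ^ k * gaussDensity s
      = (k + 1) * ∫ s, gaussDensity s * s ^ k := by
    rw [← integral_const_mul]; congr with s; ring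
  rw [e1, e2] at h
  linarith

lemma moment_zero : ∫ s : ℝ, s ^ 0 ∂gaussianReal 0 2 = 1 := by simp

lemma moment_one : ∫ s : ℝ, s ^ 1 ∂gaussianReal 0 2 = 0 := by simp

lemma integral_polynomial_gaussianReal (a₀ a₁ a₂ a₃ a₄ a₅ a₆ a₇ : ℝ) :
    ∫ s, (a₀ + a₁ * s + a₂ * s ^ 2 + a₃ * s ^ 3 + a₄ * s ^ 4 + a₅ * s ^ 5 + a₆ * s ^ 6
      + a₇ * s ^ 7) ∂gaussianReal 0 2 = a₀ + 2 * a₂ + 12 * a₄ + 120 * a₆ := by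
  have i (a : ℝ) (k : ℕ) : Integrable (fun s : ℝ => a * s ^ k) (gaussianReal 0 2) :=
    (integrable_pow_gaussianReal k).const_mul a
  have e : ∀ s : ℝ, a₀ + a₁ * s + a₂ * s ^ 2 + a₃ * s ^ 3 + a₄ * s ^ 4 + a₅ * s ^ 5 + a₆ * s ^ 6
      + a₇ * s ^ 7 = ∑ k : Fin 8, ![a₀, a₁, a₂, a₃, a₄, a₅, a₆, a₇] k * s ^ (k : ℕ) := by
    intro s
    simp [Fin.sum_univ_succ]
    ring
  simp_rw [e]
  rw [integral_finsetSum _ fun k _ => i _ _]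
  simp_rw [integral_const_mul]
  have m2 := moment_add_two 0
  have m3 := moment_add_two 1
  have m4 := moment_add_two 2
  have m5 := moment_add_two 3
  have m6 := moment_add_two 4
  have m7 := moment_add_two 5
  rw [moment_zero] at m2
  rw [moment_one] at m3
  norm_num at m2 m3
  norm_num [m2, m3] at m4 m5
  norm_num [m4, m5] at m6 m7
  simp [Fin.sum_univ_succ, m2, m3, m4, m5, m6, m7]
  ring

lemma gaussMeasure_moment_two {d : ℕ} (v w : Space d) :
    ∫ y, inner ℝ v y * inner ℝ w y ∂gaussMeasure d = 2 * inner ℝ v w := by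
  have h := covarianceBilin_stdGaussian (E := Space d)
  have h2 := covarianceBilin_apply (μ := stdGaussian (Space d)) IsGaussian.memLp_two_id v w
  rw [h] at h2
  simp only [id, integral_id_stdGaussian, sub_zero] at h2
  rw [show innerSL ℝ v w = inner ℝ v w from rfl] at h2
  rw [gaussMeasure, integral_map (by fun_prop) (by fun_prop)]
  rw [h2, ← integral_const_mul]
  congr with y
  have : (√2 : ℝ) * √2 = 2 := Real.mul_self_sqrt (by norm_num)
  rw [inner_smul_right, inner_smul_right]
  linear_combination (inner ℝ v y * inner ℝ w y) * this

lemma gaussMeasure_map_dual {d : ℕ} (v : Space d) (hv : ‖v‖ = 1) :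
    (gaussMeasure d).map (fun y => inner ℝ v y) = gaussianReal 0 2 := by
  have h := IsGaussian.map_eq_gaussianReal (μ := gaussMeasure d) (innerSL ℝ v)
  have h0 : ∫ y, innerSL ℝ v y ∂gaussMeasure d = 0 := by
    have := integral_gaussMeasure_neg (fun y => innerSL ℝ v y)
    simp only [map_neg, integral_neg] at this
    linarith
  have h1 : Var[innerSL ℝ v; gaussMeasure d] = 2 := by
    rw [variance_eq_sub, h0]
    · have := gaussMeasure_moment_two v v
      rw [real_inner_self_eq_norm_sq, hv] at this
      simp only [Pi.pow_apply, innerSL_apply_apply, pow_two]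
      rw [this]
      norm_num
    · exact (innerSL ℝ v).comp_memLp' (IsGaussian.memLp_id (gaussMeasure d) 2 (by simp))
  rw [h0, h1] at h
  convert! h
  exact (by norm_num : (2 : ℝ).toNNReal = 2).symm

/-! ### The averaging operator -/

/-- The average `∫ f (x + ε w) dw` against the Gaussian law, which is `G_{ε²} * f`. -/
def heatAvg {d : ℕ} (ε : ℝ) (f : Space d → ℝ) (x : Space d) : ℝ :=
  ∫ w, f (x + ε • w) ∂gaussMeasure d

section HeatAvg
variable {d : ℕ} {ε : ℝ} {f g : Space d → ℝ}

lemma gaussKernel_convolution_eq {t : ℝ} (ht : 0 < t) (f : Space d → ℝ) :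
    gaussKernel t ⋆ f = heatAvg √t f :=
  funext (gaussKernel_convolution ht f)

lemma measurable_heatAvg (ε : ℝ) (hf : Measurable f) : Measurable (heatAvg ε f) := by
  have : StronglyMeasurable (Function.uncurry fun (x w : Space d) => f (x + ε • w)) := by
    apply Measurable.stronglyMeasurable
    exact hf.comp (by fun_prop)
  exact this.integral_prod_right.measurable

lemma integrable_shift_of_bounded (hf : Measurable f) {C : ℝ} (hC : ∀ x, |f x| ≤ C) (x : Space d) :
    Integrable (fun w => f (x + ε • w)) (gaussMeasure d) :=
  (integrable_const C).mono' (hf.comp (by fun_prop)).aestronglyMeasurable (.of_forall fun _ => hC _)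

lemma abs_heatAvg_le {C : ℝ} (hC : ∀ x, |f x| ≤ C) (x : Space d) : |heatAvg ε f x| ≤ C := by
  have := norm_integral_le_of_norm_le_const (μ := gaussMeasure d) (f := fun w => f (x + ε • w))
    (.of_forall fun w => hC (x + ε • w))
  simpa [heatAvg] using this

lemma heatAvg_const (c : ℝ) (x : Space d) : heatAvg ε (fun _ => c) x = c := by
  simp [heatAvg]

lemma heatAvg_sub {C : ℝ} (hf : Measurable f) (hg : Measurable g) (hfC : ∀ x, |f x| ≤ C)
    (hgC : ∀ x, |g x| ≤ C) (x : Space d) :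
    heatAvg ε (fun y => f y - g y) x = heatAvg ε f x - heatAvg ε g x :=
  integral_sub (integrable_shift_of_bounded hf hfC x) (integrable_shift_of_bounded hg hgC x)

lemma heatAvg_sum {ι : Type*} (s : Finset ι) {F : ι → Space d → ℝ} (c : ι → ℝ) {C : ℝ}
    (hf : ∀ i, Measurable (F i)) (hC : ∀ i x, |F i x| ≤ C) (x : Space d) :
    heatAvg ε (fun y => ∑ i ∈ s, c i * F i y) x = ∑ i ∈ s, c i * heatAvg ε (F i) x := by
  unfold heatAvg
  rw [integral_finsetSum _ fun i _ =>
    (integrable_shift_of_bounded (hf i) (hC i) x).const_mul (c i)]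
  simp_rw [integral_const_mul]

lemma integrable_prod_shift (hf : Integrable f) (hfm : Measurable f) :
    Integrable (fun p : Space d × Space d => f (p.1 + ε • p.2))
      (volume.prod (gaussMeasure d)) := by
  have hm : AEStronglyMeasurable (fun p : Space d × Space d => f (p.1 + ε • p.2))
      (volume.prod (gaussMeasure d)) := (hfm.comp (by fun_prop)).aestronglyMeasurable
  rw [integrable_prod_iff' hm]
  refine ⟨.of_forall fun w => hf.comp_add_right (ε • w), ?_⟩
  have : ∀ w : Space d, ∫ x, ‖f (x + ε • w)‖ = ∫ x, ‖f x‖ := fun w =>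
    integral_add_right_eq_self (fun x => ‖f x‖) (ε • w)
  simp only [this]
  exact integrable_const _

lemma integrable_heatAvg (hf : Integrable f) (hfm : Measurable f) : Integrable (heatAvg ε f) :=
  (integrable_prod_shift hf hfm).integral_prod_left

/-- The averaging operator is symmetric. -/
lemma integral_mul_heatAvg (hf : Integrable f) (hfm : Measurable f) (hgm : Measurable g) {C : ℝ}
    (hg : ∀ x, |g x| ≤ C) :
    ∫ x, f x * heatAvg ε g x = ∫ x, heatAvg ε f x * g x := by
  have h1 : ∀ x, f x * heatAvg ε g x = ∫ w, f x * g (x + ε • w) ∂gaussMeasure d := fun x =>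
    (integral_const_mul _ _).symm
  have h2 : ∀ x, heatAvg ε f x * g x = ∫ w, f (x + ε • w) * g x ∂gaussMeasure d := fun x =>
    (integral_mul_const _ _).symm
  simp_rw [h1, h2]
  have i1 : Integrable (fun p : Space d × Space d => f p.1 * g (p.1 + ε • p.2))
      (volume.prod (gaussMeasure d)) := by
    have : Integrable (fun p : Space d × Space d => f p.1 * C)
      (volume.prod (gaussMeasure d)) := hf.mul_prod (integrable_const C)
    refine this.norm.mono' ((hfm.comp measurable_fst).mul
      (hgm.comp (by fun_prop))).aestronglyMeasurable (.of_forall fun p => ?_)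
    rw [norm_mul, norm_mul]
    exact mul_le_mul_of_nonneg_left ((hg _).trans (le_abs_self C)) (norm_nonneg _)
  have i2 : Integrable (fun p : Space d × Space d => f (p.1 + ε • p.2) * g p.1)
      (volume.prod (gaussMeasure d)) := by
    refine ((integrable_prod_shift hf hfm (ε := ε)).norm.const_mul C).mono' ((hfm.comp
      (by fun_prop)).mul (hgm.comp measurable_fst)).aestronglyMeasurable (.of_forall fun p => ?_)
    rw [norm_mul, mul_comm]
    exact mul_le_mul_of_nonneg_right (hg _) (norm_nonneg _)
  rw [integral_integral_swap i1,
    integral_integral_swap (f := fun x w => f (x + ε • w) * g x) i2]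
  rw [← integral_gaussMeasure_neg]
  congr with w
  rw [← integral_add_right_eq_self _ (ε • w)]
  congr with x
  simp

end HeatAvg

/-! ### Positivity of the kernel -/

section Positivity
variable {d : ℕ}

/-- `G_t` is, up to a constant, the Fourier transform of a Gaussian law. -/
lemma gaussKernel_eq_integral_cos {t : ℝ} (ht : 0 < t) (x : Space d) :
    gaussKernel t x = (4 * Real.pi * t) ^ (-(d : ℝ) / 2) *
      ∫ s, Real.cos (inner ℝ s ((2 * √t)⁻¹ • x)) ∂gaussMeasure d := by
  unfold gaussKernel
  congr 1
  have h := charFun_gaussMeasure ((2 * √t)⁻¹ • x)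
  rw [charFun_apply] at h
  have h2 := congrArg Complex.re h
  have hint : Integrable (fun s : Space d =>
      Complex.exp ((inner ℝ s ((2 * √t)⁻¹ • x) : ℝ) * Complex.I)) (gaussMeasure d) := by
    refine (integrable_const (1 : ℝ)).mono' (by fun_prop) (.of_forall fun s => ?_)
    rw [Complex.norm_exp_ofReal_mul_I]
  have h3 := integral_re hint
  simp only [RCLike.re_to_complex, Complex.exp_ofReal_mul_I_re] at h3
  rw [h3, h2, norm_smul, ← Complex.ofReal_pow, ← Complex.ofReal_neg, Complex.exp_ofReal_re,
    mul_pow, Real.norm_eq_abs, sq_abs, inv_pow, mul_pow, Real.sq_sqrt ht.le]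
  congr 1
  field_simp
  norm_num

/-- The real part of the Fourier transform, in the normalization of
`gaussKernel_eq_integral_cos`. -/
def cosTransform (a : ℝ) (f : Space d → ℝ) (s : Space d) : ℝ :=
  ∫ x, f x * Real.cos (inner ℝ s (a • x))

/-- The imaginary part of the Fourier transform, up to sign. -/
def sinTransform (a : ℝ) (f : Space d → ℝ) (s : Space d) : ℝ :=
  ∫ x, f x * Real.sin (inner ℝ s (a • x))

lemma abs_cosTransform_le {f : Space d → ℝ} (a : ℝ) (hf : Integrable f) (s : Space d) :
    |cosTransform a f s| ≤ ∫ x, ‖f x‖ := by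
  change ‖∫ x, f x * Real.cos (inner ℝ s (a • x))‖ ≤ _
  refine norm_integral_le_of_norm_le hf.norm (.of_forall fun x => ?_)
  rw [norm_mul]
  exact mul_le_of_le_one_right (norm_nonneg _) (Real.abs_cos_le_one _)

lemma abs_sinTransform_le {f : Space d → ℝ} (a : ℝ) (hf : Integrable f) (s : Space d) :
    |sinTransform a f s| ≤ ∫ x, ‖f x‖ := by
  change ‖∫ x, f x * Real.sin (inner ℝ s (a • x))‖ ≤ _
  refine norm_integral_le_of_norm_le hf.norm (.of_forall fun x => ?_)
  rw [norm_mul]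
  exact mul_le_of_le_one_right (norm_nonneg _) (Real.abs_sin_le_one _)

lemma measurable_cosTransform {f : Space d → ℝ} (a : ℝ) (hf : Measurable f) :
    Measurable (cosTransform a f) := by
  have : StronglyMeasurable (Function.uncurry fun (s x : Space d) =>
      f x * Real.cos (inner ℝ s (a • x))) := by
    apply Measurable.stronglyMeasurable
    exact (hf.comp measurable_snd).mul (by fun_prop)
  exact this.integral_prod_right.measurable

lemma measurable_sinTransform {f : Space d → ℝ} (a : ℝ) (hf : Measurable f) :
    Measurable (sinTransform a f) := by
  have : StronglyMeasurable (Function.uncurry fun (s x : Space d) =>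
      f x * Real.sin (inner ℝ s (a • x))) := by
    apply Measurable.stronglyMeasurable
    exact (hf.comp measurable_snd).mul (by fun_prop)
  exact this.integral_prod_right.measurable

lemma integrable_mul_cos {f : Space d → ℝ} (a : ℝ) (hf : Integrable f) (s : Space d) :
    Integrable fun x => f x * Real.cos (inner ℝ s (a • x)) :=
  hf.mul_bdd (by fun_prop) (.of_forall fun x => Real.abs_cos_le_one _)

lemma integrable_mul_sin {f : Space d → ℝ} (a : ℝ) (hf : Integrable f) (s : Space d) :
    Integrable fun x => f x * Real.sin (inner ℝ s (a • x)) :=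
  hf.mul_bdd (by fun_prop) (.of_forall fun x => Real.abs_sin_le_one _)

lemma integrable_cosTransform_mul_add {f g : Space d → ℝ} (a : ℝ) (hf : Integrable f)
    (hfm : Measurable f) (hg : Integrable g) (hgm : Measurable g) :
    Integrable (fun s => cosTransform a f s * cosTransform a g s
      + sinTransform a f s * sinTransform a g s) (gaussMeasure d) := by
  have m1 := measurable_cosTransform a hfm
  have m2 := measurable_cosTransform a hgm
  have m3 := measurable_sinTransform a hfm
  have m4 := measurable_sinTransform a hgm
  refine (integrable_const ((∫ x, ‖f x‖) * (∫ x, ‖g x‖) + (∫ x, ‖f x‖) * (∫ x, ‖g x‖))).mono'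
    (by fun_prop) (.of_forall fun s => ?_)
  refine (norm_add_le _ _).trans (add_le_add ?_ ?_) <;> rw [norm_mul]
  · exact mul_le_mul (abs_cosTransform_le a hf s) (abs_cosTransform_le a hg s) (norm_nonneg _)
      (by positivity)
  · exact mul_le_mul (abs_sinTransform_le a hf s) (abs_sinTransform_le a hg s) (norm_nonneg _)
      (by positivity)

lemma heatAvg_eq_integral_transform {t : ℝ} (ht : 0 < t) {g : Space d → ℝ}
    (hg : Integrable g) (hgm : Measurable g) (x : Space d) :
    heatAvg √t g x = (4 * Real.pi * t) ^ (-(d : ℝ) / 2) *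
      ∫ s, (Real.cos (inner ℝ s ((2 * √t)⁻¹ • x)) * cosTransform (2 * √t)⁻¹ g s
        + Real.sin (inner ℝ s ((2 * √t)⁻¹ • x)) * sinTransform (2 * √t)⁻¹ g s)
        ∂gaussMeasure d := by
  rw [← gaussKernel_convolution_eq ht, convolution_eq_swap]
  simp only [ContinuousLinearMap.lsmul_apply, smul_eq_mul, gaussKernel_eq_integral_cos ht]
  set a := (2 * √t)⁻¹
  have h1 : ∀ y, (4 * Real.pi * t) ^ (-(d : ℝ) / 2) *
      (∫ s, Real.cos (inner ℝ s (a • (x - y))) ∂gaussMeasure d) * g y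
      = (4 * Real.pi * t) ^ (-(d : ℝ) / 2) *
        ∫ s, Real.cos (inner ℝ s (a • (x - y))) * g y ∂gaussMeasure d := by
    intro y
    rw [integral_mul_const, mul_assoc]
  simp_rw [h1]
  rw [integral_const_mul]
  congr 1
  have i : Integrable (fun p : Space d × Space d => Real.cos (inner ℝ p.2 (a • (x - p.1))) * g p.1)
      (volume.prod (gaussMeasure d)) := by
    have : Integrable (fun p : Space d × Space d => g p.1 * (1 : ℝ))
      (volume.prod (gaussMeasure d)) := hg.mul_prod (integrable_const 1)
    refine this.norm.mono' (Measurable.mul (by fun_prop)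
      (hgm.comp measurable_fst)).aestronglyMeasurable (.of_forall fun p => ?_)
    rw [norm_mul, mul_one]
    exact mul_le_of_le_one_left (norm_nonneg _) (Real.abs_cos_le_one _)
  rw [integral_integral_swap i]
  congr with s
  unfold cosTransform sinTransform
  rw [← integral_const_mul, ← integral_const_mul, ← integral_add]
  · congr with y
    rw [smul_sub, inner_sub_right, Real.cos_sub]
    ring
  · exact (integrable_mul_cos a hg s).const_mul _
  · exact (integrable_mul_sin a hg s).const_mul _

/-- Plancherel's identity for the averaging operator. The Fourier multiplier `exp (-t |s|²)` of the
heat flow has become the weight of the Gaussian measure in the frequency variable. -/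
lemma integral_mul_heatAvg_eq {t : ℝ} (ht : 0 < t) {f g : Space d → ℝ}
    (hf : Integrable f) (hfm : Measurable f) (hg : Integrable g) (hgm : Measurable g) :
    ∫ x, f x * heatAvg √t g x = (4 * Real.pi * t) ^ (-(d : ℝ) / 2) *
      ∫ s, (cosTransform (2 * √t)⁻¹ f s * cosTransform (2 * √t)⁻¹ g s
        + sinTransform (2 * √t)⁻¹ f s * sinTransform (2 * √t)⁻¹ g s) ∂gaussMeasure d := by
  simp_rw [heatAvg_eq_integral_transform ht hg hgm]
  set a := (2 * √t)⁻¹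
  have h1 : ∀ x, f x * ((4 * Real.pi * t) ^ (-(d : ℝ) / 2) *
      ∫ s, (Real.cos (inner ℝ s (a • x)) * cosTransform a g s
        + Real.sin (inner ℝ s (a • x)) * sinTransform a g s) ∂gaussMeasure d)
      = (4 * Real.pi * t) ^ (-(d : ℝ) / 2) *
      ∫ s, f x * (Real.cos (inner ℝ s (a • x)) * cosTransform a g s
        + Real.sin (inner ℝ s (a • x)) * sinTransform a g s) ∂gaussMeasure d := by
    intro x
    rw [integral_const_mul]
    ring
  simp_rw [h1]
  rw [integral_const_mul]
  congr 1
  have m1 := measurable_cosTransform a hgm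
  have m2 := measurable_sinTransform a hgm
  have i : Integrable (fun p : Space d × Space d =>
      f p.1 * (Real.cos (inner ℝ p.2 (a • p.1)) * cosTransform a g p.2
        + Real.sin (inner ℝ p.2 (a • p.1)) * sinTransform a g p.2))
      (volume.prod (gaussMeasure d)) := by
    have : Integrable (fun p : Space d × Space d => f p.1 * ((∫ x, ‖g x‖) + ∫ x, ‖g x‖))
      (volume.prod (gaussMeasure d)) := hf.mul_prod (integrable_const _)
    refine this.norm.mono' (Measurable.mul (hfm.comp measurable_fst)
      (Measurable.add (Measurable.mul (by fun_prop) (m1.comp measurable_snd))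
      (Measurable.mul (by fun_prop) (m2.comp measurable_snd)))).aestronglyMeasurable
      (.of_forall fun p => ?_)
    rw [norm_mul, norm_mul]
    refine mul_le_mul_of_nonneg_left ?_ (norm_nonneg _)
    refine le_trans ((norm_add_le _ _).trans (add_le_add ?_ ?_)) (le_abs_self _) <;> rw [norm_mul]
    · exact (mul_le_of_le_one_left (norm_nonneg _) (Real.abs_cos_le_one _)).trans
        (abs_cosTransform_le a hg _)
    · exact (mul_le_of_le_one_left (norm_nonneg _) (Real.abs_sin_le_one _)).trans
        (abs_sinTransform_le a hg _)
  rw [integral_integral_swap i]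
  congr with s
  have e : ∀ x, f x * (Real.cos (inner ℝ s (a • x)) * cosTransform a g s
        + Real.sin (inner ℝ s (a • x)) * sinTransform a g s)
      = f x * Real.cos (inner ℝ s (a • x)) * cosTransform a g s
        + f x * Real.sin (inner ℝ s (a • x)) * sinTransform a g s := fun x => by ring
  simp_rw [e]
  rw [integral_add ((integrable_mul_cos a hf s).mul_const _)
    ((integrable_mul_sin a hf s).mul_const _), integral_mul_const, integral_mul_const]
  rfl

/-- Since the kernel has a positive Fourier transform, a negative semidefinite form in
finitely many functions stays so after inserting the averaging operator. -/
lemma integral_form_heatAvg_nonpos {t : ℝ} (ht : 0 < t) {ι : Type*} [Fintype ι]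
    (M : ι → ι → ℝ) (hM : ∀ p : ι → ℝ, ∑ i, ∑ j, M i j * (p i * p j) ≤ 0)
    (φ : ι → Space d → ℝ) (hφ : ∀ i, Integrable (φ i)) (hφm : ∀ i, Measurable (φ i))
    (hφb : ∀ i x, |φ i x| ≤ 1) :
    Integrable (fun x => ∑ i, ∑ j, M i j * (φ i x * heatAvg √t (φ j) x)) ∧
    ∫ x, ∑ i, ∑ j, M i j * (φ i x * heatAvg √t (φ j) x) ≤ 0 := by
  have hi : ∀ i j, Integrable fun x => M i j * (φ i x * heatAvg √t (φ j) x) := fun i j =>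
    ((hφ i).mul_bdd (measurable_heatAvg _ (hφm j)).aestronglyMeasurable
      (.of_forall fun x => abs_heatAvg_le (hφb j) x)).const_mul _
  refine ⟨integrable_finsetSum _ fun i _ => integrable_finsetSum _ fun j _ => hi i j, ?_⟩
  rw [integral_finsetSum _ fun i _ => integrable_finsetSum _ fun j _ => hi i j]
  simp_rw [integral_finsetSum _ fun j _ => hi _ j, integral_const_mul,
    integral_mul_heatAvg_eq ht (hφ _) (hφm _) (hφ _) (hφm _)]
  set a := (2 * √t)⁻¹
  have hK : 0 ≤ (4 * Real.pi * t) ^ (-(d : ℝ) / 2) := by positivity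
  set K := (4 * Real.pi * t) ^ (-(d : ℝ) / 2)
  have hs : ∀ i j, Integrable (fun s => M i j * (cosTransform a (φ i) s * cosTransform a (φ j) s
      + sinTransform a (φ i) s * sinTransform a (φ j) s)) (gaussMeasure d) := fun i j =>
    (integrable_cosTransform_mul_add a (hφ i) (hφm i) (hφ j) (hφm j)).const_mul _
  have e : ∑ i, ∑ j, M i j * (K * ∫ s, (cosTransform a (φ i) s * cosTransform a (φ j) s
      + sinTransform a (φ i) s * sinTransform a (φ j) s) ∂gaussMeasure d)
      = K * ∫ s, ∑ i, ∑ j, M i j * (cosTransform a (φ i) s * cosTransform a (φ j) s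
      + sinTransform a (φ i) s * sinTransform a (φ j) s) ∂gaussMeasure d := by
    rw [integral_finsetSum _ fun i _ => integrable_finsetSum _ fun j _ => hs i j]
    simp_rw [integral_finsetSum _ fun j _ => hs _ j, integral_const_mul, Finset.mul_sum]
    refine Finset.sum_congr rfl fun i _ => Finset.sum_congr rfl fun j _ => by ring
  rw [e]
  refine mul_nonpos_of_nonneg_of_nonpos hK (integral_nonpos fun s => ?_)
  have h1 := hM fun i => cosTransform a (φ i) s
  have h2 := hM fun i => sinTransform a (φ i) s
  simp only [mul_add, Finset.sum_add_distrib, Pi.zero_apply]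
  exact add_nonpos h1 h2

end Positivity

/-! ### Energy stability -/

section Stage
variable {d : ℕ}

lemma indicatorFun_eq_zero_or_one (S : Set (Space d)) (x : Space d) :
    indicatorFun S x = 0 ∨ indicatorFun S x = 1 := by
  by_cases h : x ∈ S <;> simp [indicatorFun, h]

lemma indicatorFun_nonneg (S : Set (Space d)) (x : Space d) : 0 ≤ indicatorFun S x := by
  rcases indicatorFun_eq_zero_or_one S x with h | h <;> simp [h]

lemma indicatorFun_le_one (S : Set (Space d)) (x : Space d) : indicatorFun S x ≤ 1 := by
  rcases indicatorFun_eq_zero_or_one S x with h | h <;> simp [h]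

lemma abs_indicatorFun_le (S : Set (Space d)) (x : Space d) : |indicatorFun S x| ≤ 1 := by
  rcases indicatorFun_eq_zero_or_one S x with h | h <;> simp [h]

lemma measurable_indicatorFun {S : Set (Space d)} (hS : MeasurableSet S) :
    Measurable (indicatorFun S) :=
  measurable_const.indicator hS

lemma abs_indicatorFun_sub_le (S T : Set (Space d)) (x : Space d) :
    |indicatorFun S x - indicatorFun T x| ≤ 1 := by
  rcases indicatorFun_eq_zero_or_one S x with h | h <;>
    rcases indicatorFun_eq_zero_or_one T x with h' | h' <;> simp [h, h']

variable {γ : ℕ → ℕ → ℝ} {τ : ℝ} {S : Set (Space d)}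

lemma stage_zero : stage γ τ S 0 = S := by rw [stage]

lemma stage_succ (hτ : 0 < τ) (m : ℕ) : stage γ τ S (m + 1) = {x | 1 / 2 ≤ heatAvg √τ
    (fun y => ∑ i : Fin (m + 1), γ (m + 1) i * indicatorFun (stage γ τ S i) y) x} := by
  rw [stage, gaussKernel_convolution_eq hτ]

lemma measurableSet_stage (hτ : 0 < τ) (hS : MeasurableSet S) (m : ℕ) :
    MeasurableSet (stage γ τ S m) := by
  induction m using Nat.strong_induction_on with
  | _ m ih =>
    cases m with
    | zero => rwa [stage_zero]
    | succ m =>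
      rw [stage_succ hτ]
      refine measurableSet_le measurable_const (measurable_heatAvg _ ?_)
      exact Finset.measurable_fun_sum _ fun i _ =>
        (measurable_indicatorFun (ih i (by omega))).const_mul _

lemma mem_stage_succ (hτ : 0 < τ) (hS : MeasurableSet S) (m : ℕ) (x : Space d) :
    x ∈ stage γ τ S (m + 1) ↔ 1 / 2 ≤ ∑ i : Fin (m + 1), γ (m + 1) i *
      heatAvg √τ (indicatorFun (stage γ τ S i)) x := by
  rw [stage_succ hτ, ← heatAvg_sum Finset.univ
    (F := fun i : Fin (m + 1) => indicatorFun (stage γ τ S i)) (fun i => γ (m + 1) i)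
    (fun i => measurable_indicatorFun (measurableSet_stage hτ hS i))
    (fun i => abs_indicatorFun_le _)]
  rfl

end Stage

section Energy
variable {d : ℕ} {τ : ℝ} {S : Set (Space d)}

lemma heatAvg_indicatorFun_nonneg (ε : ℝ) (S : Set (Space d)) (x : Space d) :
    0 ≤ heatAvg ε (indicatorFun S) x :=
  integral_nonneg fun _ => indicatorFun_nonneg S _

lemma heatAvg_indicatorFun_le_one (ε : ℝ) (S : Set (Space d)) (x : Space d) :
    heatAvg ε (indicatorFun S) x ≤ 1 :=
  (le_abs_self _).trans (abs_heatAvg_le (abs_indicatorFun_le S) x)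

lemma energy_eq (hτ : 0 < τ) : energy τ S =
    ∫⁻ x, ENNReal.ofReal ((1 - indicatorFun S x) * heatAvg √τ (indicatorFun S) x) := by
  rw [energy, gaussKernel_convolution_eq hτ]

lemma lintegral_gaussMeasure_neg (f : Space d → ENNReal) (hf : Measurable f) :
    ∫⁻ x, f (-x) ∂gaussMeasure d = ∫⁻ x, f x ∂gaussMeasure d := by
  conv_rhs => rw [← gaussMeasure_map_neg]
  rw [lintegral_map hf measurable_neg]

/-- The energy also measures how much of the set is averaged out of it. -/
lemma energy_eq_compl (hτ : 0 < τ) (hS : MeasurableSet S) : energy τ S =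
    ∫⁻ x, ENNReal.ofReal (indicatorFun S x * (1 - heatAvg √τ (indicatorFun S) x)) := by
  rw [energy_eq hτ]
  have hu := measurable_indicatorFun hS
  set u := indicatorFun S
  set ε := √τ
  have hint : ∀ x, Integrable (fun w => u (x + ε • w)) (gaussMeasure d) := fun x =>
    integrable_shift_of_bounded hu (abs_indicatorFun_le S) x
  have h1 : ∀ x, ENNReal.ofReal ((1 - u x) * heatAvg ε u x)
      = ∫⁻ w, ENNReal.ofReal ((1 - u x) * u (x + ε • w)) ∂gaussMeasure d := by
    intro x
    rw [heatAvg, ← integral_const_mul, ofReal_integral_eq_lintegral_ofReal ((hint x).const_mul _)]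
    exact .of_forall fun w => mul_nonneg (sub_nonneg.2 (indicatorFun_le_one S x))
      (indicatorFun_nonneg S _)
  have h2 : ∀ x, ENNReal.ofReal (u x * (1 - heatAvg ε u x))
      = ∫⁻ w, ENNReal.ofReal (u x * (1 - u (x + ε • w))) ∂gaussMeasure d := by
    intro x
    have : 1 - heatAvg ε u x = ∫ w, (1 - u (x + ε • w)) ∂gaussMeasure d := by
      rw [integral_sub (integrable_const _) (hint x)]
      simp [heatAvg]
    have hi : Integrable (fun w => u x * (1 - u (x + ε • w))) (gaussMeasure d) :=
      ((integrable_const 1).sub (hint x)).const_mul _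
    rw [this, ← integral_const_mul, ofReal_integral_eq_lintegral_ofReal hi]
    exact .of_forall fun w => mul_nonneg (indicatorFun_nonneg S x)
      (sub_nonneg.2 (indicatorFun_le_one S _))
  simp_rw [h1, h2]
  have hsh : Measurable fun p : Space d × Space d => u (p.1 + ε • p.2) := hu.comp (by fun_prop)
  have m1 : Measurable (Function.uncurry fun x w : Space d =>
      ENNReal.ofReal ((1 - u x) * u (x + ε • w))) :=
    ((measurable_const.sub (hu.comp measurable_fst)).mul hsh).ennreal_ofReal
  have m2 : Measurable (Function.uncurry fun x w : Space d =>
      ENNReal.ofReal (u x * (1 - u (x + ε • w)))) :=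
    ((hu.comp measurable_fst).mul (measurable_const.sub hsh)).ennreal_ofReal
  rw [lintegral_lintegral_swap m1.aemeasurable, lintegral_lintegral_swap
    (f := fun x w => ENNReal.ofReal (u x * (1 - u (x + ε • w)))) m2.aemeasurable]
  have hneg := lintegral_gaussMeasure_neg
    (fun w => ∫⁻ x, ENNReal.ofReal ((1 - u x) * u (x + ε • w))) m1.lintegral_prod_left'
  rw [← hneg]
  -- the substitution `x ↦ x + ε w` exchanges the roles of the two points, after reflecting `w`
  congr with w
  rw [← lintegral_add_right_eq_self _ (ε • w)]
  congr with x
  simp [mul_comm]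

lemma measurable_energyDensity (hS : MeasurableSet S) :
    Measurable fun x => (1 - indicatorFun S x) * heatAvg √τ (indicatorFun S) x :=
  (measurable_const.sub (measurable_indicatorFun hS)).mul
    (measurable_heatAvg _ (measurable_indicatorFun hS))

lemma integrable_energyDensity (hτ : 0 < τ) (hS : MeasurableSet S) (hE : energy τ S ≠ ⊤) :
    Integrable fun x => (1 - indicatorFun S x) * heatAvg √τ (indicatorFun S) x := by
  rw [energy_eq hτ] at hE
  exact (lintegral_ofReal_ne_top_iff_integrable (measurable_energyDensity hS).aestronglyMeasurable
    (.of_forall fun x => mul_nonneg (sub_nonneg.2 (indicatorFun_le_one S x))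
      (heatAvg_indicatorFun_nonneg _ S x))).1 hE

lemma integrable_indicatorFun_sub_heatAvg (hτ : 0 < τ) (hS : MeasurableSet S)
    (hE : energy τ S ≠ ⊤) :
    Integrable fun x => heatAvg √τ (indicatorFun S) x - indicatorFun S x := by
  have h1 := integrable_energyDensity hτ hS hE
  have h2 : Integrable fun x => indicatorFun S x * (1 - heatAvg √τ (indicatorFun S) x) := by
    rw [energy_eq_compl hτ hS] at hE
    refine (lintegral_ofReal_ne_top_iff_integrable ?_ ?_).1 hE
    · exact ((measurable_indicatorFun hS).mul (measurable_const.sub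
        (measurable_heatAvg _ (measurable_indicatorFun hS)))).aestronglyMeasurable
    · exact .of_forall fun x => mul_nonneg (indicatorFun_nonneg S x)
        (sub_nonneg.2 (heatAvg_indicatorFun_le_one _ S x))
  refine (h1.sub h2).congr (.of_forall fun x => ?_)
  simp only [Pi.sub_apply]
  ring

/-- All stages differ from a set of finite energy by a set of finite measure. -/
lemma integrable_stage_sub {γ : ℕ → ℕ → ℝ} {M : ℕ}
    (hγ : ∀ m < M, ∑ i : Fin (m + 1), γ (m + 1) i = 1)
    (hτ : 0 < τ) (hS : MeasurableSet S) (hE : energy τ S ≠ ⊤) (m : ℕ) (hm : m ≤ M) :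
    Integrable fun x => indicatorFun (stage γ τ S m) x - indicatorFun S x := by
  induction m using Nat.strong_induction_on with
  | _ m ih =>
    cases m with
    | zero => simp [stage_zero]
    | succ m =>
      have hmeas := fun i : ℕ => measurable_indicatorFun (measurableSet_stage (γ := γ) hτ hS i)
      have hφ : ∀ i : Fin (m + 1), Integrable fun x => γ (m + 1) i *
          heatAvg √τ (fun y => indicatorFun (stage γ τ S i) y - indicatorFun S y) x := fun i =>
        (integrable_heatAvg (ih i (by omega) (by omega))
          ((hmeas i).sub (measurable_indicatorFun hS))).const_mul _
      have h1 := (integrable_finsetSum Finset.univ fun i _ => hφ i).add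
        (integrable_indicatorFun_sub_heatAvg hτ hS hE)
      refine (h1.norm.const_mul 2).mono' ((hmeas (m + 1)).sub
        (measurable_indicatorFun hS)).aestronglyMeasurable (.of_forall fun x => ?_)
      have e : ∑ i : Fin (m + 1), γ (m + 1) i *
          heatAvg √τ (fun y => indicatorFun (stage γ τ S i) y - indicatorFun S y) x
          + (heatAvg √τ (indicatorFun S) x - indicatorFun S x)
          = ∑ i : Fin (m + 1), γ (m + 1) i * heatAvg √τ (indicatorFun (stage γ τ S i)) x
            - indicatorFun S x := by
        simp_rw [heatAvg_sub (hmeas _) (measurable_indicatorFun hS) (abs_indicatorFun_le _)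
          (abs_indicatorFun_le _), mul_sub, Finset.sum_sub_distrib, ← Finset.sum_mul,
          hγ m (by omega)]
        ring
      simp only [Pi.add_apply, Real.norm_eq_abs]
      rw [e]
      have hmem := mem_stage_succ (γ := γ) hτ hS m x
      set v := ∑ i : Fin (m + 1), γ (m + 1) i * heatAvg √τ (indicatorFun (stage γ τ S i)) x
      by_cases hx : x ∈ stage γ τ S (m + 1)
      · have hv := hmem.1 hx
        have : indicatorFun (stage γ τ S (m + 1)) x = 1 := by simp [indicatorFun, hx]
        rw [this]
        rcases indicatorFun_eq_zero_or_one S x with h | h <;> rw [h]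
        · have := le_abs_self (v - 0); norm_num at this ⊢; linarith
        · norm_num
      · have hv := not_le.1 (mt hmem.2 hx)
        have : indicatorFun (stage γ τ S (m + 1)) x = 0 := by simp [indicatorFun, hx]
        rw [this]
        rcases indicatorFun_eq_zero_or_one S x with h | h <;> rw [h]
        · norm_num
        · have := neg_abs_le (v - 1); norm_num; linarith

/-- The energy is a quadratic functional: expansion about a set of finite energy. -/
lemma energyDensity_expansion (hτ : 0 < τ) {T : Set (Space d)} (hS : MeasurableSet S)
    (hT : MeasurableSet T) (hE : energy τ S ≠ ⊤)
    (hφ : Integrable fun x => indicatorFun T x - indicatorFun S x) :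
    Integrable (fun x => (1 - indicatorFun T x) * heatAvg √τ (indicatorFun T) x) ∧
    Integrable (fun x => (indicatorFun T x - indicatorFun S x)
        * (1 - 2 * heatAvg √τ (indicatorFun S) x) - (indicatorFun T x - indicatorFun S x)
          * heatAvg √τ (fun y => indicatorFun T y - indicatorFun S y) x) ∧
    ∫ x, (1 - indicatorFun T x) * heatAvg √τ (indicatorFun T) x =
      (∫ x, (1 - indicatorFun S x) * heatAvg √τ (indicatorFun S) x)
      + ∫ x, ((indicatorFun T x - indicatorFun S x) * (1 - 2 * heatAvg √τ (indicatorFun S) x)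
        - (indicatorFun T x - indicatorFun S x)
          * heatAvg √τ (fun y => indicatorFun T y - indicatorFun S y) x) := by
  have hE' := integrable_energyDensity hτ hS hE
  have hmS := measurable_indicatorFun hS
  have hmT := measurable_indicatorFun hT
  have hbS := abs_indicatorFun_le S
  have hbT := abs_indicatorFun_le T
  have hbφ := abs_indicatorFun_sub_le T S
  have hGφ : ∀ x, heatAvg √τ (fun y => indicatorFun T y - indicatorFun S y) x
      = heatAvg √τ (indicatorFun T) x - heatAvg √τ (indicatorFun S) x := fun x =>
    heatAvg_sub hmT hmS hbT hbS x
  have hmφ : Measurable fun x => indicatorFun T x - indicatorFun S x := hmT.sub hmS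
  have iGφ := integrable_heatAvg (ε := √τ) hφ hmφ
  set u := indicatorFun S
  set v := indicatorFun T
  set φ := fun x => v x - u x
  have mGu := measurable_heatAvg √τ hmS
  have mGφ := measurable_heatAvg √τ hmφ
  have i1 : Integrable fun x => heatAvg √τ φ x * (1 - u x) :=
    iGφ.mul_bdd (c := 1) (by fun_prop) (.of_forall fun x => by
      rcases indicatorFun_eq_zero_or_one S x with h | h <;> simp [u, h])
  have i2 : Integrable fun x => φ x * heatAvg √τ u x :=
    hφ.mul_bdd mGu.aestronglyMeasurable (.of_forall fun x => abs_heatAvg_le hbS x)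
  have i3 : Integrable fun x => φ x * heatAvg √τ φ x :=
    hφ.mul_bdd mGφ.aestronglyMeasurable (.of_forall fun x => abs_heatAvg_le hbφ x)
  have hsym : ∫ x, heatAvg √τ φ x * (1 - u x) = ∫ x, (φ x - φ x * heatAvg √τ u x) := by
    rw [← integral_mul_heatAvg (g := fun x => 1 - u x) hφ hmφ (measurable_const.sub hmS) (C := 1)]
    · congr with x
      rw [heatAvg_sub measurable_const hmS (C := 1) (by simp) hbS, heatAvg_const]
      ring
    · intro x
      rcases indicatorFun_eq_zero_or_one S x with h | h <;> simp [u, h]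
  have e : ∀ x, (1 - v x) * heatAvg √τ v x = (1 - u x) * heatAvg √τ u x
      + (heatAvg √τ φ x * (1 - u x) - (φ x * heatAvg √τ u x + φ x * heatAvg √τ φ x)) := by
    intro x
    rw [hGφ x]
    simp only [φ]
    ring
  simp_rw [e]
  have i4 : Integrable fun x => φ x * heatAvg √τ u x + φ x * heatAvg √τ φ x := i2.add i3
  have i5 : Integrable fun x => heatAvg √τ φ x * (1 - u x)
      - (φ x * heatAvg √τ u x + φ x * heatAvg √τ φ x) := i1.sub i4
  have i6 : Integrable fun x => φ x - φ x * heatAvg √τ u x := hφ.sub i2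
  have e2 : ∀ x, (v x - u x) * (1 - 2 * heatAvg √τ u x) - (v x - u x) * heatAvg √τ φ x
      = (φ x - φ x * heatAvg √τ u x) - (φ x * heatAvg √τ u x + φ x * heatAvg √τ φ x) := by
    intro x
    simp only [φ]
    ring
  simp_rw [e2]
  refine ⟨hE'.add i5, i6.sub i4, ?_⟩
  rw [integral_add hE' i5, integral_sub i1 i4, hsym, ← integral_sub i6 i4]

lemma energy_eq_ofReal (hτ : 0 < τ)
    (hi : Integrable fun x => (1 - indicatorFun S x) * heatAvg √τ (indicatorFun S) x) :
    energy τ S =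
      ENNReal.ofReal (∫ x, (1 - indicatorFun S x) * heatAvg √τ (indicatorFun S) x) := by
  rw [energy_eq hτ, ofReal_integral_eq_lintegral_ofReal hi]
  exact .of_forall fun x => mul_nonneg (sub_nonneg.2 (indicatorFun_le_one S x))
      (heatAvg_indicatorFun_nonneg _ S x)

/-- Each stage minimizes its linearized energy pointwise. -/
lemma stage_minimizes {γ : ℕ → ℕ → ℝ} (hτ : 0 < τ) (hS : MeasurableSet S) (m : ℕ)
    (T : Set (Space d)) (x : Space d) :
    (indicatorFun (stage γ τ S (m + 1)) x - indicatorFun T x) *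
      (1 - 2 * ∑ i : Fin (m + 1), γ (m + 1) i *
        heatAvg √τ (indicatorFun (stage γ τ S i)) x) ≤ 0 := by
  have hmem := mem_stage_succ (γ := γ) hτ hS m x
  set v := ∑ i : Fin (m + 1), γ (m + 1) i * heatAvg √τ (indicatorFun (stage γ τ S i)) x
  by_cases hx : x ∈ stage γ τ S (m + 1)
  · have hv := hmem.1 hx
    have : indicatorFun (stage γ τ S (m + 1)) x = 1 := by simp [indicatorFun, hx]
    rw [this]
    exact mul_nonpos_of_nonneg_of_nonpos (sub_nonneg.2 (indicatorFun_le_one T x)) (by linarith)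
  · have hv := not_le.1 (mt hmem.2 hx)
    have : indicatorFun (stage γ τ S (m + 1)) x = 0 := by simp [indicatorFun, hx]
    rw [this]
    exact mul_nonpos_of_nonpos_of_nonneg (by linarith [indicatorFun_nonneg T x]) (by linarith)

/-- The matrix of the form in `stability_form_nonneg`. Applied to the differences `p i` between the
indicator functions of the stage `i + 1` and of the initial set, with the averaging operator as
inner product, it bounds the energy increment after the linear terms have been removed by the
minimality of the stages. -/
def stabilityMatrix : Fin 4 → Fin 4 → ℝ :=
  ![![-5 / 2, 0, 0, 0], ![5 / 2 + 4 / 3, -5 / 3, 0, 0],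
    ![-4 / 3 - 1, 5 / 3 - 2 * gamma42, -2 * gamma43, 0], ![1, 2 * gamma42, 2 * gamma43, -1]]

lemma sum_stabilityMatrix (p q : Fin 4 → ℝ) :
    ∑ i, ∑ j, stabilityMatrix i j * (p i * q j) =
      2 * ((p 1 - p 0) * (5 / 4 * q 0) + (p 2 - p 1) * (-2 / 3 * q 0 + 5 / 6 * q 1)
      + (p 3 - p 2) * (1 / 2 * q 0 + gamma42 * q 1 + gamma43 * q 2)) - p 3 * q 3 := by
  simp [Fin.sum_univ_four, stabilityMatrix]
  ring

/-- One step of the scheme does not increase the energy. The sum over the four stages of the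
minimality of each against its predecessor bounds the terms in the expansion of the energy that are
linear in the difference of the last stage and the initial set; what remains is a quadratic form in
the differences, which is negative semidefinite. -/
theorem energy_stage_four_le (hτ : 0 < τ) (hS : MeasurableSet S) :
    energy τ (stage gammaCoeff τ S 4) ≤ energy τ S := by
  by_cases hE : energy τ S = ⊤
  · rw [hE]; exact le_top
  have hms := fun i : ℕ => measurableSet_stage (γ := gammaCoeff) hτ hS i
  have hmu := fun i : ℕ => measurable_indicatorFun (hms i)
  have hφ := integrable_stage_sub sum_gammaCoeff hτ hS hE
  obtain ⟨hi, hi', heq⟩ := energyDensity_expansion hτ hS (hms 4) hE (hφ 4 le_rfl)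
  rw [energy_eq_ofReal hτ hi, energy_eq_ofReal hτ (integrable_energyDensity hτ hS hE)]
  apply ENNReal.ofReal_le_ofReal
  rw [heq]
  suffices h : ∫ x, ((indicatorFun (stage gammaCoeff τ S 4) x - indicatorFun S x)
      * (1 - 2 * heatAvg √τ (indicatorFun S) x)
        - (indicatorFun (stage gammaCoeff τ S 4) x - indicatorFun S x)
          * heatAvg √τ (fun y => indicatorFun (stage gammaCoeff τ S 4) y - indicatorFun S y) x)
          ≤ 0 by linarith
  obtain ⟨hf, hform⟩ := integral_form_heatAvg_nonpos hτ stabilityMatrix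
    (fun p => by
      rw [sum_stabilityMatrix]
      have := stability_form_nonneg (p 0) (p 1) (p 2) (p 3)
      linarith)
    (fun i => fun x => indicatorFun (stage gammaCoeff τ S (i + 1)) x - indicatorFun S x)
    (fun i => hφ (i + 1) (by omega))
    (fun i => (hmu _).sub (measurable_indicatorFun hS))
    (fun i x => abs_indicatorFun_sub_le _ _ x)
  refine le_trans (integral_mono hi' hf fun x => ?_) hform
  rw [sum_stabilityMatrix]
  have hG : ∀ m : ℕ, heatAvg √τ (fun y => indicatorFun (stage gammaCoeff τ S m) y
      - indicatorFun S y) x = heatAvg √τ (indicatorFun (stage gammaCoeff τ S m)) x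
      - heatAvg √τ (indicatorFun S) x := fun m =>
    heatAvg_sub (hmu m) (measurable_indicatorFun hS) (abs_indicatorFun_le _)
      (abs_indicatorFun_le _) x
  simp only [hG]
  -- the linear terms telescope, as each stage is compared with the preceding one
  have s1 := stage_minimizes (γ := gammaCoeff) hτ hS 0 (stage gammaCoeff τ S 0) x
  have s2 := stage_minimizes (γ := gammaCoeff) hτ hS 1 (stage gammaCoeff τ S 1) x
  have s3 := stage_minimizes (γ := gammaCoeff) hτ hS 2 (stage gammaCoeff τ S 2) x
  have s4 := stage_minimizes (γ := gammaCoeff) hτ hS 3 (stage gammaCoeff τ S 3) x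
  simp [Fin.sum_univ_succ, gammaCoeff, stage_zero] at s1 s2 s3 s4
  have f0 : ((0 : Fin 4) : ℕ) = 0 := rfl
  have f1 : ((1 : Fin 4) : ℕ) = 1 := rfl
  have f2 : ((2 : Fin 4) : ℕ) = 2 := rfl
  have f3 : ((3 : Fin 4) : ℕ) = 3 := rfl
  simp only [f0, f1, f2, f3, zero_add, Nat.reduceAdd]
  linarith

theorem energy_iterate_step_le {δt : ℝ} (hδ : 0 < δt) (hS : MeasurableSet S) (k : ℕ) :
    energy (kernelTime gammaCoeff 4 δt) ((step gammaCoeff 4 δt)^[k + 1] S)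
      ≤ energy (kernelTime gammaCoeff 4 δt) ((step gammaCoeff 4 δt)^[k] S) := by
  have hτ : 0 < kernelTime gammaCoeff 4 δt := div_pos hδ beta_four_pos
  have hm : ∀ k, MeasurableSet ((step gammaCoeff 4 δt)^[k] S) := by
    intro k
    induction k with
    | zero => exact hS
    | succ k ih =>
      rw [Function.iterate_succ_apply']
      exact measurableSet_stage hτ ih 4
  rw [Function.iterate_succ_apply']
  exact energy_stage_four_le hτ (hm k)

end Energy

/-! ### Families of polynomially bounded functions -/

/-- `f ε x = O(ε^k)` for `0 < ε ≤ 1`, uniformly up to a weight that is polynomial in `x`. -/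
def PolyBigO {E : Type*} [NormedAddCommGroup E] (k : ℕ) (f : ℝ → E → ℝ) : Prop :=
  ∃ C : ℝ, ∃ N : ℕ, 0 ≤ C ∧ ∀ ε, 0 < ε → ε ≤ 1 → ∀ x, |f ε x| ≤ C * ε ^ k * (1 + ‖x‖) ^ N

namespace PolyBigO
variable {E F : Type*} [NormedAddCommGroup E] [NormedAddCommGroup F] {k l : ℕ}
  {f g : ℝ → E → ℝ}

lemma congr (hf : PolyBigO k f) (h : ∀ ε, 0 < ε → ε ≤ 1 → ∀ x, g ε x = f ε x) :
    PolyBigO k g := by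
  obtain ⟨C, N, hC, hf⟩ := hf
  exact ⟨C, N, hC, fun ε h0 h1 x => by rw [h ε h0 h1 x]; exact hf ε h0 h1 x⟩

lemma mono (hf : PolyBigO k f) (h : l ≤ k) : PolyBigO l f := by
  obtain ⟨C, N, hC, hf⟩ := hf
  refine ⟨C, N, hC, fun ε h0 h1 x => (hf ε h0 h1 x).trans ?_⟩
  have := pow_le_pow_of_le_one h0.le h1 h
  gcongr

lemma add (hf : PolyBigO k f) (hg : PolyBigO k g) : PolyBigO k fun ε x => f ε x + g ε x := by
  obtain ⟨C, N, hC, hf⟩ := hf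
  obtain ⟨D, M, hD, hg⟩ := hg
  refine ⟨C + D, N + M, by positivity, fun ε h0 h1 x => ?_⟩
  have h : (1 : ℝ) ≤ 1 + ‖x‖ := by linarith [norm_nonneg x]
  calc |f ε x + g ε x| ≤ |f ε x| + |g ε x| := abs_add_le _ _
    _ ≤ C * ε ^ k * (1 + ‖x‖) ^ N + D * ε ^ k * (1 + ‖x‖) ^ M :=
        add_le_add (hf ε h0 h1 x) (hg ε h0 h1 x)
    _ ≤ C * ε ^ k * (1 + ‖x‖) ^ (N + M) + D * ε ^ k * (1 + ‖x‖) ^ (N + M) := by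
        gcongr
        · omega
        · omega
    _ = _ := by ring

lemma mul (hf : PolyBigO k f) (hg : PolyBigO l g) :
    PolyBigO (k + l) fun ε x => f ε x * g ε x := by
  obtain ⟨C, N, hC, hf⟩ := hf
  obtain ⟨D, M, hD, hg⟩ := hg
  refine ⟨C * D, N + M, by positivity, fun ε h0 h1 x => ?_⟩
  rw [abs_mul]
  calc |f ε x| * |g ε x| ≤ (C * ε ^ k * (1 + ‖x‖) ^ N) * (D * ε ^ l * (1 + ‖x‖) ^ M) :=
        mul_le_mul (hf ε h0 h1 x) (hg ε h0 h1 x) (abs_nonneg _) (by positivity)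
    _ = _ := by ring

lemma const (c : ℝ) : PolyBigO (E := E) 0 fun _ _ => c :=
  ⟨|c|, 0, abs_nonneg c, fun ε h0 h1 x => by simp⟩

lemma eps (j : ℕ) : PolyBigO (E := E) j fun ε _ => ε ^ j :=
  ⟨1, 0, zero_le_one, fun ε h0 h1 x => by simp [abs_of_pos h0]⟩

lemma const_mul (hf : PolyBigO k f) (c : ℝ) : PolyBigO k fun ε x => c * f ε x := by
  simpa using (const c).mul hf

lemma neg (hf : PolyBigO k f) : PolyBigO k fun ε x => -f ε x := by
  simpa using hf.const_mul (-1)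

lemma sub (hf : PolyBigO k f) (hg : PolyBigO k g) : PolyBigO k fun ε x => f ε x - g ε x := by
  simpa [sub_eq_add_neg] using hf.add hg.neg

lemma mul₀ (hf : PolyBigO k f) (hg : PolyBigO 0 g) : PolyBigO k fun ε x => f ε x * g ε x :=
  hf.mul hg

lemma eps_mul (hf : PolyBigO k f) (j : ℕ) : PolyBigO (j + k) fun ε x => ε ^ j * f ε x :=
  (eps j).mul hf

lemma pow (hf : PolyBigO 0 f) (j : ℕ) : PolyBigO 0 fun ε x => f ε x ^ j := by
  induction j with
  | zero => simpa using const 1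
  | succ j ih => simpa [pow_succ] using ih.mul hf

lemma abs (hf : PolyBigO k f) : PolyBigO k fun ε x => |f ε x| := by
  obtain ⟨C, N, hC, hf⟩ := hf
  exact ⟨C, N, hC, fun ε h0 h1 x => by rw [abs_abs]; exact hf ε h0 h1 x⟩

lemma sum {ι : Type*} (s : Finset ι) {f : ι → ℝ → E → ℝ} (hf : ∀ i, PolyBigO k (f i)) :
    PolyBigO k fun ε x => ∑ i ∈ s, f i ε x := by
  classical
  induction s using Finset.induction_on with
  | empty => exact ⟨0, 0, le_rfl, fun ε h0 h1 x => by simp⟩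
  | insert a s ha ih =>
    refine ((hf a).add ih).congr fun ε _ _ x => ?_
    rw [Finset.sum_insert ha]

lemma clm [NormedSpace ℝ E] (L : E →L[ℝ] ℝ) : PolyBigO 0 fun _ x => L x := by
  refine ⟨‖L‖, 1, norm_nonneg _, fun ε h0 h1 x => ?_⟩
  rw [pow_zero, mul_one, pow_one]
  exact (L.le_opNorm x).trans (by gcongr; linarith)

lemma comp_clm [NormedSpace ℝ E] [NormedSpace ℝ F] (hf : PolyBigO k f) (L : F →L[ℝ] E) :
    PolyBigO k fun ε x => f ε (L x) := by
  obtain ⟨C, N, hC, hf⟩ := hf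
  refine ⟨C * (1 + ‖L‖) ^ N, N, by positivity, fun ε h0 h1 x => (hf ε h0 h1 (L x)).trans ?_⟩
  have : 1 + ‖L x‖ ≤ (1 + ‖L‖) * (1 + ‖x‖) := by
    have := L.le_opNorm x
    nlinarith [norm_nonneg L, norm_nonneg x]
  calc C * ε ^ k * (1 + ‖L x‖) ^ N ≤ C * ε ^ k * ((1 + ‖L‖) * (1 + ‖x‖)) ^ N := by gcongr
    _ = _ := by rw [mul_pow]; ring

lemma one_add_norm_prod_le (x : E) (y : F) : 1 + ‖(x, y)‖ ≤ (1 + ‖x‖) * (1 + ‖y‖) := by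
  have : ‖(x, y)‖ ≤ ‖x‖ + ‖y‖ :=
    max_le (by linarith [norm_nonneg y]) (by linarith [norm_nonneg x])
  nlinarith [norm_nonneg x, norm_nonneg y]

variable [MeasurableSpace F] {μ : Measure F} {G : ℝ → E × F → ℝ}

lemma integral (hG : PolyBigO k G) (hμ : ∀ N : ℕ, Integrable (fun y => (1 + ‖y‖) ^ N) μ) :
    PolyBigO k fun ε x => ∫ y, G ε (x, y) ∂μ := by
  obtain ⟨C, N, hC, hG⟩ := hG
  refine ⟨C * ∫ y, (1 + ‖y‖) ^ N ∂μ, N, by positivity, fun ε h0 h1 x => ?_⟩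
  have h : ‖∫ y, G ε (x, y) ∂μ‖ ≤ ∫ y, C * ε ^ k * (1 + ‖x‖) ^ N * (1 + ‖y‖) ^ N ∂μ := by
    refine norm_integral_le_of_norm_le ((hμ N).const_mul _) (.of_forall fun y => ?_)
    refine (hG ε h0 h1 (x, y)).trans ?_
    rw [mul_assoc (C * ε ^ k), ← mul_pow]
    have := one_add_norm_prod_le x y
    gcongr
  rw [integral_const_mul] at h
  refine h.trans_eq ?_
  ring

lemma integrable_right (hG : PolyBigO k G) (hμ : ∀ N : ℕ, Integrable (fun y => (1 + ‖y‖) ^ N) μ)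
    {ε : ℝ} (h0 : 0 < ε) (h1 : ε ≤ 1) (x : E) (hm : Measurable fun y => G ε (x, y)) :
    Integrable (fun y => G ε (x, y)) μ := by
  obtain ⟨C, N, hC, hG⟩ := hG
  refine ((hμ N).const_mul (C * ε ^ k * (1 + ‖x‖) ^ N)).mono' hm.aestronglyMeasurable
    (.of_forall fun y => ?_)
  refine (hG ε h0 h1 (x, y)).trans ?_
  rw [mul_assoc (C * ε ^ k), ← mul_pow]
  have := one_add_norm_prod_le x y
  gcongr

end PolyBigO

/-- `f ε x η = O(ε^k)` for small `ε` and `|η| < R / ε`, up to a polynomial weight in `x`. -/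
def LocBigO {E : Type*} [NormedAddCommGroup E] (k : ℕ) (f : ℝ → E → ℝ → ℝ) : Prop :=
  ∃ C : ℝ, ∃ N : ℕ, ∃ R ε₀ : ℝ, 0 ≤ C ∧ 0 < R ∧ 0 < ε₀ ∧ ε₀ ≤ 1 ∧
    ∀ ε, 0 < ε → ε < ε₀ → ∀ x η, |η| < R / ε → |f ε x η| ≤ C * ε ^ k * (1 + ‖x‖) ^ N

namespace LocBigO
variable {E : Type*} [NormedAddCommGroup E] {k l : ℕ} {f g : ℝ → E → ℝ → ℝ}

lemma mono (hf : LocBigO k f) (h : l ≤ k) : LocBigO l f := by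
  obtain ⟨C, N, R, ε₀, hC, hR, hε, hε1, hf⟩ := hf
  refine ⟨C, N, R, ε₀, hC, hR, hε, hε1, fun ε h0 h1 x η hη => (hf ε h0 h1 x η hη).trans ?_⟩
  have := pow_le_pow_of_le_one h0.le (h1.le.trans hε1) h
  gcongr

lemma add (hf : LocBigO k f) (hg : LocBigO k g) : LocBigO k fun ε x η => f ε x η + g ε x η := by
  obtain ⟨C, N, R, ε₀, hC, hR, hε, hε1, hf⟩ := hf
  obtain ⟨D, M, R', ε₁, hD, hR', hε', hε1', hg⟩ := hg
  refine ⟨C + D, N + M, min R R', min ε₀ ε₁, by positivity, lt_min hR hR', lt_min hε hε',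
    (min_le_left _ _).trans hε1, fun ε h0 h1 x η hη => ?_⟩
  have h : (1 : ℝ) ≤ 1 + ‖x‖ := by linarith [norm_nonneg x]
  have h2 : |η| < R / ε := hη.trans_le (by gcongr; exact min_le_left _ _)
  have h3 : |η| < R' / ε := hη.trans_le (by gcongr; exact min_le_right _ _)
  calc |f ε x η + g ε x η| ≤ |f ε x η| + |g ε x η| := abs_add_le _ _
    _ ≤ C * ε ^ k * (1 + ‖x‖) ^ N + D * ε ^ k * (1 + ‖x‖) ^ M :=
        add_le_add (hf ε h0 (h1.trans_le (min_le_left _ _)) x η h2)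
          (hg ε h0 (h1.trans_le (min_le_right _ _)) x η h3)
    _ ≤ C * ε ^ k * (1 + ‖x‖) ^ (N + M) + D * ε ^ k * (1 + ‖x‖) ^ (N + M) := by
        gcongr
        · omega
        · omega
    _ = _ := by ring

lemma const_mul (hf : LocBigO k f) (c : ℝ) : LocBigO k fun ε x η => c * f ε x η := by
  obtain ⟨C, N, R, ε₀, hC, hR, hε, hε1, hf⟩ := hf
  refine ⟨|c| * C, N, R, ε₀, by positivity, hR, hε, hε1, fun ε h0 h1 x η hη => ?_⟩
  rw [abs_mul, mul_assoc, mul_assoc]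
  have := hf ε h0 h1 x η hη
  rw [mul_assoc] at this
  gcongr

lemma sum {ι : Type*} (s : Finset ι) {f : ι → ℝ → E → ℝ → ℝ} (hf : ∀ i, LocBigO k (f i)) :
    LocBigO k fun ε x η => ∑ i ∈ s, f i ε x η := by
  classical
  induction s using Finset.induction_on with
  | empty => exact ⟨0, 0, 1, 1, le_rfl, one_pos, one_pos, le_rfl, fun ε h0 h1 x => by simp⟩
  | insert a s ha ih =>
    simpa only [Finset.sum_insert ha] using (hf a).add ih

lemma congr (hf : LocBigO k f) (h : ∀ ε, 0 < ε → ε ≤ 1 → ∀ x η, g ε x η = f ε x η) :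
    LocBigO k g := by
  obtain ⟨C, N, R, ε₀, hC, hR, hε, hε1, hf⟩ := hf
  exact ⟨C, N, R, ε₀, hC, hR, hε, hε1, fun ε h0 h1 x η hη => by
    rw [h ε h0 (h1.le.trans hε1)]; exact hf ε h0 h1 x η hη⟩

lemma of_polyBigO {f : ℝ → E → ℝ → ℝ} (C : ℝ) (N : ℕ) (hC : 0 ≤ C)
    (h : ∀ ε, 0 < ε → ε ≤ 1 → ∀ x η, |f ε x η| ≤ C * ε ^ k * (1 + ‖x‖) ^ N) : LocBigO k f :=
  ⟨C, N, 1, 1, hC, one_pos, one_pos, le_rfl, fun ε h0 h1 x η _ => h ε h0 h1.le x η⟩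

end LocBigO

/-! ### The one-dimensional profile -/

/-- The profile `Ψ(s) = ∫_0^s g`, the excess over `1/2` of the mass of a half line. -/
def profile (s : ℝ) : ℝ := ∫ u in (0 : ℝ)..s, gaussDensity u

lemma continuous_gaussDensity : Continuous gaussDensity := by
  have : gaussDensity = fun s => gaussDensity 0 * Real.exp (-s ^ 2 / 4) := funext gaussDensity_eq
  rw [this]
  fun_prop

lemma gaussDensity_neg (s : ℝ) : gaussDensity (-s) = gaussDensity s := by
  rw [gaussDensity_eq, gaussDensity_eq s]
  simp

lemma gaussDensity_le (s : ℝ) : gaussDensity s ≤ gaussDensity 0 := by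
  rw [gaussDensity_eq s]
  refine mul_le_of_le_one_right (gaussDensity_pos 0).le (Real.exp_le_one_iff.2 ?_)
  have := sq_nonneg s
  linarith

lemma profile_sub (s t : ℝ) : profile t - profile s = ∫ u in s..t, gaussDensity u :=
  intervalIntegral.integral_interval_sub_left (continuous_gaussDensity.intervalIntegrable _ _)
    (continuous_gaussDensity.intervalIntegrable _ _)

lemma profile_zero : profile 0 = 0 := by simp [profile]

lemma profile_neg (s : ℝ) : profile (-s) = -profile s := by
  have := intervalIntegral.integral_comp_neg (a := 0) (b := s) gaussDensity
  simp only [gaussDensity_neg, neg_zero] at this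
  rw [profile, profile, this, intervalIntegral.integral_symm]

lemma abs_profile_sub_le (s t : ℝ) : |profile t - profile s| ≤ gaussDensity 0 * |t - s| := by
  rw [profile_sub]
  change ‖∫ u in s..t, gaussDensity u‖ ≤ _
  refine intervalIntegral.norm_integral_le_of_norm_le_const (a := s) (b := t) fun u _ => ?_
  rw [Real.norm_eq_abs, abs_of_pos (gaussDensity_pos u)]
  exact gaussDensity_le u

lemma continuous_profile : Continuous profile :=
  continuous_iff_continuousAt.2 fun s =>
    (intervalIntegral.integral_hasDerivAt_right (continuous_gaussDensity.intervalIntegrable 0 s)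
      (continuous_gaussDensity.stronglyMeasurableAtFilter _ _)
      continuous_gaussDensity.continuousAt).continuousAt

lemma gaussDensity_anti {s t : ℝ} (h : |s| ≤ |t|) : gaussDensity t ≤ gaussDensity s := by
  rw [gaussDensity_eq s, gaussDensity_eq t]
  have := sq_le_sq.2 h
  have := gaussDensity_pos 0
  gcongr

/-- Lower bound for increments of the profile near the origin. -/
lemma profile_sub_ge {s t c : ℝ} (hst : s ≤ t) (hs : |s| ≤ c) (ht : |t| ≤ c) :
    gaussDensity c * (t - s) ≤ profile t - profile s := by
  rw [profile_sub]
  have h : ∫ _u in s..t, gaussDensity c ≤ ∫ u in s..t, gaussDensity u := by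
    refine intervalIntegral.integral_mono_on hst (by simp)
      (continuous_gaussDensity.intervalIntegrable _ _) fun u hu => gaussDensity_anti ?_
    rw [abs_of_nonneg ((abs_nonneg s).trans hs), abs_le]
    exact ⟨(abs_le.1 hs).1.trans hu.1, hu.2.trans (abs_le.1 ht).2⟩
  simpa [mul_comm] using h

lemma profile_mono : Monotone profile := by
  intro s t hst
  rw [← sub_nonneg, profile_sub]
  exact intervalIntegral.integral_nonneg hst fun u _ => (gaussDensity_pos u).le

lemma profile_pos {s : ℝ} (hs : 0 < s) : 0 < profile s := by
  have := profile_sub_ge (c := s) hs.le (by simp [hs.le]) (by rw [abs_of_pos hs])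
  rw [profile_zero] at this
  nlinarith [gaussDensity_pos s]

/-- Where the profile is below its value at `1`, it controls its argument. -/
lemma abs_le_of_abs_profile_lt {s b : ℝ} (h : |profile s| ≤ b) (hb : b < profile 1) :
    |s| ≤ 1 ∧ gaussDensity 1 * |s| ≤ b := by
  have key : ∀ s, 0 ≤ s → |profile s| ≤ b → s ≤ 1 ∧ gaussDensity 1 * s ≤ b := by
    intro s hs h
    have h1 : s ≤ 1 := by
      by_contra! hc
      have := profile_mono hc.le
      have := le_abs_self (profile s)
      linarith
    have := profile_sub_ge (c := 1) hs (by simp) (by rwa [abs_of_nonneg hs])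
    rw [profile_zero, sub_zero, sub_zero] at this
    exact ⟨h1, this.trans ((le_abs_self _).trans h)⟩
  rcases le_total 0 s with hs | hs
  · rw [abs_of_nonneg hs]; exact key s hs h
  · rw [abs_of_nonpos hs]
    exact key (-s) (by linarith) (by rwa [profile_neg, abs_neg])

/-- Taylor expansion of the profile, valid on the whole line. -/
lemma abs_profile_sub_taylor_le (s : ℝ) :
    |profile s - gaussDensity 0 * (s - s ^ 3 / 12)| ≤ gaussDensity 0 * |s| ^ 5 := by
  have h1 : ∫ u in (0 : ℝ)..s, (gaussDensity 0 * (1 - u ^ 2 / 4))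
      = gaussDensity 0 * (s - s ^ 3 / 12) := by
    rw [intervalIntegral.integral_const_mul, intervalIntegral.integral_sub (by simp)
      ((by fun_prop : Continuous fun u : ℝ => u ^ 2 / 4).intervalIntegrable _ _),
      intervalIntegral.integral_div, integral_pow]
    simp
    left; ring
  rw [← h1, profile, ← intervalIntegral.integral_sub
    (continuous_gaussDensity.intervalIntegrable _ _)
    ((by fun_prop : Continuous fun u : ℝ => gaussDensity 0 * (1 - u ^ 2 / 4)).intervalIntegrable
      _ _)]
  have h2 : ∀ u ∈ uIoc 0 s, ‖gaussDensity u - gaussDensity 0 * (1 - u ^ 2 / 4)‖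
      ≤ gaussDensity 0 * |s| ^ 4 := by
    intro u hu
    have hus : |u| ≤ |s| := by
      rcases le_total 0 s with h | h
      · rw [uIoc_of_le h] at hu
        rw [abs_of_nonneg h, abs_of_pos hu.1]; exact hu.2
      · rw [uIoc_of_ge h] at hu
        rw [abs_of_nonpos h, abs_of_nonpos hu.2]; linarith [hu.1]
    rw [gaussDensity_eq u, ← mul_sub, norm_mul, Real.norm_eq_abs, Real.norm_eq_abs,
      abs_of_pos (gaussDensity_pos 0)]
    refine mul_le_mul_of_nonneg_left ?_ (gaussDensity_pos 0).le
    have hq : |u| ^ 4 ≤ |s| ^ 4 := by gcongr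
    refine le_trans ?_ hq
    have e4 : |u| ^ 4 = (u ^ 2) ^ 2 := by rw [← sq_abs u]; ring
    rw [e4]
    set q := u ^ 2
    have hq0 : 0 ≤ q := sq_nonneg u
    rw [abs_le]
    constructor
    · have := Real.add_one_le_exp (-q / 4)
      nlinarith
    · rcases le_total q 4 with h | h
      · have := Real.abs_exp_sub_one_sub_id_le (x := -q / 4)
          (by rw [abs_le]; constructor <;> linarith)
        have := (abs_le.1 this).2
        nlinarith
      · have := Real.exp_le_one_iff.2 (by linarith : -q / 4 ≤ 0)
        nlinarith
  have h3 := intervalIntegral.norm_integral_le_of_norm_le_const h2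
  rw [sub_zero, Real.norm_eq_abs] at h3
  refine h3.trans_eq ?_
  ring

/-! ### Averages of regions close to subgraphs -/

lemma integral_indicator_Iic (a : ℝ) :
    ∫ s, (Iic a).indicator (fun _ => (1 : ℝ)) s ∂gaussianReal 0 2 = 1 / 2 + profile a := by
  have hint : Integrable gaussDensity := by
    simpa using integrable_gaussianReal_iff.1 (integrable_const (1 : ℝ))
  have h0 : ∫ s, gaussDensity s = 1 := by
    have := integral_gaussianReal fun _ => 1
    simp only [mul_one, integral_const, probReal_univ, smul_eq_mul] at this
    exact this.symm
  have hhalf : ∫ s in Iic 0, gaussDensity s = 1 / 2 := by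
    have h1 : ∫ s in Iic 0, gaussDensity s = ∫ s in Ioi 0, gaussDensity s := by
      have := integral_comp_neg_Iic 0 gaussDensity
      simpa [gaussDensity_neg] using this
    have h2 := intervalIntegral.integral_Iic_add_Ioi (b := 0) hint.integrableOn hint.integrableOn
    rw [h0] at h2
    linarith
  have e : ∀ s, gaussDensity s * (Iic a).indicator (fun _ => (1 : ℝ)) s
      = (Iic a).indicator gaussDensity s := fun s => by
    by_cases h : s ∈ Iic a <;> simp [h]
  rw [integral_gaussianReal]
  simp_rw [e]
  rw [integral_indicator measurableSet_Iic, ← hhalf, profile,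
    ← intervalIntegral.integral_Iic_sub_Iic hint.integrableOn hint.integrableOn]
  ring

lemma integral_indicator_Icc_le {a b : ℝ} (hab : a ≤ b) :
    ∫ s, (Icc a b).indicator (fun _ => (1 : ℝ)) s ∂gaussianReal 0 2
      ≤ gaussDensity 0 * (b - a) := by
  have e : ∀ s, gaussDensity s * (Icc a b).indicator (fun _ => (1 : ℝ)) s
      = (Icc a b).indicator gaussDensity s := fun s => by
    by_cases h : s ∈ Icc a b <;> simp [h]
  rw [integral_gaussianReal]
  simp_rw [e]
  rw [integral_indicator measurableSet_Icc]
  have h := setIntegral_mono_on (s := Icc a b) (μ := volume) (f := gaussDensity)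
    (g := fun _ => gaussDensity 0) continuous_gaussDensity.continuousOn.integrableOn_Icc
    (by simp) measurableSet_Icc fun u _ => gaussDensity_le u
  refine h.trans_eq ?_
  simp [hab, mul_comm]

/-- If `v` is a step at `a` up to `b`, as far as `|s| < R`, then its Gaussian average is
the profile up to `b` and any power of `1 / R`. -/
lemma abs_integral_step_sub_le (K : ℕ) {v : ℝ → ℝ} (hv : Measurable v)
    (hv01 : ∀ s, 0 ≤ v s ∧ v s ≤ 1)
    {a b R η : ℝ} (hb : 0 ≤ b) (hR : 0 < R) (hη : |η| ≤ R / 2)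
    (h1 : ∀ s, |s| < R → s ≤ a - b → v s = 1) (h0 : ∀ s, |s| < R → a + b < s → v s = 0) :
    |∫ s, v (η + s) ∂gaussianReal 0 2 - 1 / 2 - profile (a - η)| ≤
      2 * gaussDensity 0 * b
        + (2 / R) ^ K * ∫ s, (1 + ‖s‖) ^ K ∂gaussianReal 0 2 := by
  have iv : Integrable (fun s => v (η + s)) (gaussianReal 0 2) :=
    (integrable_const (1 : ℝ)).mono' (hv.comp (by fun_prop)).aestronglyMeasurable
      (.of_forall fun s => by rw [Real.norm_eq_abs, abs_of_nonneg (hv01 _).1]; exact (hv01 _).2)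
  have ii (A : Set ℝ) (hA : MeasurableSet A) :
      Integrable (A.indicator fun _ => (1 : ℝ)) (gaussianReal 0 2) :=
    (integrable_const (1 : ℝ)).indicator hA
  have iw := (integrable_one_add_norm_pow (gaussianReal 0 2) K).const_mul ((2 / R) ^ K)
  rw [sub_sub, ← integral_indicator_Iic, ← integral_sub iv (ii _ measurableSet_Iic)]
  have hIcc := integral_indicator_Icc_le (by linarith : a - η - b ≤ a - η + b)
  have hbound : ∀ s, ‖v (η + s) - (Iic (a - η)).indicator (fun _ => (1 : ℝ)) s‖ ≤
      (Icc (a - η - b) (a - η + b)).indicator (fun _ => (1 : ℝ)) s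
        + (2 / R) ^ K * (1 + ‖s‖) ^ K := by
    intro s
    have hw : 0 ≤ (2 / R) ^ K * (1 + ‖s‖) ^ K := by positivity
    have hi : 0 ≤ (Icc (a - η - b) (a - η + b)).indicator (fun _ => (1 : ℝ)) s :=
      indicator_nonneg (fun _ _ => zero_le_one) s
    have hle : ‖v (η + s) - (Iic (a - η)).indicator (fun _ => (1 : ℝ)) s‖ ≤ 1 := by
      obtain ⟨p, q⟩ := hv01 (η + s)
      rw [Real.norm_eq_abs, abs_le]
      by_cases h : s ∈ Iic (a - η) <;> simp only [h, indicator_of_mem, indicator_of_notMem,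
        not_false_iff] <;> constructor <;> linarith
    by_cases hs : |η + s| < R
    · by_cases hm : s ∈ Icc (a - η - b) (a - η + b)
      · rw [indicator_of_mem hm]; linarith
      · have : v (η + s) - (Iic (a - η)).indicator (fun _ => (1 : ℝ)) s = 0 := by
          rw [mem_Icc, not_and_or, not_le, not_le] at hm
          rcases hm with hm | hm
          · rw [h1 _ hs (by linarith), indicator_of_mem (by rw [mem_Iic]; linarith), sub_self]
          · rw [h0 _ hs (by linarith), indicator_of_notMem (by rw [mem_Iic]; linarith), sub_self]
        rw [this, norm_zero]
        positivity
    · have h3 : R / 2 ≤ ‖s‖ := by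
        have := abs_add_le η s
        rw [Real.norm_eq_abs]
        linarith
      have h4 : 1 ≤ (2 / R) ^ K * (1 + ‖s‖) ^ K := by
        rw [← mul_pow]
        apply one_le_pow₀
        rw [div_mul_eq_mul_div, le_div_iff₀ hR]
        linarith
      linarith
  have := norm_integral_le_of_norm_le ((ii _ measurableSet_Icc).add iw) (.of_forall hbound)
  simp only [Pi.add_apply] at this
  rw [integral_add (ii _ measurableSet_Icc) iw, integral_const_mul] at this
  rw [Real.norm_eq_abs] at this
  linarith

section Average
variable {n : ℕ}

/-- The Gaussian average of (the indicator of) a region of `ℝ^n × ℝ`. -/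
def regionAvg (U : Set (Space n × ℝ)) (ξ : Space n) (η : ℝ) : ℝ :=
  ∫ y, ∫ s, U.indicator (fun _ => (1 : ℝ)) (ξ + y, η + s) ∂gaussianReal 0 2 ∂gaussMeasure n

/-- For small `ε`, the region `U ε` is, as far as `|η| < R / ε`, the set below the graph of
`ε h ε` up to an error `O(ε^(k+1))` with a weight that is polynomial in `ξ`. There is no bound on
`ξ`: where the weight exceeds `R / ε^(k+2)`, the condition is void. -/
def IsSubgraphUpTo (k : ℕ) (U : ℝ → Set (Space n × ℝ)) (h : ℝ → Space n → ℝ) : Prop :=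
  ∃ C : ℝ, ∃ N : ℕ, ∃ R ε₀ : ℝ, 0 ≤ C ∧ 0 < R ∧ 0 < ε₀ ∧ ε₀ ≤ 1 ∧
    ∀ ε, 0 < ε → ε < ε₀ → ∀ ξ η, |η| < R / ε →
      (η ≤ ε * h ε ξ - C * ε ^ (k + 1) * (1 + ‖ξ‖) ^ N → (ξ, η) ∈ U ε) ∧
      (ε * h ε ξ + C * ε ^ (k + 1) * (1 + ‖ξ‖) ^ N < η → (ξ, η) ∉ U ε)

lemma gaussMeasure_weight (n N : ℕ) :
    Integrable (fun y => (1 + ‖y‖) ^ N) (gaussMeasure n) :=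
  integrable_one_add_norm_pow _ N

lemma polyBigO_shift {h : ℝ → Space n → ℝ} {k : ℕ} (hh : PolyBigO k h) :
    PolyBigO k fun ε (p : Space n × Space n) => h ε (p.1 + p.2) :=
  hh.comp_clm (ContinuousLinearMap.fst ℝ _ _ + ContinuousLinearMap.snd ℝ _ _)

lemma measurable_section (U : Set (Space n × ℝ)) (hU : MeasurableSet U) (ξ : Space n) (η : ℝ) :
    Measurable fun y => ∫ s, U.indicator (fun _ => (1 : ℝ)) (ξ + y, η + s) ∂gaussianReal 0 2 := by
  have : StronglyMeasurable (Function.uncurry fun (y : Space n) (s : ℝ) =>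
      U.indicator (fun _ => (1 : ℝ)) (ξ + y, η + s)) := by
    apply Measurable.stronglyMeasurable
    exact (measurable_const.indicator hU).comp (by fun_prop)
  exact this.integral_prod_right.measurable

lemma indicator_one_mem_Icc (U : Set (Space n × ℝ)) (p : Space n × ℝ) :
    0 ≤ U.indicator (fun _ => (1 : ℝ)) p ∧ U.indicator (fun _ => (1 : ℝ)) p ≤ 1 := by
  by_cases h : p ∈ U <;> simp [h]

lemma integrable_section (U : Set (Space n × ℝ)) (hU : MeasurableSet U) (ξ : Space n) (η : ℝ) :
    Integrable (fun y => ∫ s, U.indicator (fun _ => (1 : ℝ)) (ξ + y, η + s) ∂gaussianReal 0 2)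
      (gaussMeasure n) := by
  refine (integrable_const (1 : ℝ)).mono' (measurable_section U hU ξ η).aestronglyMeasurable
    (.of_forall fun y => ?_)
  have := norm_integral_le_of_norm_le_const (μ := gaussianReal 0 2) (C := 1)
    (f := fun s => U.indicator (fun _ => (1 : ℝ)) (ξ + y, η + s)) (.of_forall fun s => by
      obtain ⟨p, q⟩ := indicator_one_mem_Icc U (ξ + y, η + s)
      rwa [Real.norm_eq_abs, abs_of_nonneg p])
  simpa using this

lemma integrable_profile {h : ℝ → Space n → ℝ} (hh : PolyBigO 0 h) (hm : ∀ ε, Measurable (h ε))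
    {ε : ℝ} (h0 : 0 < ε) (h1 : ε ≤ 1) (ξ : Space n) (η : ℝ) :
    Integrable (fun y => profile (ε * h ε (ξ + y) - η)) (gaussMeasure n) := by
  have i : Integrable (fun y => h ε (ξ + y)) (gaussMeasure n) :=
    (polyBigO_shift hh).integrable_right (gaussMeasure_weight n) h0 h1 ξ
      ((hm ε).comp (by fun_prop))
  refine (((i.const_mul ε).sub (integrable_const η)).norm.const_mul (gaussDensity 0)).mono'
    (continuous_profile.measurable.comp (((hm ε).comp (by fun_prop)).const_mul ε |>.sub_const η)
      ).aestronglyMeasurable (.of_forall fun y => ?_)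
  have := abs_profile_sub_le 0 (ε * h ε (ξ + y) - η)
  rwa [profile_zero, sub_zero, sub_zero] at this

/-- The average of a near-subgraph is given by the profile of its height. -/
lemma IsSubgraphUpTo.regionAvg_sub {k : ℕ} {U : ℝ → Set (Space n × ℝ)} {h : ℝ → Space n → ℝ}
    (hUh : IsSubgraphUpTo k U h) (hU : ∀ ε, MeasurableSet (U ε)) (hh : PolyBigO 0 h)
    (hm : ∀ ε, Measurable (h ε)) :
    LocBigO (k + 1) fun ε ξ η => regionAvg (U ε) ξ η - 1 / 2
      - ∫ y, profile (ε * h ε (ξ + y) - η) ∂gaussMeasure n := by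
  obtain ⟨C, N, R, ε₀, hC, hR, hε, hε1, H⟩ := hUh
  set A := ∫ y, (1 + ‖y‖) ^ N ∂gaussMeasure n
  set B := ∫ s, (1 + ‖s‖) ^ (k + 1) ∂gaussianReal 0 2
  have hA : 0 ≤ A := integral_nonneg fun y => by positivity
  have hB : 0 ≤ B := integral_nonneg fun y => by positivity
  have hg := (gaussDensity_pos 0).le
  refine ⟨2 * gaussDensity 0 * C * A + (2 / R) ^ (k + 1) * B, N, R / 2, ε₀, by positivity,
    by positivity, hε, hε1, fun ε h0 h1 ξ η hη => ?_⟩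
  have hw : (1 : ℝ) ≤ (1 + ‖ξ‖) ^ N := one_le_pow₀ (by linarith [norm_nonneg ξ])
  have e : regionAvg (U ε) ξ η - 1 / 2 - ∫ y, profile (ε * h ε (ξ + y) - η) ∂gaussMeasure n
      = ∫ y, (∫ s, (U ε).indicator (fun _ => (1 : ℝ)) (ξ + y, η + s) ∂gaussianReal 0 2 - 1 / 2
          - profile (ε * h ε (ξ + y) - η)) ∂gaussMeasure n := by
    have hi : Integrable (fun y => ∫ s, (U ε).indicator (fun _ => (1 : ℝ)) (ξ + y, η + s)
        ∂gaussianReal 0 2 - 1 / 2) (gaussMeasure n) :=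
      (integrable_section (U ε) (hU ε) ξ η).sub (integrable_const _)
    rw [integral_sub hi (integrable_profile hh hm h0 (h1.le.trans hε1) ξ η),
      integral_sub (integrable_section (U ε) (hU ε) ξ η) (integrable_const _)]
    simp [regionAvg]
  have hRε : R / 2 / ε = R / ε / 2 := by ring
  rw [hRε] at hη
  have hb : ∀ y, ‖∫ s, (U ε).indicator (fun _ => (1 : ℝ)) (ξ + y, η + s) ∂gaussianReal 0 2 - 1 / 2
          - profile (ε * h ε (ξ + y) - η)‖ ≤
      2 * gaussDensity 0 * C * ε ^ (k + 1) * (1 + ‖ξ‖) ^ N * (1 + ‖y‖) ^ N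
        + (2 / R) ^ (k + 1) * B * ε ^ (k + 1) := by
    intro y
    have hstep := abs_integral_step_sub_le (k + 1)
      (v := fun s => (U ε).indicator (fun _ => (1 : ℝ)) (ξ + y, s))
      (b := C * ε ^ (k + 1) * (1 + ‖ξ + y‖) ^ N) (a := ε * h ε (ξ + y)) (R := R / ε) (η := η)
      ((measurable_const.indicator (hU ε)).comp (by fun_prop))
      (fun s => indicator_one_mem_Icc _ _) (by positivity) (by positivity) hη.le
      (fun s hs hle => indicator_of_mem ((H ε h0 h1 (ξ + y) s hs).1 hle) _)
      (fun s hs hlt => indicator_of_notMem ((H ε h0 h1 (ξ + y) s hs).2 hlt) _)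
    refine hstep.trans ?_
    have hn : 1 + ‖ξ + y‖ ≤ (1 + ‖ξ‖) * (1 + ‖y‖) := by
      have := norm_add_le ξ y
      nlinarith [norm_nonneg ξ, norm_nonneg y]
    have hp : (1 + ‖ξ + y‖) ^ N ≤ (1 + ‖ξ‖) ^ N * (1 + ‖y‖) ^ N := by
      rw [← mul_pow]; gcongr
    have e2 : (2 / (R / ε)) ^ (k + 1) = (2 / R) ^ (k + 1) * ε ^ (k + 1) := by
      rw [← mul_pow]; congr 1; field_simp
    rw [e2]
    have : 2 * gaussDensity 0 * (C * ε ^ (k + 1) * (1 + ‖ξ + y‖) ^ N)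
        ≤ 2 * gaussDensity 0 * (C * ε ^ (k + 1) * ((1 + ‖ξ‖) ^ N * (1 + ‖y‖) ^ N)) := by
      gcongr
    linarith
  beta_reduce
  rw [e]
  have hI := norm_integral_le_of_norm_le
    (((gaussMeasure_weight n N).const_mul
      (2 * gaussDensity 0 * C * ε ^ (k + 1) * (1 + ‖ξ‖) ^ N)).add
      (integrable_const ((2 / R) ^ (k + 1) * B * ε ^ (k + 1)))) (.of_forall hb)
  simp only [Pi.add_apply] at hI
  rw [integral_add ((gaussMeasure_weight n N).const_mul _) (integrable_const _),
    integral_const_mul, integral_const, probReal_univ, one_smul] at hI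
  refine hI.trans ?_
  have : (2 / R) ^ (k + 1) * B * ε ^ (k + 1) * 1
      ≤ (2 / R) ^ (k + 1) * B * ε ^ (k + 1) * (1 + ‖ξ‖) ^ N := by gcongr
  linarith

end Average

/-! ### One stage of the scheme -/

lemma mul_neg_of_abs_add_lt {x g u : ℝ} (h : |x + g * u| < g * |u|) : x * u < 0 := by
  obtain ⟨h1, h2⟩ := abs_lt.1 h
  rcases lt_trichotomy u 0 with hu | hu | hu
  · rw [abs_of_neg hu] at h1 h2
    exact mul_neg_of_pos_of_neg (by linarith) hu
  · rw [hu, abs_zero, mul_zero] at h1 h2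
    linarith
  · rw [abs_of_pos hu] at h1 h2
    exact mul_neg_of_neg_of_pos (by linarith) hu

lemma mul_sub_neg_of_abs_add_profile_lt {x η b : ℝ} (h : |x + profile η| < |profile η|)
    (hb : |b| < |η|) : x * (η - b) < 0 := by
  obtain ⟨h1, h2⟩ := abs_lt.1 h
  have h3 := abs_lt.1 hb
  rcases le_total 0 η with hs | hs
  · have hp := profile_mono hs
    rw [profile_zero] at hp
    rw [abs_of_nonneg hs] at h3
    rw [abs_of_nonneg hp] at h1 h2
    exact mul_neg_of_neg_of_pos (by linarith) (by linarith)
  · have hp := profile_mono hs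
    rw [profile_zero] at hp
    rw [abs_of_nonpos hs] at h3
    rw [abs_of_nonpos hp] at h1 h2
    exact mul_neg_of_pos_of_neg (by linarith) (by linarith)

/-- Sign of a function `X` that is `-Ψ(η)` to leading order, and `g(0) (ε h - η)` to higher order:
it changes sign across the graph `η = ε h`, up to a layer of width `O(ε^(k+1))`. -/
lemma exists_sign_layer {E : Type*} [NormedAddCommGroup E] {k : ℕ} {X : ℝ → E → ℝ → ℝ}
    {h : ℝ → E → ℝ} (hh : PolyBigO 0 h)
    (hcoarse : LocBigO 1 fun ε ξ η => X ε ξ η + profile η)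
    (hfine : ∃ A : ℝ, ∃ N : ℕ, ∃ R ε₀ : ℝ, 0 ≤ A ∧ 0 < R ∧ 0 < ε₀ ∧ ε₀ ≤ 1 ∧
      ∀ ε, 0 < ε → ε < ε₀ → ∀ ξ η, |η| < R / ε →
        |X ε ξ η - gaussDensity 0 * (ε * h ε ξ - η)| ≤
          A * (ε ^ (k + 1) + ε ^ 2 * |η - ε * h ε ξ|) * ((1 + ‖ξ‖) * (1 + |η| / ε)) ^ N) :
    ∃ C : ℝ, ∃ N : ℕ, ∃ R ε₀ : ℝ, 0 ≤ C ∧ 0 < R ∧ 0 < ε₀ ∧ ε₀ ≤ 1 ∧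
      ∀ ε, 0 < ε → ε < ε₀ → ∀ ξ η, |η| < R / ε →
        C * ε ^ (k + 1) * (1 + ‖ξ‖) ^ N ≤ |η - ε * h ε ξ| → X ε ξ η * (η - ε * h ε ξ) < 0 := by
  obtain ⟨H, N₀, hH, hh⟩ := hh
  obtain ⟨A₁, N₁, R₁, ε₁, hA₁, hR₁, hε₁, hε₁', H₁⟩ := hcoarse
  obtain ⟨A₂, N₂, R₂, ε₂, hA₂, hR₂, hε₂, hε₂', H₂⟩ := hfine
  have hg0 := gaussDensity_pos 0
  have hg1 := gaussDensity_pos 1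
  generalize hG₀ : gaussDensity 0 = g₀ at *
  generalize hG₁ : gaussDensity 1 = g₁ at *
  have hΨ : 0 < profile 1 := profile_pos one_pos
  generalize hP : profile 1 = p at *
  -- a common constant for the coarse estimate and the bound of the height
  obtain ⟨A, hA⟩ : ∃ A : ℝ, A = A₁ + g₀ * H + 1 := ⟨_, rfl⟩
  obtain ⟨M, hM⟩ : ∃ M : ℕ, M = N₁ + N₀ := ⟨_, rfl⟩
  have hA0 : 0 < A := by rw [hA]; positivity
  -- the threshold for the weight above which the layer covers everything
  obtain ⟨B, hB⟩ : ∃ B : ℝ, B = A + 2 * A₂ / g₀ * (1 + A / g₁) ^ N₂ := ⟨_, rfl⟩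
  obtain ⟨L, hL⟩ : ∃ L : ℕ, L = M + (M + 1) * N₂ := ⟨_, rfl⟩
  obtain ⟨c, hc⟩ : ∃ c : ℝ, c = min p 1 / 2 := ⟨_, rfl⟩
  have hc0 : 0 < c := by rw [hc]; positivity
  have hB0 : 0 < B := by rw [hB]; positivity
  obtain ⟨R, hRdef⟩ : ∃ R : ℝ, R = min R₁ R₂ := ⟨_, rfl⟩
  have hR : 0 < R := hRdef ▸ lt_min hR₁ hR₂
  obtain ⟨C, hC⟩ : ∃ C : ℝ, C = (H + R + 1) * (B / c) ^ (k + 2)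
      + 4 * A₂ / g₀ * (1 + A / g₁) ^ N₂ + 1 := ⟨_, rfl⟩
  obtain ⟨N, hN⟩ : ∃ N : ℕ, N = N₀ + L * (k + 2) := ⟨_, rfl⟩
  have hC0 : 0 ≤ C := by rw [hC]; positivity
  refine ⟨C, N, R, min ε₁ ε₂, hC0, hR, lt_min hε₁ hε₂,
    (min_le_left _ _).trans hε₁', fun ε h0 h1 ξ η hη hlayer => ?_⟩
  have hε1 : ε ≤ 1 := (h1.le.trans (min_le_left _ _)).trans hε₁'
  have b1 := H₁ ε h0 (h1.trans_le (min_le_left _ _)) ξ η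
    (hη.trans_le (by gcongr; exact hRdef ▸ min_le_left _ _))
  have b2 := H₂ ε h0 (h1.trans_le (min_le_right _ _)) ξ η
    (hη.trans_le (by gcongr; exact hRdef ▸ min_le_right _ _))
  have b0 := hh ε h0 hε1 ξ
  rw [pow_zero, mul_one] at b0
  rw [pow_one] at b1
  beta_reduce at b1
  have hw1 : (1 : ℝ) ≤ 1 + ‖ξ‖ := by linarith [norm_nonneg ξ]
  generalize 1 + ‖ξ‖ = w at *
  generalize X ε ξ η = x at *
  generalize h ε ξ = h' at *
  have hw (j l : ℕ) (hjl : j ≤ l) : w ^ j ≤ w ^ l := pow_le_pow_right₀ hw1 hjl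
  have hwpos (j : ℕ) : 1 ≤ w ^ j := one_le_pow₀ hw1
  by_cases hlarge : c ≤ ε * (B * w ^ L)
  · -- the layer covers everything
    exfalso
    have e1 : 1 ≤ (B / c) ^ (k + 2) * ε ^ (k + 2) * w ^ (L * (k + 2)) := by
      have : (B / c) ^ (k + 2) * ε ^ (k + 2) * w ^ (L * (k + 2))
          = (ε * (B * w ^ L) / c) ^ (k + 2) := by
        rw [pow_mul, ← mul_pow, ← mul_pow]; congr 1; ring
      rw [this]
      exact one_le_pow₀ (by rwa [le_div_iff₀ hc0, one_mul])
    have e2 : (H + R + 1) * w ^ N₀ ≤ C * ε ^ (k + 2) * w ^ N := by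
      have : (H + R + 1) * (B / c) ^ (k + 2) ≤ C := by
        rw [hC]
        have : 0 ≤ 4 * A₂ / g₀ * (1 + A / g₁) ^ N₂ := by positivity
        linarith
      calc (H + R + 1) * w ^ N₀ ≤ (H + R + 1) * w ^ N₀ *
            ((B / c) ^ (k + 2) * ε ^ (k + 2) * w ^ (L * (k + 2))) :=
            le_mul_of_one_le_right (by positivity) e1
        _ = (H + R + 1) * (B / c) ^ (k + 2) * ε ^ (k + 2) * w ^ N := by rw [hN, pow_add]; ring
        _ ≤ _ := by gcongr
    have e3 : |η - ε * h'| * ε ≤ (H + R) * w ^ N₀ := by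
      have t1 : |η| * ε < R := by rwa [lt_div_iff₀ h0] at hη
      have t2 : |η - ε * h'| ≤ |η| + ε * |h'| := by
        have := abs_sub η (ε * h')
        rwa [abs_mul, abs_of_pos h0] at this
      have t3 : ε * |h'| * ε ≤ H * w ^ N₀ := by
        have : ε * |h'| * ε = ε * ε * |h'| := by ring
        rw [this]
        have : ε * ε ≤ 1 := mul_le_one₀ hε1 h0.le hε1
        calc ε * ε * |h'| ≤ 1 * |h'| := by gcongr
          _ ≤ _ := by rwa [one_mul]
      have t4 := mul_le_mul_of_nonneg_right t2 h0.le
      have t5 := le_mul_of_one_le_right hR.le (hwpos N₀)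
      linarith
    have e4 := mul_le_mul_of_nonneg_right hlayer h0.le
    have e5 : C * ε ^ (k + 1) * w ^ N * ε = C * ε ^ (k + 2) * w ^ N := by ring
    have := hwpos N₀
    linarith
  push Not at hlarge
  have hsmall : ε * (A * w ^ M) < c := by
    refine lt_of_le_of_lt ?_ hlarge
    have : A ≤ B := by
      rw [hB]
      have : 0 ≤ 2 * A₂ / g₀ * (1 + A / g₁) ^ N₂ := by positivity
      linarith
    have := hw M L (by omega)
    gcongr
  have hcp : c < p := by
    rw [hc]; have := min_le_left p 1; linarith
  have bcoarse : |x + profile η| ≤ ε * ((A - g₀ * H - 1) * w ^ M) := by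
    have : A - g₀ * H - 1 = A₁ := by rw [hA]; ring
    rw [this]
    calc _ ≤ A₁ * ε * w ^ N₁ := b1
      _ ≤ A₁ * ε * w ^ M := by have := hw N₁ M (by omega); gcongr
      _ = _ := by ring
  have bh : |h'| ≤ H * w ^ M := b0.trans (by have := hw N₀ M (by omega); gcongr)
  have hwM := hwpos M
  by_cases hprof : |profile η| ≤ ε * (A * w ^ M)
  · -- near the interface the higher order estimate decides
    obtain ⟨hη1, hη2⟩ := abs_le_of_abs_profile_lt hprof (hP ▸ hsmall.trans hcp)
    rw [hG₁] at hη2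
    have hζ : 1 + |η| / ε ≤ (1 + A / g₁) * w ^ M := by
      have : |η| / ε ≤ A / g₁ * w ^ M := by
        rw [div_mul_eq_mul_div, div_le_div_iff₀ h0 hg1]
        linarith
      linarith
    have hwt : (w * (1 + |η| / ε)) ^ N₂ ≤ (1 + A / g₁) ^ N₂ * w ^ L := by
      calc (w * (1 + |η| / ε)) ^ N₂ ≤ (w * ((1 + A / g₁) * w ^ M)) ^ N₂ := by gcongr
        _ = (1 + A / g₁) ^ N₂ * w ^ ((M + 1) * N₂) := by
          rw [pow_mul, ← mul_pow]; congr 1; ring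
        _ ≤ _ := by have := hw ((M + 1) * N₂) L (by omega); gcongr
    have hD0 : 0 ≤ |η - ε * h'| := abs_nonneg _
    generalize hD : |η - ε * h'| = D at *
    obtain ⟨Q, hQ⟩ : ∃ Q : ℝ, Q = A₂ * ((1 + A / g₁) ^ N₂ * w ^ L) := ⟨_, rfl⟩
    have hQ0 : 0 ≤ Q := by rw [hQ]; positivity
    have b3 : |x - g₀ * (ε * h' - η)| ≤ ε ^ (k + 1) * Q + ε ^ 2 * D * Q := by
      refine b2.trans ?_
      calc _ ≤ A₂ * (ε ^ (k + 1) + ε ^ 2 * D) * ((1 + A / g₁) ^ N₂ * w ^ L) := by gcongr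
        _ = _ := by rw [hQ]; ring
    have b4 : ε ^ 2 * Q ≤ g₀ / 4 := by
      have : 2 * Q ≤ g₀ * (B * w ^ L) := by
        rw [hQ, hB]
        have : g₀ * ((A + 2 * A₂ / g₀ * (1 + A / g₁) ^ N₂) * w ^ L)
          = g₀ * A * w ^ L + 2 * (A₂ * ((1 + A / g₁) ^ N₂ * w ^ L)) := by field_simp
        rw [this]
        have : 0 ≤ g₀ * A * w ^ L := by positivity
        linarith
      have hc1 : c ≤ 1 / 2 := by rw [hc]; have := min_le_right p 1; linarith
      have e1 := mul_le_mul_of_nonneg_left this h0.le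
      have e2 := mul_le_mul_of_nonneg_left (hlarge.le.trans hc1) hg0.le
      have e3 : ε * Q ≤ g₀ / 4 := by linarith
      calc ε ^ 2 * Q = ε * (ε * Q) := by ring
        _ ≤ 1 * (ε * Q) := by gcongr
        _ ≤ _ := by rwa [one_mul]
    have b5 : ε ^ (k + 1) * Q ≤ g₀ / 4 * D - g₀ / 4 * ε ^ (k + 1) := by
      have e1 : (4 * A₂ / g₀ * (1 + A / g₁) ^ N₂ + 1) * ε ^ (k + 1) * w ^ L ≤ D := by
        refine le_trans ?_ hlayer
        have : 4 * A₂ / g₀ * (1 + A / g₁) ^ N₂ + 1 ≤ C := by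
          rw [hC]
          have : 0 ≤ (H + R + 1) * (B / c) ^ (k + 2) := by positivity
          linarith
        have := hw L N (by
          rw [hN]
          exact (Nat.le_mul_of_pos_right L (by omega)).trans (Nat.le_add_left _ _))
        gcongr
      have e2 : g₀ / 4 * ((4 * A₂ / g₀ * (1 + A / g₁) ^ N₂ + 1) * ε ^ (k + 1) * w ^ L)
          = ε ^ (k + 1) * Q + g₀ / 4 * ε ^ (k + 1) * w ^ L := by
        rw [hQ]; field_simp
      have e3 : g₀ / 4 * ε ^ (k + 1) * 1 ≤ g₀ / 4 * ε ^ (k + 1) * w ^ L := by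
        have := hwpos L
        gcongr
      have := mul_le_mul_of_nonneg_left e1 (by positivity : 0 ≤ g₀ / 4)
      linarith
    have hpos : 0 < g₀ / 4 * ε ^ (k + 1) := by positivity
    have b6 : |x - g₀ * (ε * h' - η)| < g₀ * D := by
      have : ε ^ 2 * D * Q ≤ g₀ / 4 * D := by
        have := mul_le_mul_of_nonneg_right b4 hD0
        linarith
      have := mul_nonneg hg0.le hD0
      linarith
    refine mul_neg_of_abs_add_lt (g := g₀) ?_
    have : x + g₀ * (η - ε * h') = x - g₀ * (ε * h' - η) := by ring
    rwa [this, hD]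
  · -- away from the interface the profile decides
    push Not at hprof
    have hηbig : ε * |h'| < |η| := by
      have h2 : |profile η| ≤ g₀ * |η| := by
        simpa [profile_zero, hG₀] using abs_profile_sub_le 0 η
      have h3 : g₀ * (ε * |h'|) ≤ ε * (A * w ^ M) := by
        have : g₀ * H ≤ A := by rw [hA]; linarith
        calc g₀ * (ε * |h'|) ≤ g₀ * (ε * (H * w ^ M)) := by gcongr
          _ = ε * (g₀ * H * w ^ M) := by ring
          _ ≤ _ := by gcongr
      have : g₀ * (ε * |h'|) < g₀ * |η| := by linarith
      exact lt_of_mul_lt_mul_left this hg0.le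
    have hεh : |ε * h'| = ε * |h'| := by rw [abs_mul, abs_of_pos h0]
    have hx : |x + profile η| < |profile η| := by
      refine bcoarse.trans_lt (lt_of_le_of_lt ?_ hprof)
      have : A - g₀ * H - 1 ≤ A := by have := mul_nonneg hg0.le hH; linarith
      gcongr
    exact mul_sub_neg_of_abs_add_profile_lt hx (by rwa [hεh])

/-- The relevant part of the expansion of the profile: `Ψ(ε u) ≈ g(0) ε (u - ε² u³ / 12)`. -/
def cubicPart (ε u : ℝ) : ℝ := u - ε ^ 2 / 12 * u ^ 3

lemma abs_profile_sub_cubicPart_le {ε : ℝ} (h0 : 0 < ε) (u : ℝ) :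
    |profile (ε * u) - gaussDensity 0 * ε * cubicPart ε u|
      ≤ gaussDensity 0 * ε ^ 5 * |u| ^ 5 := by
  have h := abs_profile_sub_taylor_le (ε * u)
  have e : gaussDensity 0 * (ε * u - (ε * u) ^ 3 / 12) = gaussDensity 0 * ε * cubicPart ε u := by
    unfold cubicPart; ring
  rw [e, abs_mul, abs_of_pos h0, mul_pow] at h
  linarith

lemma abs_add_sub_le_of_expansion {g ε b ζ X₁ X₂ X₃ X₄ X₅ C₁ C₂ C₃ C₄ W : ℝ} {k : ℕ} (hk : k ≤ 4)
    (hg : 0 < g) (h0 : 0 < ε) (h1 : ε ≤ 1) (hC₁ : 0 ≤ C₁) (hC₂ : 0 ≤ C₂) (hC₃ : 0 ≤ C₃)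
    (hC₄ : 0 ≤ C₄) (hW : 0 ≤ W) (b₁ : |X₁| ≤ C₁ * ε ^ (k + 1) * W)
    (hE : |X₂ - g * ε * (X₅ + (b - ζ) - ε ^ 2 / 12 * (b - ζ) * X₃)| ≤ g * ε ^ 5 * X₄)
    (b₂ : X₄ ≤ C₂ * W) (b₃ : |X₃| ≤ C₃ * W) (b₄ : |X₅| ≤ C₄ * ε ^ k * W) :
    |X₁ + X₂ - g * (ε * b - ε * ζ)| ≤
      (C₁ + g * C₂ + g * C₄ + g * C₃) * (ε ^ (k + 1) + ε ^ 2 * |ε * ζ - ε * b|) * W := by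
  have e : X₁ + X₂ - g * (ε * b - ε * ζ)
      = X₁ + (X₂ - g * ε * (X₅ + (b - ζ) - ε ^ 2 / 12 * (b - ζ) * X₃))
        + g * ε * X₅ + g * ε ^ 2 / 12 * ((ε * ζ - ε * b) * X₃) := by ring
  rw [e]
  have t₁ : g * ε ^ 5 * X₄ ≤ g * C₂ * ε ^ (k + 1) * W := by
    have : ε ^ 5 ≤ ε ^ (k + 1) := pow_le_pow_of_le_one h0.le h1 (by omega)
    calc g * ε ^ 5 * X₄ ≤ g * ε ^ 5 * (C₂ * W) := by gcongr
      _ ≤ g * ε ^ (k + 1) * (C₂ * W) := by gcongr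
      _ = _ := by ring
  have t₂ : |g * ε * X₅| ≤ g * C₄ * ε ^ (k + 1) * W := by
    rw [abs_mul, abs_of_pos (by positivity : 0 < g * ε)]
    calc g * ε * |X₅| ≤ g * ε * (C₄ * ε ^ k * W) := by gcongr
      _ = _ := by ring
  have t₃ : |g * ε ^ 2 / 12 * ((ε * ζ - ε * b) * X₃)|
      ≤ g * C₃ * (ε ^ 2 * |ε * ζ - ε * b|) * W := by
    rw [abs_mul, abs_of_pos (by positivity : 0 < g * ε ^ 2 / 12), abs_mul]
    calc g * ε ^ 2 / 12 * (|ε * ζ - ε * b| * |X₃|)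
        ≤ g * ε ^ 2 * (|ε * ζ - ε * b| * (C₃ * W)) := by
          gcongr
          have : 0 ≤ g * ε ^ 2 := by positivity
          linarith
      _ = _ := by ring
  have s := abs_add_three (X₁ + (X₂ - g * ε * (X₅ + (b - ζ) - ε ^ 2 / 12 * (b - ζ) * X₃)))
    (g * ε * X₅) (g * ε ^ 2 / 12 * ((ε * ζ - ε * b) * X₃))
  have s' := abs_add_le X₁ (X₂ - g * ε * (X₅ + (b - ζ) - ε ^ 2 / 12 * (b - ζ) * X₃))
  have u₁ : 0 ≤ (g * C₃) * ε ^ (k + 1) * W := by positivity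
  have u₂ : 0 ≤ (C₁ + g * C₂ + g * C₄) * (ε ^ 2 * |ε * ζ - ε * b|) * W := by positivity
  linarith

section StageLemma
variable {n m k : ℕ}

/-- The residual of a candidate height `h'` in the equation that determines the next stage. -/
def stageDefect (γ : Fin m → ℝ) (h : Fin m → ℝ → Space n → ℝ) (h' : ℝ → Space n → ℝ)
    (ε : ℝ) (ξ : Space n) : ℝ :=
  ∑ i, γ i * ∫ y, cubicPart ε (h i ε (ξ + y) - h' ε ξ) ∂gaussMeasure n

lemma polyBigO_height_sub {h : ℝ → Space n → ℝ} (hh : PolyBigO 0 h) :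
    PolyBigO 0 fun ε (q : (Space n × ℝ) × Space n) => h ε (q.1.1 + q.2) - q.1.2 := by
  refine (hh.comp_clm ((ContinuousLinearMap.fst ℝ (Space n) ℝ).comp
      (ContinuousLinearMap.fst ℝ (Space n × ℝ) (Space n))
    + ContinuousLinearMap.snd ℝ (Space n × ℝ) (Space n) :
      (Space n × ℝ) × Space n →L[ℝ] Space n)).sub
    (PolyBigO.clm ((ContinuousLinearMap.snd ℝ (Space n) ℝ).comp
      (ContinuousLinearMap.fst ℝ (Space n × ℝ) (Space n)) :
      (Space n × ℝ) × Space n →L[ℝ] ℝ))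

lemma polyBigO_height_sub_height {h h' : ℝ → Space n → ℝ} (hh : PolyBigO 0 h)
    (hh' : PolyBigO 0 h') :
    PolyBigO 0 fun ε (q : (Space n × ℝ) × Space n) => h ε (q.1.1 + q.2) - h' ε q.1.1 := by
  refine (hh.comp_clm ((ContinuousLinearMap.fst ℝ (Space n) ℝ).comp
      (ContinuousLinearMap.fst ℝ (Space n × ℝ) (Space n))
    + ContinuousLinearMap.snd ℝ (Space n × ℝ) (Space n) :
      (Space n × ℝ) × Space n →L[ℝ] Space n)).sub
    (hh'.comp_clm ((ContinuousLinearMap.fst ℝ (Space n) ℝ).comp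
      (ContinuousLinearMap.fst ℝ (Space n × ℝ) (Space n)) :
      (Space n × ℝ) × Space n →L[ℝ] Space n))

/-- The integral of the profile, expanded about a height `b`. -/
lemma integral_profile_expansion {h : ℝ → Space n → ℝ} (hh : PolyBigO 0 h)
    (hm : ∀ ε, Measurable (h ε)) {ε : ℝ} (h0 : 0 < ε) (h1 : ε ≤ 1) (ξ : Space n) (ζ b : ℝ) :
    |(∫ y, profile (ε * h ε (ξ + y) - ε * ζ) ∂gaussMeasure n) - gaussDensity 0 * ε *
      ((∫ y, cubicPart ε (h ε (ξ + y) - b) ∂gaussMeasure n) + (b - ζ) - ε ^ 2 / 12 * (b - ζ) *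
        ∫ y, ((h ε (ξ + y) - ζ) ^ 2 + (h ε (ξ + y) - ζ) * (h ε (ξ + y) - b)
          + (h ε (ξ + y) - b) ^ 2) ∂gaussMeasure n)|
      ≤ gaussDensity 0 * ε ^ 5 * ∫ y, |h ε (ξ + y) - ζ| ^ 5 ∂gaussMeasure n := by
  have hw := gaussMeasure_weight n
  have hms : Measurable fun y => h ε (ξ + y) := (hm ε).comp (by fun_prop)
  have p1 : PolyBigO 0 fun ε (q : Space n × Space n) => h ε (q.1 + q.2) - ζ :=
    (polyBigO_shift hh).sub (PolyBigO.const ζ)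
  have p2 : PolyBigO 0 fun ε (q : Space n × Space n) => h ε (q.1 + q.2) - b :=
    (polyBigO_shift hh).sub (PolyBigO.const b)
  have i1 : Integrable (fun y => cubicPart ε (h ε (ξ + y) - b)) (gaussMeasure n) := by
    have := (p2.integrable_right hw h0 h1 ξ (hms.sub_const b)).sub
      (((p2.pow 3).integrable_right hw h0 h1 ξ ((hms.sub_const b).pow_const 3)).const_mul
        (ε ^ 2 / 12))
    exact this
  have i2 : Integrable (fun y => (h ε (ξ + y) - ζ) ^ 2 + (h ε (ξ + y) - ζ) * (h ε (ξ + y) - b)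
          + (h ε (ξ + y) - b) ^ 2) (gaussMeasure n) :=
    (((p1.pow 2).add (p1.mul p2)).add (p2.pow 2)).integrable_right hw h0 h1 ξ
      ((((hms.sub_const ζ).pow_const 2).add ((hms.sub_const ζ).mul (hms.sub_const b))).add
        ((hms.sub_const b).pow_const 2))
  have i3 : Integrable (fun y => |h ε (ξ + y) - ζ| ^ 5) (gaussMeasure n) :=
    (p1.abs.pow 5).integrable_right hw h0 h1 ξ (by fun_prop)
  have i4 := integrable_profile hh hm h0 h1 ξ (ε * ζ)
  have hprob : ∫ _y, (b - ζ) ∂gaussMeasure n = b - ζ := by simp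
  have i5 : Integrable (fun y => cubicPart ε (h ε (ξ + y) - b) + (b - ζ)) (gaussMeasure n) :=
    i1.add (integrable_const _)
  have i6 := i2.const_mul (ε ^ 2 / 12 * (b - ζ))
  have i7 : Integrable (fun y => gaussDensity 0 * ε * (cubicPart ε (h ε (ξ + y) - b) + (b - ζ)
      - ε ^ 2 / 12 * (b - ζ) * ((h ε (ξ + y) - ζ) ^ 2 + (h ε (ξ + y) - ζ) * (h ε (ξ + y) - b)
          + (h ε (ξ + y) - b) ^ 2))) (gaussMeasure n) := (i5.sub i6).const_mul _
  rw [← hprob, ← integral_add i1 (integrable_const _), hprob, ← integral_const_mul,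
    ← integral_sub i5 i6, ← integral_const_mul, ← integral_sub i4 i7, ← integral_const_mul]
  refine norm_integral_le_of_norm_le (G := ℝ) (i3.const_mul _) (.of_forall fun y => ?_)
  have := abs_profile_sub_cubicPart_le h0 (h ε (ξ + y) - ζ)
  rw [Real.norm_eq_abs]
  convert this using 3
  · ring_nf
  · unfold cubicPart
    ring

/-- If all earlier stages are subgraphs up to `O(ε^(k+1))`, and `h'` solves the stage
equation up to `O(ε^k)`, then the function that is thresholded in the next stage is `-Ψ(η)` to
leading order, and is proportional to `ε h' - η` to higher order. -/
theorem IsSubgraphUpTo.next_stage_aux (hk : k ≤ 4) {γ : Fin m → ℝ} (hγ : ∑ i, γ i = 1)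
    {U : Fin m → ℝ → Set (Space n × ℝ)} {h : Fin m → ℝ → Space n → ℝ}
    (hU : ∀ i ε, MeasurableSet (U i ε)) (hh : ∀ i, PolyBigO 0 (h i))
    (hm : ∀ i ε, Measurable (h i ε)) (hUh : ∀ i, IsSubgraphUpTo k (U i) (h i))
    {h' : ℝ → Space n → ℝ} (hh' : PolyBigO 0 h') (hdef : PolyBigO k (stageDefect γ h h')) :
    (LocBigO 1 fun ε ξ η => (∑ i, γ i * regionAvg (U i ε) ξ η - 1 / 2) + profile η) ∧
    ∃ A : ℝ, ∃ N : ℕ, ∃ R ε₀ : ℝ, 0 ≤ A ∧ 0 < R ∧ 0 < ε₀ ∧ ε₀ ≤ 1 ∧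
      ∀ ε, 0 < ε → ε < ε₀ → ∀ ξ η, |η| < R / ε →
        |(∑ i, γ i * regionAvg (U i ε) ξ η - 1 / 2) - gaussDensity 0 * (ε * h' ε ξ - η)| ≤
          A * (ε ^ (k + 1) + ε ^ 2 * |η - ε * h' ε ξ|) * ((1 + ‖ξ‖) * (1 + |η| / ε)) ^ N := by
  have hloc : LocBigO (k + 1) fun ε ξ η => ∑ i, γ i * (regionAvg (U i ε) ξ η - 1 / 2
      - ∫ y, profile (ε * h i ε (ξ + y) - η) ∂gaussMeasure n) :=
    LocBigO.sum Finset.univ fun i =>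
      ((hUh i).regionAvg_sub (hU i) (hh i) (hm i)).const_mul (γ i)
  have hg := gaussDensity_pos 0
  have hsplit : ∀ ε ξ η, ∑ i, γ i * regionAvg (U i ε) ξ η - 1 / 2
      = ∑ i, γ i * (regionAvg (U i ε) ξ η - 1 / 2
        - ∫ y, profile (ε * h i ε (ξ + y) - η) ∂gaussMeasure n)
        + ∑ i, γ i * ∫ y, profile (ε * h i ε (ξ + y) - η) ∂gaussMeasure n := by
    intro ε ξ η
    rw [← Finset.sum_add_distrib]
    have : ∀ i, γ i * (regionAvg (U i ε) ξ η - 1 / 2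
        - ∫ y, profile (ε * h i ε (ξ + y) - η) ∂gaussMeasure n)
        + γ i * ∫ y, profile (ε * h i ε (ξ + y) - η) ∂gaussMeasure n
        = γ i * regionAvg (U i ε) ξ η - γ i * (1 / 2) := fun i => by ring
    simp_rw [this]
    rw [Finset.sum_sub_distrib, ← Finset.sum_mul, hγ]
    ring
  constructor
  · -- to leading order the profile does not see the height
    have hc : LocBigO 1 fun ε ξ η => ∑ i, γ i *
        ∫ y, (profile (ε * h i ε (ξ + y) - η) - profile (-η)) ∂gaussMeasure n := by
      refine LocBigO.sum Finset.univ fun i => LocBigO.const_mul ?_ (γ i)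
      obtain ⟨C, N, hC, hb⟩ := (polyBigO_shift (hh i)).abs.integral (gaussMeasure_weight n)
      refine LocBigO.of_polyBigO (gaussDensity 0 * C) N (by positivity) fun ε h0 h1 ξ η => ?_
      have hi := (polyBigO_shift (hh i)).abs.integrable_right (gaussMeasure_weight n) h0 h1 ξ
        (by have := hm i ε; fun_prop)
      have := norm_integral_le_of_norm_le (μ := gaussMeasure n)
        (f := fun y => profile (ε * h i ε (ξ + y) - η) - profile (-η))
        (hi.const_mul (gaussDensity 0 * ε)) (.of_forall fun y => by
          have := abs_profile_sub_le (-η) (ε * h i ε (ξ + y) - η)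
          have e : ε * h i ε (ξ + y) - η - -η = ε * h i ε (ξ + y) := by ring
          rw [e, abs_mul, abs_of_pos h0, ← mul_assoc] at this
          exact this)
      rw [integral_const_mul] at this
      refine this.trans ?_
      have hb' := (le_abs_self _).trans (hb ε h0 h1 ξ)
      calc gaussDensity 0 * ε * ∫ y, |h i ε (ξ + y)| ∂gaussMeasure n
          ≤ gaussDensity 0 * ε * (C * ε ^ 0 * (1 + ‖ξ‖) ^ N) := by gcongr
        _ = _ := by ring
    refine ((hloc.mono (by omega)).add hc).congr fun ε h0 h1 ξ η => ?_
    rw [hsplit, add_assoc]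
    congr 1
    have : ∀ i, ∫ y, (profile (ε * h i ε (ξ + y) - η) - profile (-η)) ∂gaussMeasure n
        = (∫ y, profile (ε * h i ε (ξ + y) - η) ∂gaussMeasure n) + profile η := by
      intro i
      rw [integral_sub (integrable_profile (hh i) (hm i) h0 h1 ξ η) (integrable_const _)]
      simp [profile_neg]
    simp_rw [this, mul_add, Finset.sum_add_distrib, ← Finset.sum_mul, hγ, one_mul]
  · obtain ⟨C₁, N₁, R, ε₀, hC₁, hR, hε, hε1, hb₁⟩ := hloc
    have hq : PolyBigO 0 fun ε (p : Space n × ℝ) => ∑ i, |γ i| *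
        ∫ y, |h i ε (p.1 + y) - p.2| ^ 5 ∂gaussMeasure n :=
      PolyBigO.sum Finset.univ fun i => PolyBigO.const_mul
        (((polyBigO_height_sub (hh i)).abs.pow 5).integral (gaussMeasure_weight n)) _
    have hr : PolyBigO 0 fun ε (p : Space n × ℝ) => ∑ i, γ i *
        ∫ y, ((h i ε (p.1 + y) - p.2) ^ 2 + (h i ε (p.1 + y) - p.2) * (h i ε (p.1 + y) - h' ε p.1)
          + (h i ε (p.1 + y) - h' ε p.1) ^ 2) ∂gaussMeasure n := by
      refine PolyBigO.sum Finset.univ fun i => PolyBigO.const_mul ?_ _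
      have p1 := polyBigO_height_sub (hh i)
      have p2 := polyBigO_height_sub_height (hh i) hh'
      exact (((p1.pow 2).add (p1.mul p2)).add (p2.pow 2)).integral (gaussMeasure_weight n)
    obtain ⟨C₂, N₂, hC₂, hb₂⟩ := hq
    obtain ⟨C₃, N₃, hC₃, hb₃⟩ := hr
    obtain ⟨C₄, N₄, hC₄, hb₄⟩ := hdef
    refine ⟨C₁ + gaussDensity 0 * C₂ + gaussDensity 0 * C₄ + gaussDensity 0 * C₃,
      N₁ + N₂ + N₃ + N₄, R, ε₀, by positivity, hR, hε, hε1, fun ε h0 h1 ξ η hη => ?_⟩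
    have h1' : ε ≤ 1 := h1.le.trans hε1
    obtain ⟨ζ, rfl⟩ : ∃ ζ, η = ε * ζ := ⟨η / ε, by field_simp⟩
    have hζ : |ε * ζ| / ε = |ζ| := by rw [abs_mul, abs_of_pos h0]; field_simp
    have b₁ := hb₁ ε h0 h1 ξ (ε * ζ) hη
    have b₂ := hb₂ ε h0 h1' (ξ, ζ)
    have b₃ := hb₃ ε h0 h1' (ξ, ζ)
    have b₄ := hb₄ ε h0 h1' ξ
    have hwξ : 1 + ‖ξ‖ ≤ (1 + ‖ξ‖) * (1 + |ζ|) :=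
      le_mul_of_one_le_right (by positivity) (by linarith [abs_nonneg ζ])
    have hwp : 1 + ‖(ξ, ζ)‖ ≤ (1 + ‖ξ‖) * (1 + |ζ|) := PolyBigO.one_add_norm_prod_le ξ ζ
    have hw1 : 1 ≤ (1 + ‖ξ‖) * (1 + |ζ|) := by linarith [norm_nonneg ξ]
    rw [hζ]
    generalize (1 + ‖ξ‖) * (1 + |ζ|) = w at hwξ hwp hw1 ⊢
    -- all four weights are dominated by one power of `w`
    have weight {v : ℝ} (hv0 : 0 ≤ v) (hv : v ≤ w) {N : ℕ} (hN : N ≤ N₁ + N₂ + N₃ + N₄) :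
        v ^ N ≤ w ^ (N₁ + N₂ + N₃ + N₄) :=
      (pow_le_pow_left₀ hv0 hv N).trans (pow_le_pow_right₀ hw1 hN)
    have hE : |∑ i, γ i * (∫ y, profile (ε * h i ε (ξ + y) - ε * ζ) ∂gaussMeasure n)
        - gaussDensity 0 * ε * (stageDefect γ h h' ε ξ + (h' ε ξ - ζ) - ε ^ 2 / 12 * (h' ε ξ - ζ) *
          ∑ i, γ i * ∫ y, ((h i ε (ξ + y) - ζ) ^ 2 + (h i ε (ξ + y) - ζ) *
            (h i ε (ξ + y) - h' ε ξ) + (h i ε (ξ + y) - h' ε ξ) ^ 2) ∂gaussMeasure n)|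
        ≤ gaussDensity 0 * ε ^ 5 * ∑ i, |γ i| *
          ∫ y, |h i ε (ξ + y) - ζ| ^ 5 ∂gaussMeasure n := by
      have e : ∑ i, γ i * (∫ y, profile (ε * h i ε (ξ + y) - ε * ζ) ∂gaussMeasure n)
        - gaussDensity 0 * ε * (stageDefect γ h h' ε ξ + (h' ε ξ - ζ) - ε ^ 2 / 12 * (h' ε ξ - ζ) *
          ∑ i, γ i * ∫ y, ((h i ε (ξ + y) - ζ) ^ 2 + (h i ε (ξ + y) - ζ) *
            (h i ε (ξ + y) - h' ε ξ) + (h i ε (ξ + y) - h' ε ξ) ^ 2) ∂gaussMeasure n)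
        = ∑ i, γ i * ((∫ y, profile (ε * h i ε (ξ + y) - ε * ζ) ∂gaussMeasure n)
          - gaussDensity 0 * ε * ((∫ y, cubicPart ε (h i ε (ξ + y) - h' ε ξ) ∂gaussMeasure n)
            + (h' ε ξ - ζ) - ε ^ 2 / 12 * (h' ε ξ - ζ) *
          ∫ y, ((h i ε (ξ + y) - ζ) ^ 2 + (h i ε (ξ + y) - ζ) *
            (h i ε (ξ + y) - h' ε ξ) + (h i ε (ξ + y) - h' ε ξ) ^ 2) ∂gaussMeasure n)) := by
        have hs : h' ε ξ - ζ = ∑ i, γ i * (h' ε ξ - ζ) := by rw [← Finset.sum_mul, hγ, one_mul]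
        simp only [stageDefect]
        conv_lhs => rw [show ∀ a b c d : ℝ, a - b * (c + (h' ε ξ - ζ) - d)
          = a - b * c - b * (h' ε ξ - ζ) + b * d from fun a b c d => by ring]
        conv_lhs => enter [1, 2, 2]; rw [hs]
        simp only [Finset.mul_sum, ← Finset.sum_sub_distrib, ← Finset.sum_add_distrib]
        refine Finset.sum_congr rfl fun i _ => by ring
      rw [e, Finset.mul_sum]
      refine (Finset.abs_sum_le_sum_abs _ _).trans (Finset.sum_le_sum fun i _ => ?_)
      rw [abs_mul]
      have := mul_le_mul_of_nonneg_left (integral_profile_expansion (hh i) (hm i) h0 h1' ξ ζ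
        (h' ε ξ)) (abs_nonneg (γ i))
      linarith
    rw [hsplit]
    beta_reduce at b₁ b₂ b₃
    generalize ∑ i, γ i * (regionAvg (U i ε) ξ (ε * ζ) - 1 / 2
        - ∫ y, profile (ε * h i ε (ξ + y) - ε * ζ) ∂gaussMeasure n) = X₁ at *
    generalize ∑ i, γ i * (∫ y, profile (ε * h i ε (ξ + y) - ε * ζ) ∂gaussMeasure n) = X₂ at *
    generalize ∑ i, γ i * ∫ y, ((h i ε (ξ + y) - ζ) ^ 2 + (h i ε (ξ + y) - ζ) *
            (h i ε (ξ + y) - h' ε ξ) + (h i ε (ξ + y) - h' ε ξ) ^ 2) ∂gaussMeasure n = X₃ at *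
    generalize ∑ i, |γ i| * ∫ y, |h i ε (ξ + y) - ζ| ^ 5 ∂gaussMeasure n = X₄ at *
    generalize stageDefect γ h h' ε ξ = X₅ at *
    generalize h' ε ξ = b at *
    rw [pow_zero, mul_one] at b₂ b₃
    refine abs_add_sub_le_of_expansion hk hg h0 h1' hC₁ hC₂ hC₃ hC₄ (by positivity)
      (b₁.trans ?_) hE ((le_abs_self _).trans (b₂.trans ?_)) (b₃.trans ?_) (b₄.trans ?_)
    · exact mul_le_mul_of_nonneg_left (weight (by positivity) hwξ (by omega)) (by positivity)
    · exact mul_le_mul_of_nonneg_left (weight (by positivity) hwp (by omega)) (by positivity)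
    · exact mul_le_mul_of_nonneg_left (weight (by positivity) hwp (by omega)) (by positivity)
    · exact mul_le_mul_of_nonneg_left (weight (by positivity) hwξ (by omega)) (by positivity)

/-- If all earlier stages are subgraphs up to `O(ε^(k+1))`, so is the next one, with any height
that solves the stage equation up to `O(ε^k)`. -/
theorem IsSubgraphUpTo.next_stage (hk : k ≤ 4) {γ : Fin m → ℝ} (hγ : ∑ i, γ i = 1)
    {U : Fin m → ℝ → Set (Space n × ℝ)} {h : Fin m → ℝ → Space n → ℝ}
    (hU : ∀ i ε, MeasurableSet (U i ε)) (hh : ∀ i, PolyBigO 0 (h i))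
    (hm : ∀ i ε, Measurable (h i ε)) (hUh : ∀ i, IsSubgraphUpTo k (U i) (h i))
    {h' : ℝ → Space n → ℝ} (hh' : PolyBigO 0 h') (hdef : PolyBigO k (stageDefect γ h h'))
    {U' : ℝ → Set (Space n × ℝ)} (hU' : ∀ ε, 0 < ε → ∀ ξ η,
      (ξ, η) ∈ U' ε ↔ 1 / 2 ≤ ∑ i, γ i * regionAvg (U i ε) ξ η) :
    IsSubgraphUpTo k U' h' := by
  obtain ⟨hcoarse, hfine⟩ := IsSubgraphUpTo.next_stage_aux hk hγ hU hh hm hUh hh' hdef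
  obtain ⟨C, N, R, ε₀, hC, hR, hε, hε1, H⟩ := exists_sign_layer hh' hcoarse hfine
  refine ⟨C + 1, N, R, ε₀, by positivity, hR, hε, hε1, fun ε h0 h1 ξ η hη => ?_⟩
  have hpos : 0 < ε ^ (k + 1) * (1 + ‖ξ‖) ^ N := by positivity
  have hlayer : 0 ≤ C * ε ^ (k + 1) * (1 + ‖ξ‖) ^ N := by positivity
  have key := H ε h0 h1 ξ η hη
  rw [hU' ε h0]
  constructor
  · intro hle
    have hneg : η - ε * h' ε ξ < 0 := by linarith
    have := key (by rw [abs_of_neg hneg]; linarith)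
    have := pos_of_mul_neg_left this hneg.le
    linarith
  · intro hlt
    have hpos' : 0 < η - ε * h' ε ξ := by linarith
    have := key (by rw [abs_of_pos hpos']; linarith)
    have := neg_of_mul_neg_left this hpos'.le
    linarith

end StageLemma

/-! ### The crossing of the vertical axis -/

lemma abs_gaussDensity_sub_le {s η₁ η₂ : ℝ} (h₁ : |η₁| ≤ 1) (h₂ : |η₂| ≤ 1) :
    |gaussDensity (s - η₁) - gaussDensity (s - η₂)|
      ≤ gaussDensity 0 * Real.exp (1 / 8) * Real.exp (-(1 / 16) * s ^ 2) * |η₁ - η₂| := by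
  have hd : ∀ η ∈ Icc (-1 : ℝ) 1, HasDerivWithinAt (fun η => gaussDensity (s - η))
      ((s - η) / 2 * gaussDensity (s - η)) (Icc (-1) 1) η := fun η _ => by
    have := (hasDerivAt_gaussDensity (s - η)).comp η ((hasDerivAt_id η).const_sub s)
    refine (this.congr_deriv ?_).hasDerivWithinAt
    ring
  refine (convex_Icc (-1 : ℝ) 1).norm_image_sub_le_of_norm_hasDerivWithin_le hd (fun η hη => ?_)
    (abs_le.1 h₂) (abs_le.1 h₁)
  rw [Real.norm_eq_abs, abs_mul, abs_of_pos (gaussDensity_pos _), gaussDensity_eq (s - η)]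
  set u := s - η with hu
  have b1 : |u / 2| ≤ Real.exp (u ^ 2 / 8) := by
    have := Real.add_one_le_exp (u ^ 2 / 8)
    rw [abs_le]
    constructor <;> nlinarith [sq_nonneg (u - 2), sq_nonneg (u + 2)]
  have b2 : u ^ 2 / 8 + -u ^ 2 / 4 ≤ 1 / 8 + -(1 / 16) * s ^ 2 := by
    have : η ^ 2 ≤ 1 := by
      rw [sq_le_one_iff_abs_le_one, abs_le]; exact hη
    nlinarith [sq_nonneg (s - 2 * η)]
  calc |u / 2| * (gaussDensity 0 * Real.exp (-u ^ 2 / 4))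
      ≤ Real.exp (u ^ 2 / 8) * (gaussDensity 0 * Real.exp (-u ^ 2 / 4)) := by
        have := gaussDensity_pos 0
        gcongr
    _ = gaussDensity 0 * Real.exp (u ^ 2 / 8 + -u ^ 2 / 4) := by rw [Real.exp_add]; ring
    _ ≤ gaussDensity 0 * Real.exp (1 / 8 + -(1 / 16) * s ^ 2) := by
        have := gaussDensity_pos 0
        gcongr
    _ = _ := by rw [Real.exp_add]; ring

/-- The increments of the Gaussian average of a function that is, as far as `|s| < R`, a step at
the origin up to `b` are those of the average of the exact step, up to a relative error
`O(b + 1 / R)`. -/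
lemma abs_increment_step_sub_le : ∃ K : ℝ, 0 ≤ K ∧ ∀ (v : ℝ → ℝ), Measurable v →
    (∀ s, 0 ≤ v s ∧ v s ≤ 1) → ∀ b R η₁ η₂ : ℝ, 0 ≤ b → 0 < R → |η₁| ≤ 1 → |η₂| ≤ 1 →
    (∀ s, |s| < R → s < -b → v s = 1) → (∀ s, |s| < R → b < s → v s = 0) →
    |(∫ s, v (η₁ + s) ∂gaussianReal 0 2) - (∫ s, v (η₂ + s) ∂gaussianReal 0 2)
      - (profile η₂ - profile η₁)| ≤ K * (b + 1 / R) * |η₁ - η₂| := by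
  have hg := gaussDensity_pos 0
  have hJ : Integrable fun s : ℝ => |s| * Real.exp (-(1 / 16) * s ^ 2) := by
    refine (integrable_mul_exp_neg_mul_sq (by norm_num : (0 : ℝ) < 1 / 16)).norm.congr
      (.of_forall fun s => ?_)
    simp
  set J := ∫ s : ℝ, |s| * Real.exp (-(1 / 16) * s ^ 2)
  have hJ0 : 0 ≤ J := integral_nonneg fun s => by positivity
  set c := gaussDensity 0 * Real.exp (1 / 8) with hc
  have hc0 : 0 < c := by positivity
  refine ⟨c * (2 + J), by positivity, fun v hv hv01 b R η₁ η₂ hb hR hη₁ hη₂ h1 h0 => ?_⟩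
  have key : ∀ w : ℝ → ℝ, ∀ η, ∫ s, w (η + s) ∂gaussianReal 0 2
      = ∫ s, gaussDensity (s - η) * w s := by
    intro w η
    rw [integral_gaussianReal,
      ← integral_add_left_eq_self (fun s => gaussDensity (s - η) * w s) η]
    simp_rw [add_sub_cancel_left]
  have hstep : ∀ η, ∫ s, (Iic (0 : ℝ)).indicator (fun _ => (1 : ℝ)) (η + s) ∂gaussianReal 0 2
      = 1 / 2 - profile η := by
    intro η
    have : ∀ s, (Iic (0 : ℝ)).indicator (fun _ => (1 : ℝ)) (η + s)
        = (Iic (-η)).indicator (fun _ => (1 : ℝ)) s := fun s => by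
      simp only [indicator_apply, mem_Iic]
      congr 1
      rw [eq_iff_iff]
      constructor <;> intro h <;> linarith
    simp_rw [this]
    rw [integral_indicator_Iic, profile_neg]
    ring
  have hint : ∀ w : ℝ → ℝ, Measurable w → (∀ s, 0 ≤ w s ∧ w s ≤ 1) → ∀ η,
      Integrable fun s => gaussDensity (s - η) * w s := by
    intro w hw hw01 η
    have hI : Integrable gaussDensity := by
      simpa using integrable_gaussianReal_iff.1 (integrable_const (1 : ℝ))
    exact (hI.comp_sub_right η).mul_bdd (c := 1) hw.aestronglyMeasurable
      (.of_forall fun s => by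
        rw [Real.norm_eq_abs, abs_of_nonneg (hw01 s).1]; exact (hw01 s).2)
  set w := (Iic (0 : ℝ)).indicator (fun _ => (1 : ℝ)) with hw
  have hwm : Measurable w := measurable_const.indicator measurableSet_Iic
  have hw01 : ∀ s, 0 ≤ w s ∧ w s ≤ 1 := fun s => by
    by_cases h : s ∈ Iic (0 : ℝ) <;> simp [hw, h]
  have e : (∫ s, v (η₁ + s) ∂gaussianReal 0 2) - (∫ s, v (η₂ + s) ∂gaussianReal 0 2)
      - (profile η₂ - profile η₁)
      = ∫ s, (gaussDensity (s - η₁) - gaussDensity (s - η₂)) * (v s - w s) := by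
    have e1 : profile η₂ - profile η₁ = (∫ s, w (η₁ + s) ∂gaussianReal 0 2)
        - ∫ s, w (η₂ + s) ∂gaussianReal 0 2 := by rw [hstep, hstep]; ring
    have i1 : Integrable fun s => gaussDensity (s - η₁) * v s - gaussDensity (s - η₂) * v s :=
      (hint v hv hv01 η₁).sub (hint v hv hv01 η₂)
    have i2 : Integrable fun s => gaussDensity (s - η₁) * w s - gaussDensity (s - η₂) * w s :=
      (hint w hwm hw01 η₁).sub (hint w hwm hw01 η₂)
    rw [e1, key, key, key, key, ← integral_sub (hint v hv hv01 η₁) (hint v hv hv01 η₂),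
      ← integral_sub (hint w hwm hw01 η₁) (hint w hwm hw01 η₂), ← integral_sub i1 i2]
    exact integral_congr_ae (.of_forall fun s => by ring)
  have iIcc : Integrable ((Icc (-b) b).indicator fun _ => (1 : ℝ)) :=
    (integrable_indicator_iff measurableSet_Icc).2 (by simp)
  have hbound : ∀ s, ‖(gaussDensity (s - η₁) - gaussDensity (s - η₂)) * (v s - w s)‖ ≤
      c * |η₁ - η₂| * ((Icc (-b) b).indicator (fun _ => (1 : ℝ)) s
        + 1 / R * (|s| * Real.exp (-(1 / 16) * s ^ 2))) := by
    intro s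
    have hd := abs_gaussDensity_sub_le (s := s) hη₁ hη₂
    have hE0 : 0 < Real.exp (-(1 / 16) * s ^ 2) := Real.exp_pos _
    have hE1 : Real.exp (-(1 / 16) * s ^ 2) ≤ 1 :=
      Real.exp_le_one_iff.2 (by nlinarith [sq_nonneg s])
    rw [← hc] at hd
    generalize Real.exp (-(1 / 16) * s ^ 2) = E at *
    have hvw : |v s - w s| ≤ 1 := by
      rw [abs_le]; constructor <;> linarith [(hv01 s).1, (hv01 s).2, (hw01 s).1, (hw01 s).2]
    have hmain : E * |v s - w s| ≤ (Icc (-b) b).indicator (fun _ => (1 : ℝ)) s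
        + 1 / R * (|s| * E) := by
      have hs0 : 0 ≤ 1 / R * (|s| * E) := by positivity
      have hi0 : 0 ≤ (Icc (-b) b).indicator (fun _ => (1 : ℝ)) s :=
        indicator_nonneg (fun _ _ => zero_le_one) s
      have hEv : E * |v s - w s| ≤ E := mul_le_of_le_one_right hE0.le hvw
      by_cases hm : s ∈ Icc (-b) b
      · rw [indicator_of_mem hm]; linarith
      · by_cases hs : |s| < R
        · have : v s - w s = 0 := by
            rw [mem_Icc, not_and_or, not_le, not_le] at hm
            rcases hm with hm | hm
            · rw [h1 s hs hm, hw, indicator_of_mem (by rw [mem_Iic]; linarith), sub_self]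
            · rw [h0 s hs hm, hw, indicator_of_notMem (by rw [mem_Iic]; linarith), sub_self]
          rw [this, abs_zero, mul_zero]
          positivity
        · have : 1 ≤ 1 / R * |s| := by
            rw [one_div, inv_mul_eq_div, le_div_iff₀ hR]; linarith
          have := mul_le_mul_of_nonneg_right this hE0.le
          linarith
    rw [norm_mul, Real.norm_eq_abs, Real.norm_eq_abs]
    calc |gaussDensity (s - η₁) - gaussDensity (s - η₂)| * |v s - w s|
        ≤ c * E * |η₁ - η₂| * |v s - w s| := by gcongr
      _ = c * |η₁ - η₂| * (E * |v s - w s|) := by ring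
      _ ≤ _ := by gcongr
  have hI := norm_integral_le_of_norm_le ((iIcc.add (hJ.const_mul (1 / R))).const_mul
    (c * |η₁ - η₂|)) (.of_forall hbound)
  simp only [Pi.add_apply] at hI
  rw [integral_const_mul, integral_add iIcc (hJ.const_mul (1 / R)), integral_const_mul,
    integral_indicator measurableSet_Icc] at hI
  rw [e]
  refine hI.trans ?_
  have : ∫ _s in Icc (-b) b, (1 : ℝ) = 2 * b := by
    simp [max_eq_left (by linarith : 0 ≤ b + b)]; ring
  rw [this]
  have q1 : 0 ≤ c * |η₁ - η₂| * (2 * (1 / R)) := by positivity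
  have q2 : 0 ≤ c * |η₁ - η₂| * (J * b) := by positivity
  linarith

section Crossing
variable {n m k : ℕ}

/-- The increments in `η` of the average of a near-subgraph. -/
lemma IsSubgraphUpTo.regionAvg_increment {U : ℝ → Set (Space n × ℝ)} {h : ℝ → Space n → ℝ}
    (hUh : IsSubgraphUpTo k U h) (hU : ∀ ε, MeasurableSet (U ε)) (hh : PolyBigO 0 h) :
    ∃ K ε₀ : ℝ, 0 ≤ K ∧ 0 < ε₀ ∧ ∀ ε, 0 < ε → ε < ε₀ → ∀ η₁ η₂, |η₁| ≤ 1 → |η₂| ≤ 1 →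
      |regionAvg (U ε) 0 η₁ - regionAvg (U ε) 0 η₂ - (profile η₂ - profile η₁)|
        ≤ K * ε * |η₁ - η₂| := by
  obtain ⟨C, N, R, ε₀, hC, hR, hε, hε1, H⟩ := hUh
  obtain ⟨D, M, hD, hD'⟩ := hh
  obtain ⟨K, hK, HK⟩ := abs_increment_step_sub_le
  set A := ∫ y, (1 + ‖y‖) ^ (N + M) ∂gaussMeasure n
  have hA : 0 ≤ A := integral_nonneg fun y => by positivity
  refine ⟨K * ((C + D) * A + 1 / R), ε₀, by positivity, hε, fun ε h0 h1 η₁ η₂ hη₁ hη₂ => ?_⟩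
  have hε1' := h1.le.trans hε1
  have hb : ∀ y, ‖(∫ s, (U ε).indicator (fun _ => (1 : ℝ)) (0 + y, η₁ + s) ∂gaussianReal 0 2)
      - (∫ s, (U ε).indicator (fun _ => (1 : ℝ)) (0 + y, η₂ + s) ∂gaussianReal 0 2)
      - (profile η₂ - profile η₁)‖
      ≤ K * |η₁ - η₂| * ε * ((C + D) * (1 + ‖y‖) ^ (N + M) + 1 / R) := by
    intro y
    have hw : (1 : ℝ) ≤ 1 + ‖y‖ := by linarith [norm_nonneg y]
    have hw1 : (1 + ‖y‖) ^ N ≤ (1 + ‖y‖) ^ (N + M) := pow_le_pow_right₀ hw (by omega)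
    have hw2 : (1 + ‖y‖) ^ M ≤ (1 + ‖y‖) ^ (N + M) := pow_le_pow_right₀ hw (by omega)
    have hεk : ε ^ (k + 1) ≤ ε := by
      simpa using pow_le_pow_of_le_one h0.le hε1' (by omega : 1 ≤ k + 1)
    have hh' := hD' ε h0 hε1' y
    rw [pow_zero, mul_one] at hh'
    have hb1 : C * ε ^ (k + 1) * (1 + ‖y‖) ^ N ≤ ε * (C * (1 + ‖y‖) ^ (N + M)) := by
      calc C * ε ^ (k + 1) * (1 + ‖y‖) ^ N ≤ C * ε * (1 + ‖y‖) ^ (N + M) := by gcongr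
        _ = _ := by ring
    have hb2 : |ε * h ε y| ≤ ε * (D * (1 + ‖y‖) ^ (N + M)) := by
      rw [abs_mul, abs_of_pos h0]
      gcongr
      exact hh'.trans (by gcongr)
    have hb3 := abs_le.1 hb2
    have := HK (fun s => (U ε).indicator (fun _ => (1 : ℝ)) (0 + y, s))
      ((measurable_const.indicator (hU ε)).comp (by fun_prop))
      (fun s => indicator_one_mem_Icc _ _) (ε * ((C + D) * (1 + ‖y‖) ^ (N + M))) (R / ε) η₁ η₂
      (by positivity) (by positivity) hη₁ hη₂
      (fun s hs hlt => indicator_of_mem ((H ε h0 h1 (0 + y) s hs).1 (by rw [zero_add]; linarith)) _)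
      (fun s hs hlt => indicator_of_notMem
        ((H ε h0 h1 (0 + y) s hs).2 (by rw [zero_add]; linarith)) _)
    refine this.trans_eq ?_
    field_simp
  have i1 := integrable_section (U ε) (hU ε) 0 η₁
  have i2 := integrable_section (U ε) (hU ε) 0 η₂
  have i3 : Integrable (fun y => (∫ s, (U ε).indicator (fun _ => (1 : ℝ)) (0 + y, η₁ + s)
      ∂gaussianReal 0 2) - ∫ s, (U ε).indicator (fun _ => (1 : ℝ)) (0 + y, η₂ + s)
      ∂gaussianReal 0 2) (gaussMeasure n) := i1.sub i2
  have iw := (gaussMeasure_weight n (N + M)).const_mul (C + D)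
  have hI := norm_integral_le_of_norm_le ((iw.add (integrable_const (1 / R))).const_mul
    (K * |η₁ - η₂| * ε)) (.of_forall hb)
  simp only [Pi.add_apply] at hI
  rw [integral_const_mul, integral_add iw (integrable_const _), integral_const_mul,
    integral_sub i3 (integrable_const _), integral_sub i1 i2] at hI
  simp only [integral_const, probReal_univ, smul_eq_mul, one_mul] at hI
  refine hI.trans_eq ?_
  ring

/-- After a stage, the region meets the vertical axis in a half line, near the origin, and its
end point is given by the height of the region. -/
theorem IsSubgraphUpTo.exists_crossing {γ : Fin m → ℝ} (hγ : ∑ i, γ i = 1)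
    {U : Fin m → ℝ → Set (Space n × ℝ)} {h : Fin m → ℝ → Space n → ℝ}
    (hU : ∀ i ε, MeasurableSet (U i ε)) (hh : ∀ i, PolyBigO 0 (h i))
    (hUh : ∀ i, IsSubgraphUpTo k (U i) (h i))
    {U' : ℝ → Set (Space n × ℝ)} {h' : ℝ → Space n → ℝ} (hh' : PolyBigO 0 h')
    (hUh' : IsSubgraphUpTo k U' h') (hU' : ∀ ε, 0 < ε → ∀ ξ η,
      (ξ, η) ∈ U' ε ↔ 1 / 2 ≤ ∑ i, γ i * regionAvg (U i ε) ξ η) :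
    ∃ C R ε₀ : ℝ, 0 ≤ C ∧ 0 < R ∧ 0 < ε₀ ∧ ε₀ ≤ 1 ∧ ∀ ε, 0 < ε → ε < ε₀ → ∃ a,
      |a - ε * h' ε 0| ≤ C * ε ^ (k + 1) ∧ ∀ η, |η| < R / ε → ((0, η) ∈ U' ε ↔ η ≤ a) := by
  choose K ε₁ hK hε₁ HK using fun i => (hUh i).regionAvg_increment (hU i) (hh i)
  obtain ⟨C, N, R, ε₀, hC, hR, hε, hε1, H⟩ := hUh'
  obtain ⟨D, M, hD, hD'⟩ := hh'
  have hg := gaussDensity_pos 1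
  set L := ∑ i, |γ i| * K i with hL
  have hL0 : 0 ≤ L := Finset.sum_nonneg fun i _ => mul_nonneg (abs_nonneg _) (hK i)
  obtain ⟨ε₂, hε₂, hε₂'⟩ : ∃ ε₂ > 0, ∀ i, ε₂ ≤ ε₁ i := by
    rcases isEmpty_or_nonempty (Fin m) with hm | hm
    · exact ⟨1, one_pos, fun i => hm.elim i⟩
    · exact ⟨Finset.univ.inf' Finset.univ_nonempty ε₁,
        (Finset.lt_inf'_iff _).2 fun i _ => hε₁ i, fun i => Finset.inf'_le _ (Finset.mem_univ i)⟩
  obtain ⟨ε₃, hε₃, hs₁, hs₂, hs₃, hs₄, hs₅⟩ : ∃ ε₃ > 0, ε₃ ≤ ε₀ ∧ ε₃ ≤ ε₂ ∧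
      ε₃ * (C + 1 + D) ≤ 1 ∧ ε₃ * (L + 1) ≤ gaussDensity 1 ∧ ε₃ ≤ R / 2 := by
    refine ⟨min (min ε₀ ε₂) (min (min (1 / (C + 1 + D)) (gaussDensity 1 / (L + 1))) (R / 2)),
      by positivity, ?_, ?_, ?_, ?_, ?_⟩
    · exact (min_le_left _ _).trans (min_le_left _ _)
    · exact (min_le_left _ _).trans (min_le_right _ _)
    · rw [← le_div_iff₀ (by positivity)]
      exact (min_le_right _ _).trans ((min_le_left _ _).trans (min_le_left _ _))
    · rw [← le_div_iff₀ (by positivity)]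
      exact (min_le_right _ _).trans ((min_le_left _ _).trans (min_le_right _ _))
    · exact (min_le_right _ _).trans (min_le_right _ _)
  refine ⟨C + 1, R, ε₃, by positivity, hR, hε₃, hs₁.trans hε1, fun ε h0 h1 => ?_⟩
  have hε1' : ε ≤ 1 := h1.le.trans (hs₁.trans hε1)
  set F : ℝ → ℝ := fun η => ∑ i, γ i * regionAvg (U i ε) 0 η with hF
  -- the increments of `F` are those of `-Ψ` up to a small relative error
  have hinc : ∀ η₁ η₂, |η₁| ≤ 1 → |η₂| ≤ 1 →
      |F η₁ - F η₂ - (profile η₂ - profile η₁)| ≤ L * ε * |η₁ - η₂| := by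
    intro η₁ η₂ hη₁ hη₂
    have e : F η₁ - F η₂ - (profile η₂ - profile η₁) = ∑ i, γ i * (regionAvg (U i ε) 0 η₁
        - regionAvg (U i ε) 0 η₂ - (profile η₂ - profile η₁)) := by
      simp only [mul_sub, Finset.sum_sub_distrib, ← Finset.sum_mul, hγ, one_mul, hF]
    rw [e, hL, Finset.sum_mul, Finset.sum_mul]
    refine (Finset.abs_sum_le_sum_abs _ _).trans (Finset.sum_le_sum fun i _ => ?_)
    rw [abs_mul, mul_assoc (|γ i|), mul_assoc (|γ i|)]
    exact mul_le_mul_of_nonneg_left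
      (HK i ε h0 (h1.trans_le (hs₂.trans (hε₂' i))) η₁ η₂ hη₁ hη₂) (abs_nonneg _)
  have hanti : StrictAntiOn F (Icc (-1) 1) := by
    intro η₁ hη₁ η₂ hη₂ hlt
    have hη₁' := abs_le.2 hη₁
    have hη₂' := abs_le.2 hη₂
    have h2 := (abs_le.1 (hinc η₁ η₂ hη₁' hη₂')).1
    rw [abs_of_neg (by linarith : η₁ - η₂ < 0)] at h2
    have h3 := profile_sub_ge hlt.le hη₁' hη₂'
    have h4 : ε * (L + 1) ≤ gaussDensity 1 :=
      (mul_le_mul_of_nonneg_right h1.le (by positivity)).trans hs₄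
    have h5 := mul_le_mul_of_nonneg_right h4 (by linarith : 0 ≤ η₂ - η₁)
    have h6 : 0 < ε * (η₂ - η₁) := mul_pos h0 (by linarith)
    nlinarith
  have hcont : ContinuousOn F (Icc (-1) 1) := by
    have : LipschitzOnWith (Real.toNNReal (L * ε + gaussDensity 0)) F (Icc (-1) 1) := by
      refine LipschitzOnWith.of_dist_le_mul fun η₁ hη₁ η₂ hη₂ => ?_
      have h2 := hinc η₁ η₂ (abs_le.2 hη₁) (abs_le.2 hη₂)
      have h3 := abs_profile_sub_le η₁ η₂
      rw [Real.coe_toNNReal _ (by have := gaussDensity_pos 0; positivity), Real.dist_eq,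
        Real.dist_eq, add_mul]
      rw [abs_sub_comm η₂ η₁] at h3
      have := abs_add_le (F η₁ - F η₂ - (profile η₂ - profile η₁)) (profile η₂ - profile η₁)
      rw [sub_add_cancel] at this
      linarith
    exact this.continuousOn
  -- the layer lies in `[-1, 1]`
  have hεk : ε ^ (k + 1) ≤ ε := by
    simpa using pow_le_pow_of_le_one h0.le hε1' (by omega : 1 ≤ k + 1)
  have hεk0 : 0 < ε ^ (k + 1) := by positivity
  have hεC : ε * (C + 1 + D) ≤ 1 := (mul_le_mul_of_nonneg_right h1.le (by positivity)).trans hs₃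
  have hH : |ε * h' ε 0| ≤ ε * D := by
    have := hD' ε h0 hε1' 0
    rw [pow_zero, mul_one, norm_zero, add_zero, one_pow, mul_one] at this
    rw [abs_mul, abs_of_pos h0]
    gcongr
  have hH' := abs_le.1 hH
  have hCε : (C + 1) * ε ^ (k + 1) ≤ ε * (C + 1) := by
    rw [mul_comm]; gcongr
  have hRε : 1 < R / ε := by
    rw [lt_div_iff₀ h0]; linarith
  have hin : ∀ η, |η| < R / ε → η ≤ ε * h' ε 0 - C * ε ^ (k + 1) → (0, η) ∈ U' ε :=
    fun η hη hle => (H ε h0 (h1.trans_le hs₁) 0 η hη).1 (by simpa using hle)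
  have hout : ∀ η, |η| < R / ε → ε * h' ε 0 + C * ε ^ (k + 1) < η → (0, η) ∉ U' ε :=
    fun η hη hle => (H ε h0 (h1.trans_le hs₁) 0 η hη).2 (by simpa using hle)
  set p := ε * h' ε 0 - C * ε ^ (k + 1) with hp
  set q := ε * h' ε 0 + (C + 1) * ε ^ (k + 1) with hq
  have hp1 : -1 ≤ p := by linarith
  have hq1 : q ≤ 1 := by linarith
  have hpq : p ≤ q := by
    have : 0 ≤ C * ε ^ (k + 1) := by positivity
    linarith
  have hFp : 1 / 2 ≤ F p := (hU' ε h0 0 p).1 (hin p (lt_of_le_of_lt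
    (abs_le.2 ⟨hp1, hpq.trans hq1⟩) hRε) le_rfl)
  have hFq : F q ≤ 1 / 2 := by
    have := hout q (lt_of_le_of_lt (abs_le.2 ⟨hp1.trans hpq, hq1⟩) hRε) (by linarith)
    rw [hU' ε h0, not_le] at this
    exact this.le
  obtain ⟨a, ha, haF⟩ := intermediate_value_Icc' hpq
    (hcont.mono (Icc_subset_Icc hp1 hq1)) ⟨hFq, hFp⟩
  have ha1 : a ∈ Icc (-1 : ℝ) 1 := ⟨hp1.trans ha.1, ha.2.trans hq1⟩
  refine ⟨a, abs_le.2 ⟨by linarith [ha.1], by linarith [ha.2]⟩, fun η hη => ?_⟩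
  by_cases hη1 : η ∈ Icc (-1 : ℝ) 1
  · rw [hU' ε h0, ← haF]
    exact hanti.le_iff_ge ha1 hη1
  · rw [mem_Icc, not_and_or, not_le, not_le] at hη1
    rcases hη1 with hη1 | hη1
    · exact iff_of_true (hin η hη (by linarith)) (by linarith [ha1.1])
    · exact iff_of_false (hout η hη (by linarith)) (by linarith [ha1.2])

end Crossing

/-! ### Rescaled regions -/

section Scaled
variable {n : ℕ}

/-- The region `A`, in Cartesian coordinates in which `ε` is the unit of length. -/
def scaledRegion (e : CartesianCoords n) (A : Set (Space (n + 1))) (ε : ℝ) : Set (Space n × ℝ) :=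
  {p | e.point (ε • p.1) (ε * p.2) ∈ A}

lemma mem_scaledRegion {e : CartesianCoords n} {A : Set (Space (n + 1))} {ε : ℝ}
    {p : Space n × ℝ} : p ∈ scaledRegion e A ε ↔ e.point (ε • p.1) (ε * p.2) ∈ A := Iff.rfl

lemma measurableSet_scaledRegion (e : CartesianCoords n) {A : Set (Space (n + 1))}
    (hA : MeasurableSet A) (ε : ℝ) : MeasurableSet (scaledRegion e A ε) := by
  have : Continuous fun p : Space n × ℝ => e.point (ε • p.1) (ε * p.2) :=
    e.continuous.comp ((WithLp.prod_continuous_toLp 2 _ _).comp (by fun_prop))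
  exact this.measurable hA

lemma CartesianCoords.point_add (e : CartesianCoords n) (x y : Space n) (z s : ℝ) :
    e.point (x + y) (z + s) = e.point x z + e.linearIsometryEquiv (WithLp.toLp 2 (y, s)) := by
  have := e.map_vadd (WithLp.toLp 2 (x, z)) (WithLp.toLp 2 (y, s))
  simp only [vadd_eq_add] at this
  rw [add_comm (e.point x z)]
  refine Eq.trans ?_ this
  rw [add_comm x, add_comm z]
  rfl

lemma heatAvg_indicatorFun (e : CartesianCoords n) {A : Set (Space (n + 1))}
    (hA : MeasurableSet A) (ε : ℝ) (ξ : Space n) (η : ℝ) :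
    heatAvg ε (indicatorFun A) (e.point (ε • ξ) (ε * η))
      = regionAvg (scaledRegion e A ε) ξ η := by
  have hL : Measurable fun p : Space n × ℝ => e.linearIsometryEquiv (WithLp.toLp 2 p) :=
    (e.linearIsometryEquiv.continuous.comp (WithLp.prod_continuous_toLp 2 _ _)).measurable
  have hfun : ∀ p : Space n × ℝ, indicatorFun A (e.point (ε • ξ) (ε * η)
      + ε • e.linearIsometryEquiv (WithLp.toLp 2 p))
      = (scaledRegion e A ε).indicator (fun _ => (1 : ℝ)) (ξ + p.1, η + p.2) := by
    intro p
    have : e.point (ε • ξ) (ε * η) + ε • e.linearIsometryEquiv (WithLp.toLp 2 p)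
        = e.point (ε • (ξ + p.1)) (ε * (η + p.2)) := by
      rw [smul_add, mul_add, e.point_add, ← map_smul]
      rfl
    rw [this]
    rfl
  have hmeas : Measurable fun p : Space n × ℝ =>
      (scaledRegion e A ε).indicator (fun _ => (1 : ℝ)) (ξ + p.1, η + p.2) :=
    (measurable_const.indicator (measurableSet_scaledRegion e hA ε)).comp (by fun_prop)
  have hint : Integrable (fun p : Space n × ℝ =>
      (scaledRegion e A ε).indicator (fun _ => (1 : ℝ)) (ξ + p.1, η + p.2))
      ((gaussMeasure n).prod (gaussianReal 0 2)) :=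
    (integrable_const (1 : ℝ)).mono' hmeas.aestronglyMeasurable (.of_forall fun p => by
      obtain ⟨p, q⟩ := indicator_one_mem_Icc (scaledRegion e A ε) (ξ + p.1, η + p.2)
      rwa [Real.norm_eq_abs, abs_of_nonneg p])
  have hAm : Measurable fun w => indicatorFun A (e.point (ε • ξ) (ε * η) + ε • w) :=
    (measurable_const.indicator hA).comp (by fun_prop)
  rw [heatAvg, gaussMeasure_succ e.linearIsometryEquiv,
    integral_map hL.aemeasurable hAm.aestronglyMeasurable]
  simp_rw [hfun]
  exact integral_prod _ hint

lemma mem_scaledRegion_stage_succ (e : CartesianCoords n) (γ : ℕ → ℕ → ℝ)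
    {S : Set (Space (n + 1))} (hS : MeasurableSet S) {ε : ℝ} (hε : 0 < ε) (m : ℕ) (ξ : Space n)
    (η : ℝ) : (ξ, η) ∈ scaledRegion e (stage γ (ε ^ 2) S (m + 1)) ε ↔
      1 / 2 ≤ ∑ i : Fin (m + 1), γ (m + 1) i *
        regionAvg (scaledRegion e (stage γ (ε ^ 2) S i) ε) ξ η := by
  have hε2 : 0 < ε ^ 2 := by positivity
  rw [mem_scaledRegion, mem_stage_succ hε2 hS, Real.sqrt_sq hε.le]
  simp_rw [heatAvg_indicatorFun e (measurableSet_stage hε2 hS _)]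

/-- If the heights `h m` solve the stage equations up to `O(ε^k)`, then the last one gives the
point in which the last stage crosses the vertical axis up to `O(ε^(k+1))`. -/
theorem exists_crossing_stage {k M : ℕ} (hk : k ≤ 4) {γ : ℕ → ℕ → ℝ}
    (hγ : ∀ m < M + 1, ∑ i : Fin (m + 1), γ (m + 1) i = 1) (e : CartesianCoords n)
    {S : Set (Space (n + 1))} (hS : MeasurableSet S) {h : ℕ → ℝ → Space n → ℝ}
    (hh : ∀ m, PolyBigO 0 (h m)) (hm : ∀ m ε, Measurable (h m ε))
    (hS₀ : IsSubgraphUpTo k (scaledRegion e S) (h 0))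
    (hdef : ∀ m < M + 1, PolyBigO k
      (stageDefect (fun i : Fin (m + 1) => γ (m + 1) i) (fun i => h i) (h (m + 1)))) :
    ∃ C R ε₀ : ℝ, 0 ≤ C ∧ 0 < R ∧ 0 < ε₀ ∧ ε₀ ≤ 1 ∧ ∀ ε, 0 < ε → ε < ε₀ → ∃ a,
      |a - ε * h (M + 1) ε 0| ≤ C * ε ^ (k + 1) ∧
        ∀ η, |η| < R / ε → (e.point 0 (ε * η) ∈ stage γ (ε ^ 2) S (M + 1) ↔ η ≤ a) := by
  -- for `ε ≤ 0` the stages are not under control, but neither are they needed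
  set U : ℕ → ℝ → Set (Space n × ℝ) := fun m ε =>
    if 0 < ε then scaledRegion e (stage γ (ε ^ 2) S m) ε else ∅ with hU
  have hUpos : ∀ m ε, 0 < ε → U m ε = scaledRegion e (stage γ (ε ^ 2) S m) ε :=
    fun m ε h0 => if_pos h0
  have hUm : ∀ m ε, MeasurableSet (U m ε) := fun m ε => by
    by_cases h0 : 0 < ε
    · rw [hUpos m ε h0]
      exact measurableSet_scaledRegion e (measurableSet_stage (by positivity) hS m) ε
    · simp [hU, h0]
  have hrec : ∀ m ε, 0 < ε → ∀ ξ η, (ξ, η) ∈ U (m + 1) ε ↔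
      1 / 2 ≤ ∑ i : Fin (m + 1), γ (m + 1) i * regionAvg (U i ε) ξ η := fun m ε h0 ξ η => by
    simp_rw [hUpos _ ε h0]
    exact mem_scaledRegion_stage_succ e γ hS h0 m ξ η
  have hsub : ∀ m ≤ M + 1, IsSubgraphUpTo k (U m) (h m) := by
    intro m
    induction m using Nat.strong_induction_on with
    | _ m ih =>
      intro hmM
      rcases m with _ | m
      · obtain ⟨C, N, R, ε₀, hC, hR, hε, hε1, H⟩ := hS₀
        refine ⟨C, N, R, ε₀, hC, hR, hε, hε1, fun ε h0 h1 => ?_⟩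
        rw [hUpos 0 ε h0, stage_zero]
        exact H ε h0 h1
      · exact IsSubgraphUpTo.next_stage hk (hγ m (by omega))
          (U := fun i : Fin (m + 1) => U i) (h := fun i => h i) (fun i => hUm i)
          (fun i => hh i) (fun i => hm i) (fun i => ih i (by omega) (by omega)) (hh _)
          (hdef m (by omega)) (hrec m)
  obtain ⟨C, R, ε₀, hC, hR, hε, hε1, H⟩ := IsSubgraphUpTo.exists_crossing (hγ M (by omega))
    (U := fun i : Fin (M + 1) => U i) (h := fun i => h i) (fun i => hUm i)
    (fun i => hh i) (fun i => hsub i (by omega)) (hh _) (hsub (M + 1) le_rfl) (hrec M)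
  refine ⟨C, R, ε₀, hC, hR, hε, hε1, fun ε h0 h1 => ?_⟩
  obtain ⟨a, ha, Ha⟩ := H ε h0 h1
  refine ⟨a, ha, fun η hη => ?_⟩
  rw [← Ha η hη, hUpos _ ε h0, mem_scaledRegion, smul_zero]

/-- Accuracy of the scheme, given heights that solve the stage equations and match the motion by
mean curvature. The time step is `δt = β ε²`. -/
theorem accurate_of_heights {p M : ℕ} (hp : 2 * p ≤ 4) {γ : ℕ → ℕ → ℝ}
    (hγ : ∀ m < M + 1, ∑ i : Fin (m + 1), γ (m + 1) i = 1) (hβ : 0 < beta₁ γ (M + 1))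
    (e : CartesianCoords n)
    {S : Set (Space (n + 1))} (hS : MeasurableSet S) {h : ℕ → ℝ → Space n → ℝ}
    (hh : ∀ m, PolyBigO 0 (h m)) (hm : ∀ m ε, Measurable (h m ε))
    (hS₀ : IsSubgraphUpTo (2 * p) (scaledRegion e S) (h 0))
    (hdef : ∀ m < M + 1, PolyBigO (2 * p)
      (stageDefect (fun i : Fin (m + 1) => γ (m + 1) i) (fun i => h i) (h (m + 1))))
    {u : ℝ → ℝ} {C₀ ε₁ : ℝ} (hε₁ : 0 < ε₁)
    (hu : ∀ ε, 0 < ε → ε < ε₁ →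
      |ε ^ 2 * h (M + 1) ε 0 - u (beta₁ γ (M + 1) * ε ^ 2)| ≤ C₀ * ε ^ (2 * p + 2)) :
    ∃ δ₀ > 0, ∃ ρ > 0, ∃ C : ℝ, ∀ δt ∈ Ioo 0 δ₀, ∃ z ∈ Ioo (-ρ) ρ,
      (∀ z' ∈ Ioo (-ρ) ρ, e.point 0 z' ∈ step γ (M + 1) δt S ↔ z' ≤ z) ∧
        |z - u δt| ≤ C * δt ^ (p + 1) := by
  obtain ⟨C, R, ε₀, hC, hR, hε, hε1, H⟩ := exists_crossing_stage hp hγ e hS hh hm hS₀ hdef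
  obtain ⟨D, N, hD, hD'⟩ := hh (M + 1)
  set β := beta₁ γ (M + 1)
  set ε₂ := min (min ε₀ ε₁) (R / (C + D + 1)) with hε₂
  have hε₂0 : 0 < ε₂ := by positivity
  refine ⟨β * ε₂ ^ 2, by positivity, R, hR, (C + C₀) * (1 / β) ^ (p + 1), fun δt hδ => ?_⟩
  obtain ⟨ε, h0, rfl⟩ : ∃ ε, 0 < ε ∧ δt = β * ε ^ 2 :=
    ⟨√(δt / β), Real.sqrt_pos.2 (div_pos hδ.1 hβ), by
      rw [Real.sq_sqrt (div_pos hδ.1 hβ).le]; field_simp⟩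
  have hlt : ε < ε₂ :=
    lt_of_pow_lt_pow_left₀ 2 hε₂0.le (lt_of_mul_lt_mul_left hδ.2 hβ.le)
  have h1 : ε < ε₀ := hlt.trans_le ((min_le_left _ _).trans (min_le_left _ _))
  have h2 : ε < ε₁ := hlt.trans_le ((min_le_left _ _).trans (min_le_right _ _))
  have h3 : ε * (C + D + 1) < R := by
    rw [← lt_div_iff₀ (by positivity)]
    exact hlt.trans_le (min_le_right _ _)
  have hε1' : ε ≤ 1 := h1.le.trans hε1
  obtain ⟨a, ha, Ha⟩ := H ε h0 h1
  have hstep : step γ (M + 1) (β * ε ^ 2) S = stage γ (ε ^ 2) S (M + 1) := by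
    rw [step, kernelTime, mul_div_cancel_left₀ _ hβ.ne']
  rw [hstep]
  have hbig : |a| < R / ε := by
    rw [lt_div_iff₀ h0]
    have b1 := hD' ε h0 hε1' 0
    rw [pow_zero, mul_one, norm_zero, add_zero, one_pow, mul_one] at b1
    have b2 : |a| ≤ |a - ε * h (M + 1) ε 0| + |ε * h (M + 1) ε 0| := by
      have := abs_add_le (a - ε * h (M + 1) ε 0) (ε * h (M + 1) ε 0)
      rwa [sub_add_cancel] at this
    have b3 : |ε * h (M + 1) ε 0| ≤ D := by
      rw [abs_mul, abs_of_pos h0]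
      calc ε * |h (M + 1) ε 0| ≤ 1 * D := by gcongr
        _ = D := one_mul _
    have b4 : C * ε ^ (2 * p + 1) ≤ C := mul_le_of_le_one_right hC (pow_le_one₀ h0.le hε1')
    have : |a| * ε ≤ (C + D + 1) * ε := by gcongr; linarith
    linarith
  have hza : ∀ b : ℝ, |b| < R / ε → ε * b ∈ Ioo (-R) R := fun b hb => by
    rw [lt_div_iff₀ h0] at hb
    have : |ε * b| < R := by rwa [abs_mul, abs_of_pos h0, mul_comm]
    exact abs_lt.1 this
  refine ⟨ε * a, hza a hbig, fun z' hz' => ?_, ?_⟩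
  · have hz : |z' / ε| < R / ε := by
      rw [abs_div, abs_of_pos h0]
      gcongr
      exact abs_lt.2 hz'
    have := Ha (z' / ε) hz
    rw [mul_div_cancel₀ _ h0.ne'] at this
    rw [this, div_le_iff₀ h0, mul_comm]
  · have e1 : ε * a - u (β * ε ^ 2) = ε * (a - ε * h (M + 1) ε 0)
        + (ε ^ 2 * h (M + 1) ε 0 - u (β * ε ^ 2)) := by ring
    have e2 : |ε * (a - ε * h (M + 1) ε 0)| ≤ C * ε ^ (2 * p + 2) := by
      rw [abs_mul, abs_of_pos h0]
      calc ε * |a - ε * h (M + 1) ε 0| ≤ ε * (C * ε ^ (2 * p + 1)) := by gcongr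
        _ = _ := by ring
    have e3 : (C + C₀) * (1 / β) ^ (p + 1) * (β * ε ^ 2) ^ (p + 1)
        = C * ε ^ (2 * p + 2) + C₀ * ε ^ (2 * p + 2) := by
      rw [mul_assoc, ← mul_pow, one_div, inv_mul_cancel_left₀ hβ.ne', ← pow_mul, mul_add 2]
      ring
    rw [e1, e3]
    exact (abs_add_le _ _).trans (add_le_add e2 (hu ε h0 h2))

end Scaled

/-! ### Taylor expansions -/

/-- Taylor's formula for a chain of derivatives on an interval. -/
lemma abs_sub_taylor_le {N : ℕ} {φ : ℕ → ℝ → ℝ} {a C : ℝ}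
    (hφ : ∀ i < N, ∀ t ∈ Icc 0 a, HasDerivWithinAt (φ i) (φ (i + 1) t) (Icc 0 a) t)
    (hC : ∀ t ∈ Icc 0 a, |φ N t| ≤ C) :
    ∀ t ∈ Icc 0 a, |φ 0 t - ∑ i ∈ Finset.range N, φ i 0 * t ^ i / i.factorial|
      ≤ C * t ^ N / N.factorial := by
  induction N generalizing φ with
  | zero => simpa using hC
  | succ N ih =>
    have ih' := ih (φ := fun i => φ (i + 1)) (fun i hi => hφ (i + 1) (by omega)) hC
    have hpow : ∀ (c : ℝ) (i : ℕ) (t : ℝ), HasDerivAt (fun t => c * t ^ (i + 1) / (i + 1).factorial)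
        (c * t ^ i / i.factorial) t := by
      intro c i t
      refine (((hasDerivAt_pow (i + 1) t).const_mul c).div_const _).congr_deriv ?_
      rw [Nat.factorial_succ]
      push_cast
      field_simp
    have hd : ∀ t ∈ Icc 0 a, HasDerivWithinAt
        (fun t => φ 0 t - ∑ i ∈ Finset.range (N + 1), φ i 0 * t ^ i / i.factorial)
        (φ 1 t - ∑ i ∈ Finset.range N, φ (i + 1) 0 * t ^ i / i.factorial) (Icc 0 a) t := by
      intro t ht
      refine (hφ 0 (by omega) t ht).sub (HasDerivAt.hasDerivWithinAt ?_)
      simp_rw [Finset.sum_range_succ']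
      simpa using (HasDerivAt.fun_sum fun i _ => hpow (φ (i + 1) 0) i t).add_const
        (φ 0 0 * t ^ 0 / (Nat.factorial 0))
    intro t ht
    refine image_norm_le_of_norm_deriv_right_le_deriv_boundary
      (fun t ht => (hd t ht).continuousWithinAt) (fun t ht =>
        (hd t ⟨ht.1, ht.2.le⟩).mono_of_mem_nhdsWithin (Icc_mem_nhdsGE_of_mem ht)) ?_
      (hpow C N) (fun t ht => ih' t ⟨ht.1, ht.2.le⟩) ht
    simp [Finset.sum_range_succ']

lemma exists_taylor_bound_of_contDiffOn {φ : ℝ → ℝ} {T : ℝ} (hT : 0 < T)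
    (hφ : ContDiffOn ℝ ∞ φ (Ico 0 T)) (N : ℕ) :
    ∃ C, ∀ t ∈ Icc 0 (T / 2), |φ t - ∑ i ∈ Finset.range N,
      iteratedDerivWithin i φ (Ico 0 T) 0 * t ^ i / i.factorial| ≤ C * t ^ N := by
  have hu : UniqueDiffOn ℝ (Ico 0 T) := uniqueDiffOn_Ico 0 T
  have hsub : Icc 0 (T / 2) ⊆ Ico 0 T := Icc_subset_Ico_right (by linarith)
  have hc : ContinuousOn (iteratedDerivWithin N φ (Ico 0 T)) (Icc 0 (T / 2)) :=
    (hφ.continuousOn_iteratedDerivWithin (by exact_mod_cast le_top) hu).mono hsub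
  obtain ⟨C, hC⟩ := isCompact_Icc.exists_bound_of_continuousOn hc
  refine ⟨C / N.factorial, fun t ht => ?_⟩
  have := abs_sub_taylor_le (φ := fun i => iteratedDerivWithin i φ (Ico 0 T)) (N := N)
    (a := T / 2) (C := C) (fun i _ t ht => ?_) hC t ht
  · rw [iteratedDerivWithin_zero] at this
    refine this.trans_eq (by ring)
  · rw [iteratedDerivWithin_succ]
    exact ((hφ.differentiableOn_iteratedDerivWithin
      (by exact_mod_cast WithTop.coe_lt_top i) hu t (hsub ht)).hasDerivWithinAt).mono hsub

section Space
variable {n : ℕ}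

lemma hasDerivAt_iteratedFDeriv_smul {f : Space n → ℝ} {i : ℕ} {t : ℝ} {x : Space n}
    (hf : DifferentiableAt ℝ (iteratedFDeriv ℝ i f) (t • x)) :
    HasDerivAt (fun t : ℝ => iteratedFDeriv ℝ i f (t • x) (fun _ => x))
      (iteratedFDeriv ℝ (i + 1) f (t • x) (fun _ => x)) t := by
  have h1 := (hf.hasFDerivAt.comp_hasDerivAt t ((hasDerivAt_id t).smul_const x))
  have h2 := (ContinuousMultilinearMap.apply ℝ (fun _ : Fin i => Space n) ℝ
    (fun _ => x)).hasFDerivAt.comp_hasDerivAt t h1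
  refine h2.congr_deriv ?_
  rw [iteratedFDeriv_succ_apply_left, one_smul]
  rfl

lemma exists_taylor_bound_of_contDiffAt {f : Space n → ℝ} (hf : ContDiffAt ℝ ∞ f 0) (N : ℕ) :
    ∃ C, ∃ r > 0, ∀ x, ‖x‖ < r → |f x - ∑ i ∈ Finset.range N,
      iteratedFDeriv ℝ i f 0 (fun _ => x) / i.factorial| ≤ C * ‖x‖ ^ N := by
  have hev : ∀ᶠ x in nhds (0 : Space n), ContDiffAt ℝ (N : ℕ∞) f x :=
    (hf.of_le (by exact_mod_cast le_top)).eventually (by simp)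
  have hc : ContinuousAt (iteratedFDeriv ℝ N f) 0 :=
    hf.continuousAt_iteratedFDeriv (by exact_mod_cast le_top)
  have hb : ∀ᶠ x in nhds (0 : Space n), ‖iteratedFDeriv ℝ N f x‖
      < ‖iteratedFDeriv ℝ N f 0‖ + 1 := hc.norm.eventually_lt continuousAt_const (by simp)
  obtain ⟨r, hr, hball⟩ := Metric.eventually_nhds_iff.1 (hev.and hb)
  refine ⟨(‖iteratedFDeriv ℝ N f 0‖ + 1) / N.factorial, r, hr, fun x hx => ?_⟩
  have hmem : ∀ t ∈ Icc (0 : ℝ) 1, dist (t • x) 0 < r := fun t ht => by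
    rw [dist_zero_right, norm_smul, Real.norm_eq_abs, abs_of_nonneg ht.1]
    exact (mul_le_of_le_one_left (norm_nonneg x) ht.2).trans_lt hx
  have := abs_sub_taylor_le (φ := fun i t => iteratedFDeriv ℝ i f (t • x) (fun _ => x)) (N := N)
    (a := 1) (C := (‖iteratedFDeriv ℝ N f 0‖ + 1) * ‖x‖ ^ N) (fun i hi t ht => ?_)
    (fun t ht => ?_) 1 (by simp)
  · simpa [mul_div_right_comm] using this
  · exact (hasDerivAt_iteratedFDeriv_smul ((hball (hmem t ht)).1.differentiableAt_iteratedFDeriv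
      (by exact_mod_cast hi))).hasDerivWithinAt
  · refine ((iteratedFDeriv ℝ N f (t • x)).le_opNorm _).trans ?_
    simp only [Finset.prod_const, Finset.card_univ, Fintype.card_fin]
    have := (hball (hmem t ht)).2.le
    gcongr

/-! ### The initial region -/

/-- A region that is the subgraph of `f` near the origin is, after rescaling, a subgraph up to
`O(ε^(k+1))` of any `h` with `f(ε ξ) = ε² h(ε, ξ) + O(|ε ξ|^(k+2))`. -/
lemma isSubgraphUpTo_scaledRegion (e : CartesianCoords n) {S : Set (Space (n + 1))} {r : ℝ}
    (hr : 0 < r) {f : Space n → ℝ}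
    (hS : ∀ x ∈ Metric.ball (0 : Space n) r, ∀ z ∈ Ioo (-r) r, e.point x z ∈ S ↔ z ≤ f x)
    {k : ℕ} {h : ℝ → Space n → ℝ} (hh : PolyBigO 0 h) {C r₁ : ℝ} (hr₁ : 0 < r₁)
    (hf : ∀ ε, 0 < ε → ε ≤ 1 → ∀ ξ : Space n, ‖ε • ξ‖ < r₁ →
      |f (ε • ξ) - ε ^ 2 * h ε ξ| ≤ C * ‖ε • ξ‖ ^ (k + 2)) :
    IsSubgraphUpTo k (scaledRegion e S) h := by
  obtain ⟨D, M, hD, hD'⟩ := hh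
  obtain ⟨r₂, hr₂0, hr₂r, hr₂⟩ : ∃ r₂ > 0, r₂ ≤ r ∧ r₂ ≤ r₁ :=
    ⟨min r r₁, lt_min hr hr₁, min_le_left _ _, min_le_right _ _⟩
  set A := |C| + (r + D + 1) / r₂ ^ (k + 2) with hA
  have hA0 : 0 ≤ A := by positivity
  refine ⟨A, M + (k + 2), r, 1, hA0, hr, one_pos, le_rfl, fun ε h0 h1 ξ η hη => ?_⟩
  have hεη : |ε * η| < r := by
    rw [lt_div_iff₀ h0] at hη
    rwa [abs_mul, abs_of_pos h0, mul_comm]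
  have hw1 : 1 ≤ 1 + ‖ξ‖ := by linarith [norm_nonneg ξ]
  by_cases hξ : ‖ε • ξ‖ < r₂
  · -- the Taylor expansion is valid
    have hT := abs_le.1 (hf ε h0 h1.le ξ (hξ.trans_le hr₂))
    have hmem : (ξ, η) ∈ scaledRegion e S ε ↔ ε * η ≤ f (ε • ξ) :=
      hS (ε • ξ) (by simpa using hξ.trans_le hr₂r) (ε * η) (abs_lt.1 hεη)
    have hbound : C * ‖ε • ξ‖ ^ (k + 2)
        ≤ ε * (A * ε ^ (k + 1) * (1 + ‖ξ‖) ^ (M + (k + 2))) := by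
      rw [norm_smul, Real.norm_eq_abs, abs_of_pos h0]
      have q1 : ‖ξ‖ ^ (k + 2) ≤ (1 + ‖ξ‖) ^ (M + (k + 2)) :=
        (pow_le_pow_left₀ (norm_nonneg ξ) (by linarith) _).trans
          (pow_le_pow_right₀ hw1 (by omega))
      have q2 : |C| ≤ A := by rw [hA]; exact le_add_of_nonneg_right (by positivity)
      calc C * (ε * ‖ξ‖) ^ (k + 2) ≤ |C| * (ε * ‖ξ‖) ^ (k + 2) := by
            gcongr; exact le_abs_self C
        _ = ε * (|C| * ε ^ (k + 1) * ‖ξ‖ ^ (k + 2)) := by ring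
        _ ≤ _ := by gcongr
    rw [hmem]
    constructor
    · intro hle
      have := mul_le_mul_of_nonneg_left hle h0.le
      linarith
    · intro hlt
      have := mul_lt_mul_of_pos_left hlt h0
      linarith
  · -- the layer of uncertainty contains all heights in question
    rw [not_lt, norm_smul, Real.norm_eq_abs, abs_of_pos h0] at hξ
    have hbig : r / ε + |ε * h ε ξ| < A * ε ^ (k + 1) * (1 + ‖ξ‖) ^ (M + (k + 2)) := by
      have b1 := hD' ε h0 h1.le ξ
      rw [pow_zero, mul_one] at b1
      have hwM : 1 ≤ (1 + ‖ξ‖) ^ M := one_le_pow₀ hw1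
      have b2 : ε * (r / ε + |ε * h ε ξ|) < (r + D + 1) * (1 + ‖ξ‖) ^ M := by
        have e1 : ε * (r / ε + |ε * h ε ξ|) = r + ε * ε * |h ε ξ| := by
          rw [abs_mul, abs_of_pos h0]; field_simp
        have e2 : ε * ε * |h ε ξ| ≤ 1 * 1 * (D * (1 + ‖ξ‖) ^ M) := by gcongr
        rw [e1]
        have e3 := mul_le_mul_of_nonneg_left hwM hr.le
        linarith
      have b3 : (r + D + 1) * (1 + ‖ξ‖) ^ M
          ≤ ε * (A * ε ^ (k + 1) * (1 + ‖ξ‖) ^ (M + (k + 2))) := by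
        have p1 : (r₂ : ℝ) ^ (k + 2) ≤ (ε * (1 + ‖ξ‖)) ^ (k + 2) := by
          refine pow_le_pow_left₀ hr₂0.le (hξ.trans ?_) _
          gcongr
          linarith
        have p2 : r + D + 1 ≤ A * r₂ ^ (k + 2) := by
          rw [hA, add_mul, div_mul_cancel₀ _ (by positivity)]
          exact le_add_of_nonneg_left (by positivity)
        calc (r + D + 1) * (1 + ‖ξ‖) ^ M ≤ A * r₂ ^ (k + 2) * (1 + ‖ξ‖) ^ M := by gcongr
          _ ≤ A * (ε * (1 + ‖ξ‖)) ^ (k + 2) * (1 + ‖ξ‖) ^ M := by gcongr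
          _ = _ := by rw [mul_pow]; ring
      exact lt_of_mul_lt_mul_left (b2.trans_le b3) h0.le
    have b1 := abs_lt.1 hη
    have b2 := abs_le.1 (le_refl |ε * h ε ξ|)
    constructor
    · intro hle; linarith
    · intro hlt; linarith

lemma stageDefect_eq {m : ℕ} {γ : Fin m → ℝ} (hγ : ∑ i, γ i = 1) {h : Fin m → ℝ → Space n → ℝ}
    (hh : ∀ i, PolyBigO 0 (h i)) (hm : ∀ i ε, Measurable (h i ε)) (h' : ℝ → Space n → ℝ)
    {ε : ℝ} (h0 : 0 < ε) (h1 : ε ≤ 1) (ξ : Space n) :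
    stageDefect γ h h' ε ξ = (∑ i, γ i * ∫ y, h i ε (ξ + y) ∂gaussMeasure n) - h' ε ξ
      - ε ^ 2 / 12 * ∑ i, γ i * ∫ y, (h i ε (ξ + y) - h' ε ξ) ^ 3 ∂gaussMeasure n := by
  have hw := gaussMeasure_weight n
  have i1 : ∀ i, Integrable (fun y => h i ε (ξ + y)) (gaussMeasure n) := fun i =>
    (polyBigO_shift (hh i)).integrable_right hw h0 h1 ξ ((hm i ε).comp (by fun_prop))
  have i2 : ∀ i, Integrable (fun y => h i ε (ξ + y) - h' ε ξ) (gaussMeasure n) := fun i =>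
    (i1 i).sub (integrable_const _)
  have i3 : ∀ i, Integrable (fun y => (h i ε (ξ + y) - h' ε ξ) ^ 3) (gaussMeasure n) := fun i =>
    (((polyBigO_shift (hh i)).sub (PolyBigO.const (h' ε ξ))).pow 3).integrable_right hw h0 h1 ξ
      ((((hm i ε).comp (by fun_prop)).sub_const _).pow_const 3)
  have e : ∀ i, ∫ y, cubicPart ε (h i ε (ξ + y) - h' ε ξ) ∂gaussMeasure n
      = (∫ y, h i ε (ξ + y) ∂gaussMeasure n) - h' ε ξ
        - ε ^ 2 / 12 * ∫ y, (h i ε (ξ + y) - h' ε ξ) ^ 3 ∂gaussMeasure n := fun i => by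
    unfold cubicPart
    rw [integral_sub (i2 i) ((i3 i).const_mul _), integral_sub (i1 i) (integrable_const _),
      integral_const_mul]
    simp
  unfold stageDefect
  simp_rw [e, mul_sub, Finset.sum_sub_distrib, ← Finset.sum_mul, hγ, one_mul, Finset.mul_sum]
  congr 1
  exact Finset.sum_congr rfl fun i _ => by ring

end Space

/-! ### First order accuracy -/

section FirstOrder
variable {n : ℕ}

lemma polyBigO_multilinear {j : ℕ} (A : (Space n) [×j]→L[ℝ] ℝ) (c : ℝ) :
    PolyBigO 0 fun _ (ξ : Space n) => A (fun _ => ξ) / c := by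
  have : PolyBigO 0 fun _ (ξ : Space n) => A (fun _ => ξ) := by
    refine ⟨‖A‖, j, norm_nonneg _, fun ε _ _ ξ => ?_⟩
    rw [pow_zero, mul_one]
    refine (A.le_opNorm _).trans ?_
    simp only [Finset.prod_const, Finset.card_univ, Fintype.card_fin]
    gcongr
    linarith
  simpa [div_eq_inv_mul] using this.const_mul c⁻¹

/-- The heights that arise from the initial height `o` when each stage is replaced by the
linear combination of the averages of the earlier ones. -/
def averagedHeight (γ : ℕ → ℕ → ℝ) (o : Space n → ℝ) : ℕ → Space n → ℝ
  | 0 => o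
  | m + 1 => fun ξ => ∑ i : Fin (m + 1), γ (m + 1) i *
      ∫ y, averagedHeight γ o i (ξ + y) ∂gaussMeasure n

lemma averagedHeight_zero (γ : ℕ → ℕ → ℝ) (o : Space n → ℝ) : averagedHeight γ o 0 = o := by
  rw [averagedHeight]

lemma averagedHeight_succ (γ : ℕ → ℕ → ℝ) (o : Space n → ℝ) (m : ℕ) (ξ : Space n) :
    averagedHeight γ o (m + 1) ξ = ∑ i : Fin (m + 1), γ (m + 1) i *
      ∫ y, averagedHeight γ o i (ξ + y) ∂gaussMeasure n := by
  rw [averagedHeight]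

lemma measurable_averagedHeight (γ : ℕ → ℕ → ℝ) {o : Space n → ℝ} (ho : Measurable o) (m : ℕ) :
    Measurable (averagedHeight γ o m) := by
  induction m using Nat.strong_induction_on with
  | _ m ih =>
    rcases m with _ | m
    · rwa [averagedHeight_zero]
    · rw [funext (averagedHeight_succ γ o m)]
      refine Finset.measurable_sum _ fun i _ => Measurable.const_mul ?_ _
      have : StronglyMeasurable (Function.uncurry fun (ξ y : Space n) =>
          averagedHeight γ o i (ξ + y)) :=
        ((ih i (by omega)).comp (by fun_prop)).stronglyMeasurable
      exact this.integral_prod_right.measurable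

lemma polyBigO_averagedHeight (γ : ℕ → ℕ → ℝ) {o : Space n → ℝ} (ho : PolyBigO 0 fun _ => o)
    (m : ℕ) : PolyBigO 0 fun _ => averagedHeight γ o m := by
  induction m using Nat.strong_induction_on with
  | _ m ih =>
    rcases m with _ | m
    · rwa [averagedHeight_zero]
    · rw [funext (averagedHeight_succ γ o m)]
      exact PolyBigO.sum _ fun i => PolyBigO.const_mul
        ((polyBigO_shift (ih i (by omega))).integral (gaussMeasure_weight n)) _

lemma averagedHeight_neg (γ : ℕ → ℕ → ℝ) {o : Space n → ℝ} (ho : ∀ ξ, o (-ξ) = -o ξ) (m : ℕ)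
    (ξ : Space n) : averagedHeight γ o m (-ξ) = -averagedHeight γ o m ξ := by
  induction m using Nat.strong_induction_on generalizing ξ with
  | _ m ih =>
    rcases m with _ | m
    · rw [averagedHeight_zero, ho]
    · rw [averagedHeight_succ, averagedHeight_succ, ← Finset.sum_neg_distrib]
      refine Finset.sum_congr rfl fun i _ => ?_
      rw [← mul_neg, ← integral_neg,
        ← integral_gaussMeasure_neg fun y => averagedHeight γ o i (-ξ + y)]
      congr 1
      refine integral_congr_ae (.of_forall fun y => ?_)
      beta_reduce
      rw [← ih i (by omega), neg_add]

lemma integral_clm_gaussMeasure (L : Space n →L[ℝ] ℝ) : ∫ y, L y ∂gaussMeasure n = 0 := by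
  have := integral_gaussMeasure_neg fun y => L y
  simp_rw [map_neg, integral_neg] at this
  linarith

lemma integrable_clm_gaussMeasure (L : Space n →L[ℝ] ℝ) : Integrable L (gaussMeasure n) :=
  (((PolyBigO.clm L).comp_clm (ContinuousLinearMap.snd ℝ (Space n) (Space n))).integrable_right
    (gaussMeasure_weight n) one_pos le_rfl 0 (by simpa using L.continuous.measurable) :)

/-- The Gaussian average of a quadratic form is twice its trace, since the covariance is twice the
identity. -/
lemma integral_bilin_gaussMeasure (B : Space n →L[ℝ] Space n →L[ℝ] ℝ) :
    Integrable (fun y => B y y) (gaussMeasure n) ∧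
    ∫ y, B y y ∂gaussMeasure n = 2 * ∑ i, B (EuclideanSpace.basisFun (Fin n) ℝ i)
      (EuclideanSpace.basisFun (Fin n) ℝ i) := by
  set b := EuclideanSpace.basisFun (Fin n) ℝ
  have hB : ∀ y, B y y = ∑ i, ∑ j, B (b i) (b j) * (inner ℝ (b i) y * inner ℝ (b j) y) := by
    intro y
    conv_lhs => rw [← b.sum_repr' y]
    simp only [map_sum, map_smul, sum_apply, smul_apply,
      smul_eq_mul, Finset.mul_sum]
    rw [Finset.sum_comm]
    refine Finset.sum_congr rfl fun i _ => Finset.sum_congr rfl fun j _ => ?_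
    ring
  have hint : ∀ i j, Integrable (fun y => inner ℝ (b i) y * inner ℝ (b j) y)
      (gaussMeasure n) := fun i j => by
    have p : PolyBigO 0 fun _ (q : Space n × Space n) => inner ℝ (b i) q.2 * inner ℝ (b j) q.2 :=
      ((PolyBigO.clm (innerSL ℝ (b i))).comp_clm
        (ContinuousLinearMap.snd ℝ (Space n) (Space n))).mul
      ((PolyBigO.clm (innerSL ℝ (b j))).comp_clm (ContinuousLinearMap.snd ℝ (Space n) (Space n)))
    exact p.integrable_right (gaussMeasure_weight n) one_pos le_rfl 0 (by fun_prop)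
  simp_rw [hB]
  refine ⟨integrable_finsetSum _ fun i _ => integrable_finsetSum _ fun j _ =>
    (hint i j).const_mul _, ?_⟩
  rw [integral_finsetSum _ fun i _ => integrable_finsetSum _ fun j _ => (hint i j).const_mul _,
    Finset.mul_sum]
  refine Finset.sum_congr rfl fun i _ => ?_
  rw [integral_finsetSum _ fun j _ => (hint i j).const_mul _]
  simp_rw [integral_const_mul, gaussMeasure_moment_two, b.inner_eq_ite]
  simp
  ring

/-- The scheme is first order accurate in any dimension: to leading order, the height of each
stage is the initial one plus a constant, which grows in proportion to `β`, and the next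
correction is odd, and does not contribute on the vertical axis. -/
theorem isAccurateOfOrder_one (n : ℕ) : IsAccurateOfOrder n 1 (step gammaCoeff 4) := by
  intro S e T r f hS hT hr hf hf0 hg0 hSf
  set u := f 0 with hu
  have hmaps : MapsTo (fun x : Space n => ((0 : ℝ), x)) (Metric.ball 0 r)
      (Ico 0 T ×ˢ Metric.ball 0 r) := fun x hx => ⟨⟨le_rfl, hT⟩, hx⟩
  have hsm : ContDiffAt ℝ ∞ u 0 :=
    (hf.smooth.comp (by fun_prop) hmaps).contDiffAt (Metric.ball_mem_nhds 0 hr)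
  obtain ⟨C, r₁, hr₁, hC⟩ := exists_taylor_bound_of_contDiffAt hsm 4
  have hD : fderiv ℝ u 0 = 0 := by rw [← toDual_gradient, hg0, map_zero]
  set q : Space n → ℝ := fun ξ => iteratedFDeriv ℝ 2 u 0 (fun _ => ξ) / 2 with hq
  set o : Space n → ℝ := fun ξ => iteratedFDeriv ℝ 3 u 0 (fun _ => ξ) / 6 with ho
  have hqP : PolyBigO 0 fun _ => q := polyBigO_multilinear _ 2
  have hoP : PolyBigO 0 fun _ => o := polyBigO_multilinear _ 6
  have hqc : Continuous q := by
    have : Continuous fun ξ : Space n => (fun _ : Fin 2 => ξ) := by fun_prop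
    exact ((iteratedFDeriv ℝ 2 u 0).cont.comp this).div_const _
  have hoc : Continuous o := by
    have : Continuous fun ξ : Space n => (fun _ : Fin 3 => ξ) := by fun_prop
    exact ((iteratedFDeriv ℝ 3 u 0).cont.comp this).div_const _
  have hsmul : ∀ (j : ℕ) (ε : ℝ) (ξ : Space n), iteratedFDeriv ℝ j u 0 (fun _ => ε • ξ)
      = ε ^ j * iteratedFDeriv ℝ j u 0 (fun _ => ξ) := fun j ε ξ => by
    simpa using (iteratedFDeriv ℝ j u 0).map_smul_univ (fun _ => ε) (fun _ => ξ)
  have hodd : ∀ ξ, o (-ξ) = -o ξ := fun ξ => by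
    have := hsmul 3 (-1) ξ
    simp only [neg_smul, one_smul] at this
    simp only [ho, this]
    ring
  set Δ := Laplacian.laplacian u 0 with hΔ
  set β := beta₁ gammaCoeff with hβ
  have hqint : ∀ ξ, Integrable (fun y => q (ξ + y)) (gaussMeasure n) ∧
      ∫ y, q (ξ + y) ∂gaussMeasure n = q ξ + Δ := by
    intro ξ
    set B := fderiv ℝ (fderiv ℝ u) 0
    have hqB : ∀ ξ, q ξ = B ξ ξ / 2 := fun ξ => by rw [hq]; simp [iteratedFDeriv_two_apply, B]
    have hexp : ∀ y, q (ξ + y) = q ξ + (1 / 2 : ℝ) * (B ξ + B.flip ξ) y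
        + (1 / 2 : ℝ) * B y y := by
      intro y
      simp only [hqB, map_add, add_apply, ContinuousLinearMap.flip_apply]
      ring
    obtain ⟨j1, j2⟩ := integral_bilin_gaussMeasure B
    have j3 := (integrable_clm_gaussMeasure (B ξ + B.flip ξ)).const_mul (1 / 2 : ℝ)
    have j4 : Integrable (fun y => q ξ + (1 / 2 : ℝ) * (B ξ + B.flip ξ) y) (gaussMeasure n) :=
      (integrable_const _).add j3
    simp_rw [hexp]
    refine ⟨j4.add (j1.const_mul _), ?_⟩
    rw [integral_add j4 (j1.const_mul _), integral_add (integrable_const _) j3,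
      integral_const_mul, integral_const_mul, integral_clm_gaussMeasure, j2, hΔ,
      InnerProductSpace.laplacian_eq_iteratedFDeriv_orthonormalBasis u
        (EuclideanSpace.basisFun (Fin n) ℝ)]
    simp [iteratedFDeriv_two_apply, B]
  set h : ℕ → ℝ → Space n → ℝ := fun m ε ξ =>
    q ξ + β m * Δ + ε ^ 1 * averagedHeight gammaCoeff o m ξ with hh
  have haP := polyBigO_averagedHeight gammaCoeff hoP
  have ham := measurable_averagedHeight gammaCoeff hoc.measurable
  have hP : ∀ m, PolyBigO 0 (h m) := fun m =>
    (hqP.add (PolyBigO.const _)).add (((haP m).eps_mul 1).mono (by omega))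
  have hm : ∀ m ε, Measurable (h m ε) := fun m ε =>
    (hqc.measurable.add_const _).add ((ham m).const_mul _)
  have hdef : ∀ m < 3 + 1, PolyBigO (2 * 1) (stageDefect
      (fun i : Fin (m + 1) => gammaCoeff (m + 1) i) (fun i => h i) (h (m + 1))) := by
    intro m hm4
    have hγ := sum_gammaCoeff m hm4
    have hcub : PolyBigO 0 fun ε (ξ : Space n) => -(1 / 12) * ∑ i : Fin (m + 1),
        gammaCoeff (m + 1) i * ∫ y, (h i ε (ξ + y) - h (m + 1) ε ξ) ^ 3 ∂gaussMeasure n := by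
      refine PolyBigO.const_mul (PolyBigO.sum _ fun i => PolyBigO.const_mul ?_ _) _
      exact (((polyBigO_shift (hP i)).sub ((hP (m + 1)).comp_clm
        (ContinuousLinearMap.fst ℝ (Space n) (Space n)))).pow 3).integral (gaussMeasure_weight n)
    refine (hcub.eps_mul 2).congr fun ε h0 h1 ξ => ?_
    rw [stageDefect_eq hγ (fun i => hP i) (fun i => hm i) _ h0 h1]
    have hlin : ∑ i : Fin (m + 1), gammaCoeff (m + 1) i * ∫ y, h i ε (ξ + y) ∂gaussMeasure n
        = h (m + 1) ε ξ := by
      have hi : ∀ i, ∫ y, h i ε (ξ + y) ∂gaussMeasure n = q ξ + Δ + β i * Δ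
          + ε ^ 1 * ∫ y, averagedHeight gammaCoeff o i (ξ + y) ∂gaussMeasure n := by
        intro i
        have i1 : Integrable (fun y => averagedHeight gammaCoeff o i (ξ + y)) (gaussMeasure n) :=
          (polyBigO_shift (haP i)).integrable_right (gaussMeasure_weight n) h0 h1 ξ
            ((ham i).comp (by fun_prop))
        have i2 : Integrable (fun y => q (ξ + y) + β i * Δ) (gaussMeasure n) :=
          (hqint ξ).1.add (integrable_const _)
        simp only [hh]
        rw [integral_add i2 (i1.const_mul _), integral_add (hqint ξ).1 (integrable_const _),
          (hqint ξ).2, integral_const, probReal_univ, one_smul, integral_const_mul]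
      simp_rw [hi, mul_add, Finset.sum_add_distrib, ← Finset.sum_mul, hγ]
      simp only [hh]
      rw [averagedHeight_succ, hβ, beta₁, add_mul, Finset.sum_mul, Finset.mul_sum, one_mul, one_mul]
      have e1 : ∀ i : Fin (m + 1), gammaCoeff (m + 1) i * (beta₁ gammaCoeff i * Δ)
          = gammaCoeff (m + 1) i * beta₁ gammaCoeff i * Δ := fun i => by ring
      have e2 : ∀ i : Fin (m + 1), gammaCoeff (m + 1) i
          * (ε ^ 1 * ∫ y, averagedHeight gammaCoeff o i (ξ + y) ∂gaussMeasure n)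
          = ε ^ 1 * (gammaCoeff (m + 1) i
            * ∫ y, averagedHeight gammaCoeff o i (ξ + y) ∂gaussMeasure n) := fun i => by ring
      simp_rw [e1, e2]
      ring
    rw [hlin]
    ring
  have hinit : IsSubgraphUpTo (2 * 1) (scaledRegion e S) (h 0) := by
    refine isSubgraphUpTo_scaledRegion e hr hSf (hP 0) hr₁ (C := C) fun ε h0 h1 ξ hξ => ?_
    refine le_of_eq_of_le ?_ (hC (ε • ξ) hξ)
    congr 1
    have z0 : iteratedFDeriv ℝ 0 u 0 (fun _ => ε • ξ) = 0 := by simpa using hf0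
    have z1 : iteratedFDeriv ℝ 1 u 0 (fun _ => ε • ξ) = 0 := by
      rw [iteratedFDeriv_one_apply, hD]; rfl
    simp only [Finset.sum_range_succ, Finset.sum_range_zero, z0, z1, hsmul 2, hsmul 3, hh, hq, ho,
      averagedHeight_zero, hβ, beta₁]
    norm_num [Nat.factorial]
    ring
  have htime : ContDiffOn ℝ ∞ (fun t => f t 0) (Ico 0 T) :=
    hf.smooth.comp (f := fun t : ℝ => (t, (0 : Space n))) (by fun_prop)
      fun t ht => ⟨ht, by simpa using hr⟩
  obtain ⟨C', hC'⟩ := exists_taylor_bound_of_contDiffOn hT htime 2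
  have hspeed : iteratedDerivWithin 1 (fun t => f t 0) (Ico 0 T) 0 = Δ := by
    rw [iteratedDerivWithin_one, hf.equation 0 ⟨le_rfl, hT⟩ 0 (by simpa using hr),
      graphMeanCurvatureSpeed, ← hu, hg0]
    have : iteratedFDeriv ℝ 2 u 0 ![0, 0] = 0 := by simp [iteratedFDeriv_two_apply]
    rw [this, norm_zero]
    norm_num [hΔ]
  have hβ0 : 0 < β (3 + 1) := beta_four_pos
  refine accurate_of_heights (p := 1) (M := 3) (h := h) (u := fun t => f t 0) (by norm_num)
    sum_gammaCoeff hβ0 e hS hP hm hinit hdef (C₀ := C' * β 4 ^ 2) (ε₁ := √(T / 2 / β 4))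
    (Real.sqrt_pos.2 (div_pos (by linarith) hβ0)) fun ε h0 h1 => ?_
  have ht : β 4 * ε ^ 2 ∈ Icc 0 (T / 2) := by
    refine ⟨by positivity, ?_⟩
    have := (Real.lt_sqrt h0.le).1 h1
    rw [lt_div_iff₀ hβ0] at this
    linarith
  have key := hC' _ ht
  simp only [Finset.sum_range_succ, Finset.sum_range_zero, hspeed] at key
  have ha0 : averagedHeight gammaCoeff o 4 0 = 0 := by
    have := averagedHeight_neg gammaCoeff hodd 4 0
    rw [neg_zero] at this
    linarith
  have hq0 : q 0 = 0 := by simp [hq, iteratedFDeriv_two_apply]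
  have hf0' : f 0 0 = 0 := hf0
  rw [abs_sub_comm]
  refine le_of_eq_of_le ?_ (key.trans_eq (by ring))
  congr 1
  simp only [hh, ha0, hq0, iteratedDerivWithin_zero, hf0']
  norm_num [Nat.factorial]
  ring

end FirstOrder

/-! ### Motion by mean curvature of plane curves -/

section Partial
variable {E : Type*} [NormedAddCommGroup E] [NormedSpace ℝ E] {s : Set E} {F : E → ℝ}

/-- The derivative of `F` within `s` in the direction `w`. -/
def partialWithin (s : Set E) (w : E) (F : E → ℝ) (p : E) : ℝ := fderivWithin ℝ F s p w

lemma contDiffOn_partialWithin (hs : UniqueDiffOn ℝ s) (hF : ContDiffOn ℝ ∞ F s) (w : E) :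
    ContDiffOn ℝ ∞ (partialWithin s w F) s :=
  (hF.fderivWithin hs (by simp)).clm_apply contDiffOn_const

lemma partialWithin_congr {F' : E → ℝ} (h : ∀ p ∈ s, F p = F' p) {w p : E} (hp : p ∈ s) :
    partialWithin s w F p = partialWithin s w F' p := by
  unfold partialWithin
  rw [fderivWithin_congr h (h p hp)]

/-- Mixed partial derivatives commute, also on the boundary. -/
lemma partialWithin_comm (hs : UniqueDiffOn ℝ s) (hcl : s ⊆ closure (interior s))
    (hF : ContDiffOn ℝ ∞ F s) (v w : E) {p : E} (hp : p ∈ s) :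
    partialWithin s v (partialWithin s w F) p = partialWithin s w (partialWithin s v F) p := by
  have hd : DifferentiableWithinAt ℝ (fderivWithin ℝ F s) s p :=
    ((hF.fderivWithin hs (m := ∞) (by simp)).differentiableOn (by simp)) p hp
  have key : ∀ v w, partialWithin s v (partialWithin s w F) p
      = fderivWithin ℝ (fderivWithin ℝ F s) s p v w := fun v w => by
    unfold partialWithin
    rw [fderivWithin_clm_apply (hs p hp) hd (differentiableWithinAt_const w)]
    simp
  rw [key, key]
  exact ((hF p hp).isSymmSndFDerivWithinAt (by simpa using ENat.LEInfty.out) hs (hcl hp) hp) v w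

end Partial

section Strip
variable {T r : ℝ} {F : ℝ × ℝ → ℝ}

/-- Half open space-time strip. -/
abbrev strip (T r : ℝ) : Set (ℝ × ℝ) := Ico 0 T ×ˢ Ioo (-r) r

lemma uniqueDiffOn_strip : UniqueDiffOn ℝ (strip T r) :=
  (uniqueDiffOn_Ico 0 T).prod (uniqueDiffOn_Ioo _ _)

lemma strip_subset_closure_interior (hT : 0 < T) (hr : 0 < r) :
    strip T r ⊆ closure (interior (strip T r)) := by
  rw [interior_prod_eq, closure_prod_eq, interior_Ico, interior_Ioo, closure_Ioo hT.ne,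
    closure_Ioo (by linarith)]
  exact prod_mono Ico_subset_Icc_self Ioo_subset_Icc_self

/-- The time derivative on a strip. -/
abbrev dt (T r : ℝ) : (ℝ × ℝ → ℝ) → ℝ × ℝ → ℝ := partialWithin (strip T r) (1, 0)

/-- The space derivative on a strip. -/
abbrev dx (T r : ℝ) : (ℝ × ℝ → ℝ) → ℝ × ℝ → ℝ := partialWithin (strip T r) (0, 1)

lemma hasDerivWithinAt_dt (hF : ContDiffOn ℝ ∞ F (strip T r)) {t x : ℝ}
    (h : (t, x) ∈ strip T r) :
    HasDerivWithinAt (fun t => F (t, x)) (dt T r F (t, x)) (Ico 0 T) t := by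
  have hd := ((hF.differentiableOn (by simp)) (t, x) h).hasFDerivWithinAt
  have hline : HasDerivWithinAt (fun t : ℝ => (t, x)) (1, 0) (Ico 0 T) t :=
    (hasDerivWithinAt_id t _).prodMk (hasDerivWithinAt_const t _ x)
  have hm : MapsTo (fun t : ℝ => (t, x)) (Ico 0 T) (strip T r) := fun t' ht' => ⟨ht', h.2⟩
  exact hd.comp_hasDerivWithinAt t hline hm

lemma hasDerivAt_dx (hF : ContDiffOn ℝ ∞ F (strip T r)) {t x : ℝ} (h : (t, x) ∈ strip T r) :
    HasDerivAt (fun x => F (t, x)) (dx T r F (t, x)) x := by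
  have hd := ((hF.differentiableOn (by simp)) (t, x) h).hasFDerivWithinAt
  have hline : HasDerivWithinAt (fun x : ℝ => (t, x)) (0, 1) (Ioo (-r) r) x :=
    (hasDerivWithinAt_const x _ t).prodMk (hasDerivWithinAt_id x _)
  have hm : MapsTo (fun x : ℝ => (t, x)) (Ioo (-r) r) (strip T r) := fun x' hx' => ⟨h.1, hx'⟩
  exact (hd.comp_hasDerivWithinAt x hline hm).hasDerivAt
    (Ioo_mem_nhds h.2.1 h.2.2)

/-- The first two time derivatives, at a point where the graph is horizontal, of a solution of
`F_t = F_xx / (1 + F_x²)`. -/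
lemma dt_dt_of_curveShortening (hT : 0 < T) (hr : 0 < r) (hF : ContDiffOn ℝ ∞ F (strip T r))
    (hpde : ∀ p ∈ strip T r, dt T r F p = dx T r (dx T r F) p / (1 + dx T r F p ^ 2))
    (h1 : dx T r F (0, 0) = 0) :
    dt T r F (0, 0) = dx T r (dx T r F) (0, 0) ∧
    dt T r (dt T r F) (0, 0) = dx T r (dx T r (dx T r (dx T r F))) (0, 0)
      - 2 * dx T r (dx T r F) (0, 0) ^ 3 := by
  have hs := uniqueDiffOn_strip (T := T) (r := r)
  have hcl := strip_subset_closure_interior hT hr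
  set D₁ := dx T r F with hD₁
  set D₂ := dx T r D₁ with hD₂
  set D₃ := dx T r D₂ with hD₃
  have c₁ : ContDiffOn ℝ ∞ D₁ (strip T r) := contDiffOn_partialWithin hs hF _
  have c₂ : ContDiffOn ℝ ∞ D₂ (strip T r) := contDiffOn_partialWithin hs c₁ _
  have c₃ : ContDiffOn ℝ ∞ D₃ (strip T r) := contDiffOn_partialWithin hs c₂ _
  have ct : ContDiffOn ℝ ∞ (dt T r F) (strip T r) := contDiffOn_partialWithin hs hF _
  have cxt : ContDiffOn ℝ ∞ (dx T r (dt T r F)) (strip T r) := contDiffOn_partialWithin hs ct _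
  have h0 : ((0 : ℝ), (0 : ℝ)) ∈ strip T r := ⟨⟨le_rfl, hT⟩, by simpa using hr⟩
  have hne : ∀ y : ℝ, 1 + y ^ 2 ≠ 0 := fun y => by positivity
  refine ⟨by rw [hpde _ h0, h1]; simp, ?_⟩
  -- the time derivative of the right-hand side of the equation
  have e₁ : dt T r (dt T r F) (0, 0) = dt T r D₂ (0, 0) := by
    have hq := (hasDerivWithinAt_dt c₂ h0).div
      (((hasDerivWithinAt_dt c₁ h0).pow 2).const_add 1) (hne _)
    have hl := (hasDerivWithinAt_dt ct h0).congr (f₁ := fun t => D₂ (t, 0) / (1 + D₁ (t, 0) ^ 2))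
      (fun t ht => (hpde (t, 0) ⟨ht, h0.2⟩).symm) (hpde _ h0).symm
    rw [(uniqueDiffOn_Ico 0 T 0 ⟨le_rfl, hT⟩).eq_deriv _ hl hq]
    simp [h1]
  -- exchange of derivatives
  have e₂ : dt T r D₂ (0, 0) = dx T r (dx T r (dt T r F)) (0, 0) := by
    exact (partialWithin_comm hs hcl c₁ _ _ h0).trans
      (partialWithin_congr (fun p hp => partialWithin_comm hs hcl hF _ _ hp) h0)
  -- the second space derivative of the right-hand side of the equation
  have e₃ : ∀ x, (0, x) ∈ strip T r → dx T r (dt T r F) (0, x)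
      = (D₃ (0, x) * (1 + D₁ (0, x) ^ 2) - D₂ (0, x) * (2 * D₁ (0, x) * D₂ (0, x)))
        / (1 + D₁ (0, x) ^ 2) ^ 2 := by
    intro x hx
    have hq := (hasDerivAt_dx c₂ hx).div (((hasDerivAt_dx c₁ hx).pow 2).const_add 1) (hne _)
    have hl : HasDerivAt (fun x => D₂ (0, x) / (1 + D₁ (0, x) ^ 2)) (dx T r (dt T r F) (0, x)) x :=
      (hasDerivAt_dx ct hx).congr_of_eventuallyEq (by
        filter_upwards [Ioo_mem_nhds hx.2.1 hx.2.2] with y hy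
        exact (hpde (0, y) ⟨hx.1, hy⟩).symm)
    rw [hl.unique hq]
    simp only [Pi.pow_apply, Nat.cast_ofNat, Nat.add_one_sub_one, pow_one]
    rfl
  have e₄ : dx T r (dx T r (dt T r F)) (0, 0) = dx T r D₃ (0, 0) - 2 * D₂ (0, 0) ^ 3 := by
    have d₁ := hasDerivAt_dx c₁ h0
    have d₂ := hasDerivAt_dx c₂ h0
    have d₃ := hasDerivAt_dx c₃ h0
    have hn := (d₃.mul ((d₁.pow 2).const_add 1)).sub (d₂.mul ((d₁.const_mul 2).mul d₂))
    have hq := hn.div (((d₁.pow 2).const_add 1).pow 2) (pow_ne_zero 2 (hne _))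
    have hl := (hasDerivAt_dx cxt h0).congr_of_eventuallyEq (f₁ := fun x =>
      (D₃ (0, x) * (1 + D₁ (0, x) ^ 2) - D₂ (0, x) * (2 * D₁ (0, x) * D₂ (0, x)))
        / (1 + D₁ (0, x) ^ 2) ^ 2) (by
        filter_upwards [Ioo_mem_nhds h0.2.1 h0.2.2] with y hy
        exact (e₃ y ⟨h0.1, hy⟩).symm)
    rw [hl.unique hq]
    simp [h1]
    ring
  rw [e₁, e₂, e₄]

end Strip

/-- The unit vector of the line. -/
def axis : Space 1 := EuclideanSpace.basisFun (Fin 1) ℝ 0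

lemma smul_axis (ξ : Space 1) : ξ 0 • axis = ξ := by
  ext i
  fin_cases i
  simp [axis]

lemma norm_axis : ‖axis‖ = 1 := (EuclideanSpace.basisFun (Fin 1) ℝ).norm_eq_one 0

section CurveShortening
variable {T r : ℝ} {f : ℝ → Space 1 → ℝ}

/-- A function of time and of a point of the line, as a function of two real variables. -/
def onStrip (f : ℝ → Space 1 → ℝ) (p : ℝ × ℝ) : ℝ := f p.1 (p.2 • axis)

lemma smul_axis_mem_ball {x : ℝ} : x • axis ∈ Metric.ball (0 : Space 1) r ↔ x ∈ Ioo (-r) r := by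
  rw [mem_ball_zero_iff, norm_smul, norm_axis, mul_one, Real.norm_eq_abs, abs_lt]
  rfl

lemma IsGraphMotionByMeanCurvature.contDiffOn_onStrip (hf : IsGraphMotionByMeanCurvature T r f) :
    ContDiffOn ℝ ∞ (onStrip f) (strip T r) :=
  hf.smooth.comp (f := fun p : ℝ × ℝ => (p.1, p.2 • axis)) (by fun_prop)
    fun p hp => ⟨hp.1, smul_axis_mem_ball.2 hp.2⟩

lemma IsGraphMotionByMeanCurvature.contDiffAt_slice (hf : IsGraphMotionByMeanCurvature T r f)
    {t : ℝ} (ht : t ∈ Ico 0 T) {x : Space 1} (hx : x ∈ Metric.ball 0 r) :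
    ContDiffAt ℝ ∞ (f t) x :=
  (hf.smooth.comp (f := fun x : Space 1 => (t, x)) (s := Metric.ball 0 r) (by fun_prop)
    fun _ hx => ⟨ht, hx⟩).contDiffAt (Metric.isOpen_ball.mem_nhds hx)

lemma contDiffOn_dx_iterate (hf : IsGraphMotionByMeanCurvature T r f) (i : ℕ) :
    ContDiffOn ℝ ∞ ((dx T r)^[i] (onStrip f)) (strip T r) := by
  induction i with
  | zero => exact hf.contDiffOn_onStrip
  | succ i ih =>
    rw [Function.iterate_succ_apply']
    exact contDiffOn_partialWithin uniqueDiffOn_strip ih _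

lemma iteratedFDeriv_axis (hf : IsGraphMotionByMeanCurvature T r f) (i : ℕ) {t x : ℝ}
    (h : (t, x) ∈ strip T r) : iteratedFDeriv ℝ i (f t) (x • axis) (fun _ => axis)
      = (dx T r)^[i] (onStrip f) (t, x) := by
  induction i generalizing x with
  | zero => simp [onStrip]
  | succ i ih =>
    have h1 := hasDerivAt_iteratedFDeriv_smul
      ((hf.contDiffAt_slice h.1 (smul_axis_mem_ball.2 h.2)).differentiableAt_iteratedFDeriv
        (m := i) (by exact_mod_cast WithTop.coe_lt_top i))
    have h2 := hasDerivAt_dx (contDiffOn_dx_iterate hf i) h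
    rw [Function.iterate_succ_apply']
    refine h1.unique (h2.congr_of_eventuallyEq ?_)
    filter_upwards [Ioo_mem_nhds h.2.1 h.2.2] with y hy
    exact ih ⟨h.1, hy⟩

lemma gradient_eq_smul_axis (u : Space 1 → ℝ) (x : Space 1) :
    ∇ u x = iteratedFDeriv ℝ 1 u x (fun _ => axis) • axis := by
  rw [← smul_axis (∇ u x), iteratedFDeriv_one_apply, ← inner_gradient_left]
  congr 1
  rw [axis, EuclideanSpace.basisFun_apply, EuclideanSpace.inner_single_right]
  simp

/-- In one dimension the equation is `f_t = f_xx / (1 + f_x²)`. -/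
lemma graphMeanCurvatureSpeed_line (u : Space 1 → ℝ) (x : Space 1) :
    graphMeanCurvatureSpeed u x = iteratedFDeriv ℝ 2 u x (fun _ => axis)
      / (1 + iteratedFDeriv ℝ 1 u x (fun _ => axis) ^ 2) := by
  have hvec : ∀ v : Space 1, ![v, v] = fun _ => v := fun v => by
    ext1 i; fin_cases i <;> rfl
  rw [graphMeanCurvatureSpeed, InnerProductSpace.laplacian_eq_iteratedFDeriv_orthonormalBasis u
    (EuclideanSpace.basisFun (Fin 1) ℝ), gradient_eq_smul_axis]
  set g := iteratedFDeriv ℝ 1 u x (fun _ => axis)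
  have h2 : iteratedFDeriv ℝ 2 u x ![g • axis, g • axis]
      = g ^ 2 * iteratedFDeriv ℝ 2 u x (fun _ => axis) := by
    rw [hvec]
    simpa using (iteratedFDeriv ℝ 2 u x).map_smul_univ (fun _ => g) (fun _ => axis)
  rw [h2, norm_smul, norm_axis, mul_one, Real.norm_eq_abs, sq_abs]
  simp only [Finset.univ_unique, Fin.default_eq_zero, Finset.sum_singleton, hvec]
  change ((1 + g ^ 2) * iteratedFDeriv ℝ 2 u x (fun _ => axis) - _) / _ = _
  congr 1
  ring

/-- The expansions, in space and in time, of a moving curve at a point where it is horizontal. -/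
lemma IsGraphMotionByMeanCurvature.exists_expansion (hf : IsGraphMotionByMeanCurvature T r f)
    (hT : 0 < T) (hr : 0 < r) (hf0 : f 0 0 = 0) (hg0 : ∇ (f 0) 0 = 0) :
    ∃ κ c q e : ℝ,
      (∃ C, ∃ r₁ > 0, ∀ ξ : Space 1, ‖ξ‖ < r₁ → |f 0 ξ - (κ * ξ 0 ^ 2 / 2 + c * ξ 0 ^ 3 / 6
        + q * ξ 0 ^ 4 / 24 + e * ξ 0 ^ 5 / 120)| ≤ C * ‖ξ‖ ^ 6) ∧
      ∃ C, ∀ t ∈ Icc 0 (T / 2),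
        |f t 0 - (κ * t + (q - 2 * κ ^ 3) * t ^ 2 / 2)| ≤ C * t ^ 3 := by
  have h0 : ((0 : ℝ), (0 : ℝ)) ∈ strip T r := ⟨⟨le_rfl, hT⟩, by simpa using hr⟩
  have hF := hf.contDiffOn_onStrip
  have hdt : ∀ t x, (t, x) ∈ strip T r →
      derivWithin (fun t => f t (x • axis)) (Ico 0 T) t = dt T r (onStrip f) (t, x) :=
    fun t x h => (hasDerivWithinAt_dt hF h).derivWithin (uniqueDiffOn_Ico 0 T t h.1)
  have hpde : ∀ p ∈ strip T r, dt T r (onStrip f) p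
      = dx T r (dx T r (onStrip f)) p / (1 + dx T r (onStrip f) p ^ 2) := by
    rintro ⟨t, x⟩ h
    rw [← hdt t x h, hf.equation t h.1 _ (smul_axis_mem_ball.2 h.2), graphMeanCurvatureSpeed_line,
      iteratedFDeriv_axis hf 1 h, iteratedFDeriv_axis hf 2 h]
    rfl
  have h1 : dx T r (onStrip f) (0, 0) = 0 := by
    have := iteratedFDeriv_axis hf 1 h0
    rw [zero_smul, iteratedFDeriv_one_apply, ← inner_gradient_left, hg0, inner_zero_left] at this
    exact this.symm
  obtain ⟨t1, t2⟩ := dt_dt_of_curveShortening hT hr hF hpde h1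
  have hD : ∀ i, iteratedFDeriv ℝ i (f 0) 0 (fun _ => axis)
      = (dx T r)^[i] (onStrip f) (0, 0) := fun i => by
    have := iteratedFDeriv_axis hf i h0
    rwa [zero_smul] at this
  refine ⟨(dx T r)^[2] (onStrip f) (0, 0), (dx T r)^[3] (onStrip f) (0, 0),
    (dx T r)^[4] (onStrip f) (0, 0), (dx T r)^[5] (onStrip f) (0, 0), ?_, ?_⟩
  · obtain ⟨C, r₁, hr₁, hC⟩ := exists_taylor_bound_of_contDiffAt
      (hf.contDiffAt_slice ⟨le_rfl, hT⟩ (Metric.mem_ball_self hr)) 6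
    refine ⟨C, r₁, hr₁, fun ξ hξ => le_of_eq_of_le ?_ (hC ξ hξ)⟩
    have hco : ∀ i, iteratedFDeriv ℝ i (f 0) 0 (fun _ => ξ)
        = ξ 0 ^ i * (dx T r)^[i] (onStrip f) (0, 0) := fun i => by
      conv_lhs => rw [← smul_axis ξ]
      rw [← hD]
      simpa using (iteratedFDeriv ℝ i (f 0) 0).map_smul_univ (fun _ => ξ 0) (fun _ => axis)
    have z0 : (dx T r)^[0] (onStrip f) (0, 0) = 0 := by simpa [onStrip] using hf0
    have z1 : (dx T r)^[1] (onStrip f) (0, 0) = 0 := h1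
    simp only [hco, Finset.sum_range_succ, Finset.sum_range_zero, z0, z1]
    congr 1
    norm_num [Nat.factorial]
    ring
  · have htime : ContDiffOn ℝ ∞ (fun t => f t 0) (Ico 0 T) :=
      hf.smooth.comp (f := fun t : ℝ => (t, (0 : Space 1))) (by fun_prop)
        fun t ht => ⟨ht, by simpa using hr⟩
    obtain ⟨C, hC⟩ := exists_taylor_bound_of_contDiffOn hT htime 3
    refine ⟨C, fun t ht => le_of_eq_of_le ?_ (hC t ht)⟩
    have s1 : ∀ t ∈ Ico 0 T, iteratedDerivWithin 1 (fun t => f t 0) (Ico 0 T) t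
        = dt T r (onStrip f) (t, 0) := fun t ht => by
      rw [iteratedDerivWithin_one, ← hdt t 0 ⟨ht, h0.2⟩, zero_smul]
    have s2 : iteratedDerivWithin 2 (fun t => f t 0) (Ico 0 T) 0
        = dt T r (dt T r (onStrip f)) (0, 0) := by
      rw [iteratedDerivWithin_succ, derivWithin_congr s1 (s1 0 ⟨le_rfl, hT⟩)]
      exact (hasDerivWithinAt_dt (contDiffOn_partialWithin uniqueDiffOn_strip hF _) h0).derivWithin
        (uniqueDiffOn_Ico 0 T 0 ⟨le_rfl, hT⟩)
    simp only [Finset.sum_range_succ, Finset.sum_range_zero, s2, s1 0 ⟨le_rfl, hT⟩, t1, t2,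
      iteratedDerivWithin_zero, hf0]
    congr 1
    simp only [Function.iterate_succ, Function.iterate_zero, Function.comp_apply, id]
    norm_num [Nat.factorial]

end CurveShortening

/-! ### Second order accuracy in the plane -/

/-- The height of a stage up to `O(ε⁴)`, in terms of the derivatives `κ, c, q, e` of orders two to
five of the initial height, and of the coefficients of the stage. -/
def lineHeight (κ c q e β δ b P Q ε x : ℝ) : ℝ :=
  κ * (x ^ 2 / 2 + β) + ε * (c * (x ^ 3 / 6 + β * x))
    + ε ^ 2 * (q * (x ^ 4 / 24 + β * x ^ 2 / 2 + δ) + κ ^ 3 * (-(β * x ^ 2) + b))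
    + ε ^ 3 * (e * (x ^ 5 / 120 + β * x ^ 3 / 6 + δ * x) + κ ^ 2 * c * (P * x ^ 3 + Q * x))

/-- The coefficient of `ε³ f_xx² f_xxx x³` in the height of the `m`-th stage. -/
def mixedCubicCoeff (γ : ℕ → ℕ → ℝ) : ℕ → ℝ
  | 0 => 0
  | m + 1 => ∑ i : Fin (m + 1), γ (m + 1) i *
      (mixedCubicCoeff γ i - 3 - (beta₁ γ i - beta₁ γ (m + 1)))

/-- The coefficient of `ε³ f_xx² f_xxx x` in the height of the `m`-th stage. -/
def mixedLinearCoeff (γ : ℕ → ℕ → ℝ) : ℕ → ℝ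
  | 0 => 0
  | m + 1 => ∑ i : Fin (m + 1), γ (m + 1) i *
      (6 * mixedCubicCoeff γ i + mixedLinearCoeff γ i
        - (35 + 13 * (beta₁ γ i - beta₁ γ (m + 1)) + 3 * (beta₁ γ i - beta₁ γ (m + 1)) ^ 2
          + (beta₁ γ i - beta₁ γ (m + 1)) ^ 3
          + beta₁ γ i * (12 + 4 * (beta₁ γ i - beta₁ γ (m + 1)))) / 4)

lemma PolyBigO.div_const {E : Type*} [NormedAddCommGroup E] {k : ℕ} {f : ℝ → E → ℝ}
    (hf : PolyBigO k f) (c : ℝ) : PolyBigO k fun ε x => f ε x / c := by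
  simpa [div_eq_inv_mul] using hf.const_mul c⁻¹

lemma polyBigO_lineHeight {E : Type*} [NormedAddCommGroup E] (κ c q e β δ b P Q : ℝ)
    {x : ℝ → E → ℝ} (hx : PolyBigO 0 x) :
    PolyBigO 0 fun ε p => lineHeight κ c q e β δ b P Q ε (x ε p) := by
  have hε : PolyBigO (E := E) 0 fun ε _ => ε := by simpa using (PolyBigO.eps 1).mono (zero_le_one)
  unfold lineHeight
  repeat' first
    | exact PolyBigO.const _
    | exact hx
    | exact hε
    | refine PolyBigO.add ?_ ?_
    | refine PolyBigO.neg ?_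
    | refine PolyBigO.div_const ?_ _
    | refine PolyBigO.pow ?_ _
    | refine PolyBigO.mul₀ ?_ ?_

/-- The part of order at least two of the difference of two heights. -/
def lineHeightTail (κ q e c β δ b P Q β' δ' b' P' Q' ε x s : ℝ) : ℝ :=
  (q * ((x + s) ^ 4 / 24 + β * (x + s) ^ 2 / 2 + δ) + κ ^ 3 * (-(β * (x + s) ^ 2) + b)
      - (q * (x ^ 4 / 24 + β' * x ^ 2 / 2 + δ') + κ ^ 3 * (-(β' * x ^ 2) + b')))
    + ε * (e * ((x + s) ^ 5 / 120 + β * (x + s) ^ 3 / 6 + δ * (x + s))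
        + κ ^ 2 * c * (P * (x + s) ^ 3 + Q * (x + s))
      - (e * (x ^ 5 / 120 + β' * x ^ 3 / 6 + δ' * x) + κ ^ 2 * c * (P' * x ^ 3 + Q' * x)))

/-- The leading part of the difference of two heights. -/
def lineHeightLead (κ β β' x s : ℝ) : ℝ := κ * (x * s + s ^ 2 / 2 + (β - β'))

/-- The first order part of the difference of two heights. -/
def lineHeightNext (c β β' x s : ℝ) : ℝ :=
  c * (x ^ 2 * s / 2 + x * s ^ 2 / 2 + s ^ 3 / 6 + (β - β') * x + β * s)

lemma lineHeight_sub (κ c q e β δ b P Q β' δ' b' P' Q' ε x s : ℝ) :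
    lineHeight κ c q e β δ b P Q ε (x + s) - lineHeight κ c q e β' δ' b' P' Q' ε x
      = lineHeightLead κ β β' x s + ε * lineHeightNext c β β' x s
        + ε ^ 2 * lineHeightTail κ q e c β δ b P Q β' δ' b' P' Q' ε x s := by
  unfold lineHeight lineHeightLead lineHeightNext lineHeightTail
  ring

/-- The error in replacing the cube of a difference of heights by its part of order below two. -/
def lineHeightCubeRest (κ c q e β δ b P Q β' δ' b' P' Q' ε x s : ℝ) : ℝ :=
  3 * lineHeightLead κ β β' x s * lineHeightNext c β β' x s ^ 2
    + ε * lineHeightNext c β β' x s ^ 3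
    + lineHeightTail κ q e c β δ b P Q β' δ' b' P' Q' ε x s
      * (3 * (lineHeightLead κ β β' x s + ε * lineHeightNext c β β' x s) ^ 2
        + 3 * (lineHeightLead κ β β' x s + ε * lineHeightNext c β β' x s)
          * (ε ^ 2 * lineHeightTail κ q e c β δ b P Q β' δ' b' P' Q' ε x s)
        + (ε ^ 2 * lineHeightTail κ q e c β δ b P Q β' δ' b' P' Q' ε x s) ^ 2)

lemma lineHeight_sub_cube (κ c q e β δ b P Q β' δ' b' P' Q' ε x s : ℝ) :
    (lineHeight κ c q e β δ b P Q ε (x + s) - lineHeight κ c q e β' δ' b' P' Q' ε x) ^ 3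
      = (lineHeightLead κ β β' x s ^ 3
          + ε * (3 * lineHeightLead κ β β' x s ^ 2 * lineHeightNext c β β' x s))
        + ε ^ 2 * lineHeightCubeRest κ c q e β δ b P Q β' δ' b' P' Q' ε x s := by
  rw [lineHeight_sub]
  unfold lineHeightCubeRest
  ring

lemma polyBigO_lineHeightCubeRest {E : Type*} [NormedAddCommGroup E]
    (κ c q e β δ b P Q β' δ' b' P' Q' : ℝ) {x s : ℝ → E → ℝ} (hx : PolyBigO 0 x)
    (hs : PolyBigO 0 s) : PolyBigO 0 fun ε p =>
      lineHeightCubeRest κ c q e β δ b P Q β' δ' b' P' Q' ε (x ε p) (s ε p) := by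
  have hε : PolyBigO (E := E) 0 fun ε _ => ε := by simpa using (PolyBigO.eps 1).mono (zero_le_one)
  have h1 : PolyBigO 0 fun ε p => lineHeightLead κ β β' (x ε p) (s ε p) := by
    unfold lineHeightLead
    repeat' first
      | exact PolyBigO.const _ | exact hx | exact hs | refine PolyBigO.add ?_ ?_
      | refine PolyBigO.div_const ?_ _ | refine PolyBigO.pow ?_ _ | refine PolyBigO.mul₀ ?_ ?_
  have h2 : PolyBigO 0 fun ε p => lineHeightNext c β β' (x ε p) (s ε p) := by
    unfold lineHeightNext
    repeat' first
      | exact PolyBigO.const _ | exact hx | exact hs | refine PolyBigO.add ?_ ?_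
      | refine PolyBigO.div_const ?_ _ | refine PolyBigO.pow ?_ _ | refine PolyBigO.mul₀ ?_ ?_
  have h3 : PolyBigO 0 fun ε p =>
      lineHeightTail κ q e c β δ b P Q β' δ' b' P' Q' ε (x ε p) (s ε p) := by
    unfold lineHeightTail
    repeat' first
      | exact PolyBigO.const _ | exact hx | exact hs | exact hε | refine PolyBigO.add ?_ ?_
      | refine PolyBigO.sub ?_ ?_ | refine PolyBigO.neg ?_
      | refine PolyBigO.div_const ?_ _ | refine PolyBigO.pow ?_ _ | refine PolyBigO.mul₀ ?_ ?_
  unfold lineHeightCubeRest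
  repeat' first
    | exact PolyBigO.const _ | exact h1 | exact h2 | exact h3 | exact hε
    | refine PolyBigO.add ?_ ?_ | refine PolyBigO.pow ?_ _ | refine PolyBigO.mul₀ ?_ ?_

lemma integral_coord {G : ℝ → ℝ} (hG : Continuous G) :
    ∫ y, G (y 0) ∂gaussMeasure 1 = ∫ s, G s ∂gaussianReal 0 2 := by
  have h : ∀ y : Space 1, inner ℝ axis y = y 0 := fun y => by
    rw [axis, EuclideanSpace.basisFun_apply, EuclideanSpace.inner_single_left]
    simp
  rw [← gaussMeasure_map_dual axis norm_axis, integral_map (by fun_prop)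
    hG.measurable.aestronglyMeasurable]
  simp_rw [h]

/-- The Gaussian average of a height. -/
lemma integral_lineHeight (κ c q e β δ b P Q ε x : ℝ) :
    ∫ y, lineHeight κ c q e β δ b P Q ε (x + y 0) ∂gaussMeasure 1
      = lineHeight κ c q e β δ b P Q ε x
        + (κ + ε * (c * x) + ε ^ 2 * (q * (x ^ 2 / 2 + β) - 2 * κ ^ 3 * β)
          + ε ^ 3 * (e * (x ^ 3 / 6 + β * x) + 6 * κ ^ 2 * c * P * x))
        + (ε ^ 2 * q + ε ^ 3 * (e * x)) / 2 := by
  rw [integral_coord (G := fun s => lineHeight κ c q e β δ b P Q ε (x + s))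
    (by unfold lineHeight; fun_prop)]
  -- the coefficients of the powers of `s`
  have := integral_polynomial_gaussianReal (lineHeight κ c q e β δ b P Q ε x)
    (κ * x + ε * (c * (x ^ 2 / 2 + β)) + ε ^ 2 * (q * (x ^ 3 / 6 + β * x) - 2 * κ ^ 3 * β * x)
      + ε ^ 3 * (e * (x ^ 4 / 24 + β * x ^ 2 / 2 + δ) + κ ^ 2 * c * (3 * P * x ^ 2 + Q)))
    ((κ + ε * (c * x) + ε ^ 2 * (q * (x ^ 2 / 2 + β) - 2 * κ ^ 3 * β)
          + ε ^ 3 * (e * (x ^ 3 / 6 + β * x) + 6 * κ ^ 2 * c * P * x)) / 2)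
    ((ε * c + ε ^ 2 * q * x + ε ^ 3 * (e * (x ^ 2 / 2 + β) + 6 * κ ^ 2 * c * P)) / 6)
    ((ε ^ 2 * q + ε ^ 3 * (e * x)) / 24) (ε ^ 3 * e / 120) 0 0
  refine Eq.trans (integral_congr_ae (.of_forall fun s => ?_)) (this.trans ?_)
  · unfold lineHeight
    ring
  · ring

/-- The Gaussian average of the cube of a difference of heights, below order two. -/
lemma integral_lineHeight_cube (κ c β β' ε x : ℝ) :
    ∫ y, (lineHeightLead κ β β' x (y 0) ^ 3 + ε * (3 * lineHeightLead κ β β' x (y 0) ^ 2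
        * lineHeightNext c β β' x (y 0))) ∂gaussMeasure 1
      = κ ^ 3 * (x ^ 2 * (18 + 6 * (β - β')) + 15 + 9 * (β - β') + 3 * (β - β') ^ 2
          + (β - β') ^ 3)
        + ε * (3 * κ ^ 2 * c * (x ^ 3 * (12 + 4 * (β - β'))
          + x * (35 + 13 * (β - β') + 3 * (β - β') ^ 2 + (β - β') ^ 3
            + β * (12 + 4 * (β - β'))))) := by
  rw [integral_coord (G := fun s => lineHeightLead κ β β' x s ^ 3
    + ε * (3 * lineHeightLead κ β β' x s ^ 2 * lineHeightNext c β β' x s))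
    (by unfold lineHeightLead lineHeightNext; fun_prop)]
  obtain ⟨d, hd⟩ : ∃ d, β - β' = d := ⟨_, rfl⟩
  obtain ⟨k, hk⟩ : ∃ k, ε * (3 * κ ^ 2 * c) = k := ⟨_, rfl⟩
  -- the coefficients of the powers of `s`
  have := integral_polynomial_gaussianReal
    (κ ^ 3 * d ^ 3 + k * (d ^ 3 * x))
    (κ ^ 3 * (3 * d ^ 2 * x) + k * (d ^ 2 * (x ^ 2 / 2 + β) + 2 * d ^ 2 * x ^ 2))
    (κ ^ 3 * (3 * d * x ^ 2 + 3 * d ^ 2 / 2)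
      + k * (d ^ 2 * x / 2 + 2 * d * x * (x ^ 2 / 2 + β) + (x ^ 2 + d) * d * x))
    (κ ^ 3 * (x ^ 3 + 3 * d * x)
      + k * (d ^ 2 / 6 + d * x ^ 2 + (x ^ 2 + d) * (x ^ 2 / 2 + β) + d * x ^ 2))
    (κ ^ 3 * (3 * x ^ 2 / 2 + 3 * d / 4)
      + k * (d * x / 3 + (x ^ 2 + d) * x / 2 + x * (x ^ 2 / 2 + β) + d * x / 4))
    (κ ^ 3 * (3 * x / 4) + k * ((x ^ 2 + d) / 6 + x ^ 2 / 2 + (x ^ 2 / 2 + β) / 4))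
    (κ ^ 3 / 8 + k * (x / 6 + x / 8)) (k / 24)
  refine Eq.trans (integral_congr_ae (.of_forall fun s => ?_)) (this.trans ?_)
  · simp only [lineHeightLead, lineHeightNext, hd, ← hk]
    ring
  · rw [hd, ← hk]
    ring

/-- Weighted averages of affine functions of five sequences. -/
lemma sum_affine_combination {m : ℕ} {γ : Fin m → ℝ} (hγ : ∑ i, γ i = 1) (a₀ a₁ a₂ a₃ a₄ a₅ : ℝ)
    (u₁ u₂ u₃ u₄ u₅ : Fin m → ℝ) :
    ∑ i, γ i * (a₀ + a₁ * u₁ i + a₂ * u₂ i + a₃ * u₃ i + a₄ * u₄ i + a₅ * u₅ i)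
      = a₀ + a₁ * ∑ i, γ i * u₁ i + a₂ * ∑ i, γ i * u₂ i + a₃ * ∑ i, γ i * u₃ i
        + a₄ * ∑ i, γ i * u₄ i + a₅ * ∑ i, γ i * u₅ i := by
  have : ∀ i, γ i * (a₀ + a₁ * u₁ i + a₂ * u₂ i + a₃ * u₃ i + a₄ * u₄ i + a₅ * u₅ i)
      = γ i * a₀ + a₁ * (γ i * u₁ i) + a₂ * (γ i * u₂ i) + a₃ * (γ i * u₃ i)
        + a₄ * (γ i * u₄ i) + a₅ * (γ i * u₅ i) := fun i => by ring
  simp_rw [this, Finset.sum_add_distrib, ← Finset.mul_sum, ← Finset.sum_mul, hγ, one_mul]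

/-- The height of the `m`-th stage. -/
def stageHeight (γ : ℕ → ℕ → ℝ) (κ c q e : ℝ) (m : ℕ) : ℝ → ℝ → ℝ :=
  lineHeight κ c q e (beta₁ γ m) (biharmonicCoeff γ m) (curvatureCubeCoeff γ m)
    (mixedCubicCoeff γ m) (mixedLinearCoeff γ m)

/-- The coefficients of the stages are such that the stage equation holds up to `O(ε⁴)`. -/
lemma stageHeight_recursion {γ : ℕ → ℕ → ℝ} {m : ℕ} (hγ : ∑ i : Fin (m + 1), γ (m + 1) i = 1)
    (κ c q e ε x : ℝ) :
    ∑ i : Fin (m + 1), γ (m + 1) i *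
      ((∫ y, stageHeight γ κ c q e i ε (x + y 0) ∂gaussMeasure 1) - ε ^ 2 / 12 *
        ∫ y, (lineHeightLead κ (beta₁ γ i) (beta₁ γ (m + 1)) x (y 0) ^ 3
          + ε * (3 * lineHeightLead κ (beta₁ γ i) (beta₁ γ (m + 1)) x (y 0) ^ 2
            * lineHeightNext c (beta₁ γ i) (beta₁ γ (m + 1)) x (y 0))) ∂gaussMeasure 1)
      = stageHeight γ κ c q e (m + 1) ε x := by
  obtain ⟨β', hβ'⟩ : ∃ β', beta₁ γ (m + 1) = β' := ⟨_, rfl⟩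
  have s₁ : ∑ i : Fin (m + 1), γ (m + 1) i * beta₁ γ i = β' - 1 := by
    rw [← hβ', beta₁]; ring
  have s₂ : ∑ i : Fin (m + 1), γ (m + 1) i * (beta₁ γ i + biharmonicCoeff γ i)
      = biharmonicCoeff γ (m + 1) - 1 / 2 := by rw [biharmonicCoeff]; ring
  have s₃ := (curvatureCubeCoeff.eq_2 γ m).symm
  have s₄ := (mixedCubicCoeff.eq_2 γ m).symm
  have s₅ := (mixedLinearCoeff.eq_2 γ m).symm
  rw [hβ'] at s₃ s₄ s₅
  -- `u₂, …, u₅` are the summands in the recursions of the four coefficients after `β`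
  have key := sum_affine_combination hγ
    (κ * (x ^ 2 / 2 + 1) + ε * (c * (x ^ 3 / 6 + x))
      + ε ^ 2 * (q * (x ^ 4 / 24 + x ^ 2 / 2 + 1 / 2) - κ ^ 3 * x ^ 2 * (3 / 2 - β' / 2))
      + ε ^ 3 * (e * (x ^ 5 / 120 + x ^ 3 / 6 + x / 2)))
    (κ + ε * (c * x) + ε ^ 2 * (q * x ^ 2 / 2 - 3 / 2 * κ ^ 3 * x ^ 2) + ε ^ 3 * (e * x ^ 3 / 6))
    (ε ^ 2 * q + ε ^ 3 * (e * x)) (ε ^ 2 * κ ^ 3) (ε ^ 3 * (κ ^ 2 * c * x ^ 3))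
    (ε ^ 3 * (κ ^ 2 * c * x)) (fun i : Fin (m + 1) => beta₁ γ i)
    (fun i => beta₁ γ i + biharmonicCoeff γ i)
    (fun i => curvatureCubeCoeff γ i - 2 * beta₁ γ i
      - (15 + 9 * (beta₁ γ i - β') + 3 * (beta₁ γ i - β') ^ 2 + (beta₁ γ i - β') ^ 3) / 12)
    (fun i => mixedCubicCoeff γ i - 3 - (beta₁ γ i - β'))
    (fun i => 6 * mixedCubicCoeff γ i + mixedLinearCoeff γ i
        - (35 + 13 * (beta₁ γ i - β') + 3 * (beta₁ γ i - β') ^ 2 + (beta₁ γ i - β') ^ 3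
          + beta₁ γ i * (12 + 4 * (beta₁ γ i - β'))) / 4)
  rw [s₁, s₂, s₃, s₄, s₅] at key
  rw [hβ']
  refine Eq.trans (Finset.sum_congr rfl fun i _ => ?_) (key.trans ?_)
  · rw [integral_lineHeight_cube, stageHeight, integral_lineHeight, lineHeight]
    ring
  · rw [stageHeight, lineHeight, hβ']
    ring

/-- The scheme is second order accurate in the plane: with the given coefficients, the height of
the last stage agrees with the solution up to `O(δt³)`. -/
theorem isAccurateOfOrder_two : IsAccurateOfOrder 1 2 (step gammaCoeff 4) := by
  intro S E T r f hS hT hr hf hf0 hg0 hSf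
  obtain ⟨κ, c, q, e, ⟨C, r₁, hr₁, hC⟩, C', hC'⟩ := hf.exists_expansion hT hr hf0 hg0
  set h : ℕ → ℝ → Space 1 → ℝ := fun m ε ξ => stageHeight gammaCoeff κ c q e m ε (ξ 0) with hh
  have hcoord : PolyBigO 0 fun _ (ξ : Space 1) => ξ 0 := by
    simpa using PolyBigO.clm (EuclideanSpace.proj (0 : Fin 1) : Space 1 →L[ℝ] ℝ)
  have hP : ∀ m, PolyBigO 0 (h m) := fun m => polyBigO_lineHeight _ _ _ _ _ _ _ _ _ hcoord
  have hm : ∀ m ε, Measurable (h m ε) := fun m ε => by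
    simp only [hh, stageHeight, lineHeight]
    fun_prop
  have hdef : ∀ m < 3 + 1, PolyBigO (2 * 2) (stageDefect
      (fun i : Fin (m + 1) => gammaCoeff (m + 1) i) (fun i => h i) (h (m + 1))) := by
    intro m hm4
    have hγ := sum_gammaCoeff m hm4
    set rest : ℕ → ℝ → Space 1 × Space 1 → ℝ := fun i ε p =>
      lineHeightCubeRest κ c q e (beta₁ gammaCoeff i) (biharmonicCoeff gammaCoeff i)
        (curvatureCubeCoeff gammaCoeff i) (mixedCubicCoeff gammaCoeff i)
        (mixedLinearCoeff gammaCoeff i) (beta₁ gammaCoeff (m + 1))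
        (biharmonicCoeff gammaCoeff (m + 1)) (curvatureCubeCoeff gammaCoeff (m + 1))
        (mixedCubicCoeff gammaCoeff (m + 1)) (mixedLinearCoeff gammaCoeff (m + 1)) ε
        (p.1 0) (p.2 0) with hrest
    have hrP : ∀ i, PolyBigO 0 (rest i) := fun i =>
      polyBigO_lineHeightCubeRest _ _ _ _ _ _ _ _ _ _ _ _ _ _
        (hcoord.comp_clm (ContinuousLinearMap.fst ℝ (Space 1) (Space 1)))
        (hcoord.comp_clm (ContinuousLinearMap.snd ℝ (Space 1) (Space 1)))
    have hsum : PolyBigO 0 fun ε (ξ : Space 1) => -(1 / 12) * ∑ i : Fin (m + 1),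
        gammaCoeff (m + 1) i * ∫ y, rest i ε (ξ, y) ∂gaussMeasure 1 :=
      PolyBigO.const_mul (PolyBigO.sum Finset.univ fun i : Fin (m + 1) => PolyBigO.const_mul
        ((hrP i).integral (gaussMeasure_weight 1)) (gammaCoeff (m + 1) i)) _
    refine (hsum.eps_mul 4).congr fun ε h0 h1 ξ => ?_
    rw [stageDefect_eq hγ (fun i => hP i) (fun i => hm i) _ h0 h1]
    set main : ℕ → Space 1 → ℝ := fun i y =>
      lineHeightLead κ (beta₁ gammaCoeff i) (beta₁ gammaCoeff (m + 1)) (ξ 0) (y 0) ^ 3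
      + ε * (3 * lineHeightLead κ (beta₁ gammaCoeff i) (beta₁ gammaCoeff (m + 1)) (ξ 0) (y 0) ^ 2
        * lineHeightNext c (beta₁ gammaCoeff i) (beta₁ gammaCoeff (m + 1)) (ξ 0) (y 0)) with hmain
    have hcube : ∀ i y, (h i ε (ξ + y) - h (m + 1) ε ξ) ^ 3
        = main i y + ε ^ 2 * rest i ε (ξ, y) := fun i y =>
      lineHeight_sub_cube _ _ _ _ _ _ _ _ _ _ _ _ _ _ _ _ _
    have hirest : ∀ i, Integrable (fun y => rest i ε (ξ, y)) (gaussMeasure 1) := fun i =>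
      (hrP i).integrable_right (gaussMeasure_weight 1) h0 h1 ξ (by
        simp only [hrest, lineHeightCubeRest, lineHeightLead, lineHeightNext, lineHeightTail]
        fun_prop)
    have himain : ∀ i, Integrable (main i) (gaussMeasure 1) := fun i => by
      have hi : Integrable (fun y => (h i ε (ξ + y) - h (m + 1) ε ξ) ^ 3) (gaussMeasure 1) :=
        (((polyBigO_shift (hP i)).sub (PolyBigO.const (h (m + 1) ε ξ))).pow 3).integrable_right
          (gaussMeasure_weight 1) h0 h1 ξ
          ((((hm i ε).comp (by fun_prop)).sub_const _).pow_const 3)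
      refine (hi.sub ((hirest i).const_mul (ε ^ 2))).congr (.of_forall fun y => ?_)
      simp only [Pi.sub_apply, hcube]
      ring
    have hint : ∀ i, ∫ y, (h i ε (ξ + y) - h (m + 1) ε ξ) ^ 3 ∂gaussMeasure 1
        = (∫ y, main i y ∂gaussMeasure 1) + ε ^ 2 * ∫ y, rest i ε (ξ, y) ∂gaussMeasure 1 :=
      fun i => by
        simp_rw [hcube]
        rw [integral_add (himain i) ((hirest i).const_mul _), integral_const_mul]
    have hrec : ∑ i : Fin (m + 1), gammaCoeff (m + 1) i *
        ((∫ y, h i ε (ξ + y) ∂gaussMeasure 1) - ε ^ 2 / 12 * ∫ y, main i y ∂gaussMeasure 1)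
        = h (m + 1) ε ξ := stageHeight_recursion hγ κ c q e ε (ξ 0)
    simp_rw [hint]
    rw [← hrec]
    simp_rw [mul_add, mul_sub, Finset.sum_add_distrib, Finset.sum_sub_distrib]
    have e1 : ∑ i : Fin (m + 1), gammaCoeff (m + 1) i *
        (ε ^ 2 / 12 * ∫ y, main i y ∂gaussMeasure 1)
        = ε ^ 2 / 12 * ∑ i : Fin (m + 1), gammaCoeff (m + 1) i * ∫ y, main i y ∂gaussMeasure 1 := by
      rw [Finset.mul_sum]
      exact Finset.sum_congr rfl fun i _ => by ring
    have e2 : ∑ i : Fin (m + 1), gammaCoeff (m + 1) i *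
        (ε ^ 2 * ∫ y, rest i ε (ξ, y) ∂gaussMeasure 1)
        = ε ^ 2 * ∑ i : Fin (m + 1), gammaCoeff (m + 1) i
          * ∫ y, rest i ε (ξ, y) ∂gaussMeasure 1 := by
      rw [Finset.mul_sum]
      exact Finset.sum_congr rfl fun i _ => by ring
    rw [e1, e2]
    ring
  have hinit : IsSubgraphUpTo (2 * 2) (scaledRegion E S) (h 0) := by
    refine isSubgraphUpTo_scaledRegion E hr hSf (hP 0) hr₁ (C := C) fun ε h0 h1 ξ hξ => ?_
    refine le_of_eq_of_le ?_ (hC (ε • ξ) hξ)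
    congr 1
    simp only [hh, stageHeight, lineHeight, beta₁, biharmonicCoeff, curvatureCubeCoeff,
      mixedCubicCoeff, mixedLinearCoeff, PiLp.smul_apply, smul_eq_mul]
    ring
  set β := beta₁ gammaCoeff 4 with hβ
  have hβ0 : 0 < β := beta_four_pos
  refine accurate_of_heights (p := 2) (M := 3) (h := h) (u := fun t => f t 0) (by norm_num)
    sum_gammaCoeff hβ0 E hS hP hm hinit hdef (C₀ := C' * β ^ 3) (ε₁ := √(T / 2 / β))
    (Real.sqrt_pos.2 (div_pos (by linarith) hβ0)) fun ε h0 h1 => ?_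
  have ht : β * ε ^ 2 ∈ Icc 0 (T / 2) := by
    refine ⟨by positivity, ?_⟩
    have := (Real.lt_sqrt h0.le).1 h1
    rw [lt_div_iff₀ hβ0] at this
    linarith
  rw [abs_sub_comm]
  refine le_of_eq_of_le ?_ ((hC' _ ht).trans_eq (by ring))
  congr 1
  have hlast : h (3 + 1) ε 0 = lineHeight κ c q e β (β ^ 2 / 2) (-β ^ 2)
      (mixedCubicCoeff gammaCoeff 4) (mixedLinearCoeff gammaCoeff 4) ε 0 := by
    rw [hβ, ← biharmonicCoeff_four, ← curvatureCubeCoeff_four]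
    rfl
  rw [hlast, lineHeight]
  change f (β * ε ^ 2) 0 - _ = _
  ring

end ThresholdDynamics

end

theorem mainTheorem3 :
    -- unconditional energy stability in any dimension
    (∀ (d : ℕ) (δt : ℝ), 0 < δt →
      ∀ S : Set (ThresholdDynamics.Space d), MeasurableSet S → ∀ k : ℕ,
        ThresholdDynamics.energy
            (ThresholdDynamics.kernelTime ThresholdDynamics.gammaCoeff 4 δt)
            ((ThresholdDynamics.step ThresholdDynamics.gammaCoeff 4 δt)^[k + 1] S) ≤
          ThresholdDynamics.energy
            (ThresholdDynamics.kernelTime ThresholdDynamics.gammaCoeff 4 δt)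
            ((ThresholdDynamics.step ThresholdDynamics.gammaCoeff 4 δt)^[k] S)) ∧
    -- first order accuracy in any dimension
    (∀ n : ℕ, ThresholdDynamics.IsAccurateOfOrder n 1
      (ThresholdDynamics.step ThresholdDynamics.gammaCoeff 4)) ∧
    -- second order accuracy in two dimensions
    ThresholdDynamics.IsAccurateOfOrder 1 2
      (ThresholdDynamics.step ThresholdDynamics.gammaCoeff 4) :=
  ⟨fun _ _ hδ _ hS k => ThresholdDynamics.energy_iterate_step_le hδ hS k,
    ThresholdDynamics.isAccurateOfOrder_one, ThresholdDynamics.isAccurateOfOrder_two⟩
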